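/- Let $N\ge 2$, $s\in(0,1)$, $a=1-2s$, and write $X=(x,y)\in\mathbb R^N\times\mathbb R$. For $x_0\in\mathbb R^N$ put $X_0=(x_0,0)$, let $B_r(X_0)$ be the open ball of $\mathbb R^{N+1}$ and $B_r^+(X_0)=B_r(X_0)\cap\{y>0\}$. For open $\Omega\subset\{y>0\}$, $H^{1;a}(\Omega)$ is the space of weakly differentiable $v$ with $\int_\Omega y^a(v^2+|\nabla v|^2)\,dx\,dy<\infty$. Let $\mathbb S^N_+=\{|X|=1,\ y>0\}$ with surface measure $\sigma$, let $\mathbb S^{N-1}=\{|X|=1,\ y=0\}$ be its boundary, and let $H^{1;a}(\mathbb S^N_+)$ be the space of functions $u$ on $\mathbb S^N_+$ with a weak tangential gradient $\nabla_T u$ and $\int_{\mathbb S^N_+}y^a(u^2+|\nabla_Tu|^2)\,d\sigma<\infty$. For each open (possibly empty) $\omega\subset\mathbb S^{N-1}$ let $$\lambda_1^s(\omega)=\inf\left\{\frac{\int_{\mathbb S^N_+}y^a|\nabla_Tu|^2\,d\sigma}{\int_{\mathbb S^N_+}y^au^2\,d\sigma}:\ 0\ne u\in H^{1;a}(\mathbb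 S^N_+),\ u\equiv0\text{ on }\mathbb S^{N-1}\setminus\omega\right\},$$ where $u\equiv0$ on $\mathbb S^{N-1}\setminus\omega$ means that $u$ is a limit in $H^{1;a}(\mathbb S^N_+)$ of functions of this space that are continuous on $\overline{\mathbb S^N_+}$ and vanish at every point of $\mathbb S^{N-1}\setminus\omega$. Put $$\gamma(t)=\sqrt{\Big(\tfrac{N-2s}2\Big)^2+t}-\tfrac{N-2s}2,\qquad \nu_{ACF}=\inf\left\{\frac{\gamma(\lambda_1^s(\omega_1))+\gamma(\lambda_1^s(\omega_2))}2:\ \omega_1,\omega_2\subset\mathbb S^{N-1}\text{ open},\ \omega_1\cap\omega_2=\emptyset\right\}.$$ Let $R>0$, and let $v_1,v_2\in H^{1;a}(B_R^+(X_0))$ be continuous on $B_R(X_0)\cap\{y\ge0\}$ and such that * $v_1v_2=0$ on $B_R(X_0)\cap\{y=0\}$, and $v_1(X_0)=v_2(X_0)=0$; * for $i=1,2$ and every non-negative $\phi\in C_0^\infty(B_R(X_0))$, $$\int_{B_R^+(X_0)}y^a\,\nabla v_i\cdot\nabla(v_i\phi)\,dx\,dy\le0 .$$ Then for every $r\in(0,R)$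 and $i=1,2$ the integral $\int_{B_r^+(X_0)}y^a|\nabla v_i|^2|X-X_0|^{2s-N}\,dx\,dy$ is finite, and the function $$\Phi(r)=\prod_{i=1}^2\frac1{r^{2\nu_{ACF}}}\int_{B_r^+(X_0)}y^a\frac{|\nabla v_i|^2}{|X-X_0|^{N-2s}}\,dx\,dy$$ is monotone non-decreasing on $(0,R)$. -/

import Mathlib

open MeasureTheory Filter Topology Set Metric
open scoped ContDiff Gradient InnerProductSpace

namespace FracACF

noncomputable section

/-! ### The half-space and weighted Sobolev functions on its open subsets -/

/-- The space `ℝ^{N+1}`, whose points are `X = (x, y)` with `x ∈ ℝ^N` and `y ∈ ℝ`. -/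
abbrev Space (N : ℕ) : Type := EuclideanSpace ℝ (Fin (N + 1))

/-- The last coordinate `y` of `X = (x, y)`. -/
def yCoord {N : ℕ} (X : Space N) : ℝ := X (Fin.last N)

/-- The point `(x, 0)`. -/
def flatPoint {N : ℕ} (x : EuclideanSpace ℝ (Fin N)) : Space N :=
  WithLp.toLp 2 (Fin.snoc (α := fun _ => ℝ) (fun j => x j) 0)

/-- The weight `y^a` with `a = 1 - 2s`; it is only used where `y > 0`. -/
def weight {N : ℕ} (s : ℝ) (X : Space N) : ℝ := yCoord X ^ (1 - 2 * s)

/-- The open half ball `B_r^+(X₀) = B_r(X₀) ∩ {y > 0}`. -/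
def halfBall {N : ℕ} (X₀ : Space N) (r : ℝ) : Set (Space N) := ball X₀ r ∩ {X | 0 < yCoord X}

/-- `G` is a weak (distributional) gradient of `v` in the open set `Ω`. -/
def IsWeakGrad {N : ℕ} (Ω : Set (Space N)) (v : Space N → ℝ) (G : Space N → Space N) : Prop :=
  LocallyIntegrableOn v Ω ∧ LocallyIntegrableOn G Ω ∧
    ∀ φ : Space N → ℝ, ContDiff ℝ ∞ φ → HasCompactSupport φ → tsupport φ ⊆ Ω →
      ∫ X in Ω, v X • ∇ φ X = - ∫ X in Ω, φ X • G X

open Classical in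
/-- The weak gradient of `v` in `Ω` (unique up to null sets of `Ω`); zero if there is none. -/
def weakGrad {N : ℕ} (Ω : Set (Space N)) (v : Space N → ℝ) : Space N → Space N :=
  if h : ∃ G, IsWeakGrad Ω v G then h.choose else 0

theorem isWeakGrad_weakGrad {N : ℕ} {Ω : Set (Space N)} {v : Space N → ℝ}
    (h : ∃ G, IsWeakGrad Ω v G) : IsWeakGrad Ω v (weakGrad Ω v) := by
  rw [weakGrad, dif_pos h]
  exact h.choose_spec

/-- `v ∈ H^{1;a}(Ω)`, for an open set `Ω ⊆ {y > 0}`. -/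
def MemH1a {N : ℕ} (s : ℝ) (Ω : Set (Space N)) (v : Space N → ℝ) : Prop :=
  (∃ G, IsWeakGrad Ω v G) ∧
    IntegrableOn (fun X => weight s X * (v X ^ 2 + ‖weakGrad Ω v X‖ ^ 2)) Ω

/-! ### Weighted Sobolev functions on the upper half sphere -/

/-- The unit sphere `𝕊^N` of `ℝ^{N+1}`. -/
abbrev Sph (N : ℕ) : Type := sphere (0 : Space N) 1

/-- The open upper half sphere `𝕊^N_+ = 𝕊^N ∩ {y > 0}`. -/
def hemisphere (N : ℕ) : Set (Sph N) := {ξ | 0 < yCoord (ξ : Space N)}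

/-- The closed upper half sphere `𝕊^N ∩ {y ≥ 0}`. -/
def closedHemisphere (N : ℕ) : Set (Sph N) := {ξ | 0 ≤ yCoord (ξ : Space N)}

/-- The equator `𝕊^{N-1} = ∂𝕊^N_+ = 𝕊^N ∩ {y = 0}`, with the subspace topology. -/
abbrev Equator (N : ℕ) : Type := {ξ : Sph N // yCoord (ξ : Space N) = 0}

/-- The surface measure `σ` on `𝕊^N`. -/
def surf (N : ℕ) : Measure (Sph N) := (volume : Measure (Space N)).toSphere

/-- The tangential divergence on `𝕊^N`, at `ξ`, of a field `F` that is tangent to `𝕊^N`: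
the trace of `DF(ξ)` over the tangent space `ξ^⊥`. -/
def tangDiv {N : ℕ} (F : Space N → Space N) (ξ : Sph N) : ℝ :=
  LinearMap.trace ℝ (Space N) (fderiv ℝ F (ξ : Space N)).toLinearMap
    - ⟪fderiv ℝ F (ξ : Space N) (ξ : Space N), (ξ : Space N)⟫_ℝ

/-- `G` is a weak tangential gradient of `u` on `𝕊^N_+`: a tangent field with
`∫ u div_T F dσ = - ∫ G · F dσ` for all smooth tangent fields `F` compactly supported in the open
half sphere. -/
def IsWeakTangGrad {N : ℕ} (u : Sph N → ℝ) (G : Sph N → Space N) : Prop :=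
  LocallyIntegrableOn u (hemisphere N) (surf N) ∧
  LocallyIntegrableOn G (hemisphere N) (surf N) ∧
  (∀ ξ : Sph N, ⟪G ξ, (ξ : Space N)⟫_ℝ = 0) ∧
    ∀ F : Space N → Space N, ContDiff ℝ ∞ F → HasCompactSupport F →
      tsupport F ⊆ {X | 0 < yCoord X} → (∀ ξ : Sph N, ⟪F ξ, (ξ : Space N)⟫_ℝ = 0) →
      ∫ ξ in hemisphere N, u ξ * tangDiv F ξ ∂(surf N)
        = - ∫ ξ in hemisphere N, ⟪G ξ, F ξ⟫_ℝ ∂(surf N)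

open Classical in
/-- The tangential gradient `∇_T u` on `𝕊^N_+` (unique up to null sets of `𝕊^N_+`); zero if there
is none. -/
def tangGrad {N : ℕ} (u : Sph N → ℝ) : Sph N → Space N :=
  if h : ∃ G, IsWeakTangGrad u G then h.choose else 0

theorem isWeakTangGrad_tangGrad {N : ℕ} {u : Sph N → ℝ} (h : ∃ G, IsWeakTangGrad u G) :
    IsWeakTangGrad u (tangGrad u) := by
  rw [tangGrad, dif_pos h]
  exact h.choose_spec

/-- `u ∈ H^{1;a}(𝕊^N_+)`. -/
def MemH1aSph {N : ℕ} (s : ℝ) (u : Sph N → ℝ) : Prop :=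
  (∃ G, IsWeakTangGrad u G) ∧
    IntegrableOn (fun ξ : Sph N => weight s (ξ : Space N) * (u ξ ^ 2 + ‖tangGrad u ξ‖ ^ 2))
      (hemisphere N) (surf N)

/-- `u ≡ 0` on `𝕊^{N-1} \ W`, in the Sobolev sense: `u` is the limit in `H^{1;a}(𝕊^N_+)` of
functions of `H^{1;a}(𝕊^N_+)` that are continuous up to the equator and vanish at every point of
`𝕊^{N-1} \ W`. -/
def VanishesOff {N : ℕ} (s : ℝ) (W : Set (Equator N)) (u : Sph N → ℝ) : Prop :=
  ∃ w : ℕ → Sph N → ℝ,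
    (∀ n, MemH1aSph s (w n) ∧ ContinuousOn (w n) (closedHemisphere N) ∧
      ∀ ξ : Equator N, ξ ∉ W → w n ξ = 0) ∧
    Tendsto (fun n => ∫ ξ in hemisphere N, weight s (ξ : Space N) *
      ((w n ξ - u ξ) ^ 2 + ‖tangGrad (w n) ξ - tangGrad u ξ‖ ^ 2) ∂(surf N)) atTop (𝓝 0)

/-! ### The first eigenvalue and the exponent `ν_ACF` -/

/-- The first `s`-eigenvalue `λ_1^s(W)`: the infimum of the Rayleigh quotients of the nonzero
`u ∈ H^{1;a}(𝕊^N_+)` with `u ≡ 0` on `𝕊^{N-1} \ W`. -/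
def lambda1 {N : ℕ} (s : ℝ) (W : Set (Equator N)) : ℝ :=
  sInf {q : ℝ | ∃ u : Sph N → ℝ, MemH1aSph s u ∧ VanishesOff s W u ∧
    0 < ∫ ξ in hemisphere N, weight s (ξ : Space N) * u ξ ^ 2 ∂(surf N) ∧
    q = (∫ ξ in hemisphere N, weight s (ξ : Space N) * ‖tangGrad u ξ‖ ^ 2 ∂(surf N)) /
        (∫ ξ in hemisphere N, weight s (ξ : Space N) * u ξ ^ 2 ∂(surf N))}

/-- `γ(t) = √(((N - 2s)/2)² + t) - (N - 2s)/2`. -/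
def gam (N : ℕ) (s t : ℝ) : ℝ :=
  Real.sqrt ((((N : ℝ) - 2 * s) / 2) ^ 2 + t) - ((N : ℝ) - 2 * s) / 2

/-- `ν_ACF`: the infimum of `(γ(λ_1^s(W₁)) + γ(λ_1^s(W₂))) / 2` over the pairs of disjoint (possibly
empty) open subsets of `𝕊^{N-1}`. -/
def nuACF (N : ℕ) (s : ℝ) : ℝ :=
  sInf {q : ℝ | ∃ W₁ W₂ : Set (Equator N), IsOpen W₁ ∧ IsOpen W₂ ∧ Disjoint W₁ W₂ ∧
    q = (gam N s (lambda1 s W₁) + gam N s (lambda1 s W₂)) / 2}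

/-! ### The functional -/

/-- The integrand `y^a |∇v|² / |X - X₀|^{N-2s}`, where `∇v` is the weak gradient of `v` in `Ω`. -/
def acfDensity {N : ℕ} (s : ℝ) (Ω : Set (Space N)) (X₀ : Space N) (v : Space N → ℝ)
    (X : Space N) : ℝ :=
  weight s X * (‖weakGrad Ω v X‖ ^ 2 / ‖X - X₀‖ ^ ((N : ℝ) - 2 * s))

end

end FracACF

open FracACF

/-!
The functional is a product `r^{-4ν} J₁(r) J₂(r)` with `J_i(r) = ∫_0^r ρ ∫ y^a |∇v_i|² dσ dρ` in
polar coordinates `X = X₀ + ρ ξ`, the inner integral being over the upper half sphere of radius `ρ`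
rescaled to radius one. It is non-decreasing once `r J_i' ≥ 2 γ_i J_i` for almost every `r` with
`γ₁ + γ₂ ≥ 2 ν_ACF`; here `γ_i = γ(λ_1^s(W_i))`, and `W_i` is the open set of the points of the
equator where the rescaled function `v_i(X₀ + r ·)` does not vanish
(`monotoneOn_rpow_mul_integral`). Since `v₁ v₂ = 0` on `{y = 0}`, the sets `W₁` and `W₂` are
disjoint, and `γ₁ + γ₂ ≥ 2 ν_ACF` is the definition of `ν_ACF` (`nuACF_le`).

The inequality for a single function `v` (`FiniteEnergy.two_gam_mul_integral_le`) combines two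
facts. Put `m = N - 2s`, and let `H(r) = ∫ y^a v²` and `F(r) = ∫ y^a v ∂_r v` be the mass and the
flux on the sphere of radius `r`, again rescaled to radius one.

* Upper bound for `J` (`FiniteEnergy.energy_le`): `J(r) ≤ r F(r) + (m/2) H(r)`. Testing the
  differential inequality with radial functions gives `∫_0^r D ≤ E` for
  `D = r^{m+1} ∫ y^a |∇v|²` and `E = r^{m+1} F`. Since `H' = 2F`, the bound follows from
  integrating `r^{-m} D` by parts (`weighted_energy_le`); this also proves that `J` is finite. The
  terms at the inner end of the interval have the favourable sign, so that no approximation of the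
  singular weight `|X - X₀|^{2s-N}` is needed.
* Lower bound for `J'`: the tangential part of `r ∇v` is a weak tangential gradient of the slice
  `v(X₀ + r ·)` for almost every `r` (`FiniteEnergy.ae_isWeakTangGrad`), so the slice is a
  competitor for `λ_1^s(W)`, and `r² ∫ y^a |∇v|² ≥ r² ∫ y^a (∂_r v)² + λ_1^s(W) H`.

Finally `r² (∂_r v)² + γ² v² ≥ 2 γ r v ∂_r v` and `γ² + m γ = λ_1^s(W)` give `r J' ≥ 2 γ J`.

That almost every slice has a weak tangential gradient rests on the separability of the space of
test fields: the identity defining a weak gradient, tested with `h(|X - X₀|) F((X - X₀)/|X - X₀|)`,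
holds on almost every sphere for a fixed field `F`, hence on almost every sphere for all the fields
of a countable dense family at once, and by density for all of them.
-/

namespace FracACF

/-! ### Polar coordinates on half balls -/

/-- Polar coordinates centred at `X₀`: the point at distance `p.1` from `X₀` in direction `p.2`. -/
def polar {N : ℕ} (X₀ : Space N) (p : ℝ × Sph N) : Space N := X₀ + p.1 • (p.2 : Space N)

/-- The surface measure of the open upper half sphere. -/
noncomputable def surfPos (N : ℕ) : Measure (Sph N) := (surf N).restrict (hemisphere N)

/-- The radial measure `r^N dr` on `(0, R)`. -/
noncomputable def radial (N : ℕ) (R : ℝ) : Measure ℝ :=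
  (volume.restrict (Ioo 0 R)).withDensity (fun r => ENNReal.ofReal (r ^ N))

instance (N : ℕ) : IsFiniteMeasure (surf N) := by unfold surf; infer_instance

instance (N : ℕ) : IsFiniteMeasure (surfPos N) := by unfold surfPos; infer_instance

instance (N : ℕ) (R : ℝ) : SigmaFinite (radial N R) := by unfold radial; infer_instance

variable {N : ℕ}

theorem continuous_polar (X₀ : Space N) : Continuous (polar X₀) := by
  unfold polar; fun_prop

theorem continuous_yCoord : Continuous (yCoord : Space N → ℝ) := by
  unfold yCoord; fun_prop

@[simp] theorem yCoord_add (X Y : Space N) : yCoord (X + Y) = yCoord X + yCoord Y := rfl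

@[simp] theorem yCoord_smul (c : ℝ) (X : Space N) : yCoord (c • X) = c * yCoord X := rfl

theorem yCoord_flatPoint (x : EuclideanSpace ℝ (Fin N)) : yCoord (flatPoint x) = 0 := by
  simp [yCoord, flatPoint, Fin.snoc]

theorem isOpen_hemisphere : IsOpen (hemisphere N) :=
  isOpen_lt continuous_const (continuous_yCoord.comp continuous_subtype_val)

theorem isOpen_halfBall (X₀ : Space N) (R : ℝ) : IsOpen (halfBall X₀ R) :=
  isOpen_ball.inter (isOpen_lt continuous_const continuous_yCoord)

theorem norm_sph (ξ : Sph N) : ‖(ξ : Space N)‖ = 1 := by simp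

theorem polar_mem_halfBall {X₀ : Space N} (h₀ : yCoord X₀ = 0) {R r : ℝ} {ξ : Sph N}
    (hr : 0 < r) : polar X₀ (r, ξ) ∈ halfBall X₀ R ↔ r < R ∧ ξ ∈ hemisphere N := by
  simp [halfBall, polar, hemisphere, norm_smul, abs_of_pos hr, h₀, hr]

/-- The radial measure on the subtype `(0, ∞)` of Mathlib's polar decomposition, moved to `ℝ`. -/
theorem map_coe_volumeIoiPow (n : ℕ) :
    Measure.map Subtype.val (Measure.volumeIoiPow n) =
      (volume.restrict (Ioi (0 : ℝ))).withDensity (fun r => ENNReal.ofReal (r ^ n)) := by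
  ext s hs
  rw [Measure.map_apply measurable_subtype_coe hs, Measure.volumeIoiPow,
    withDensity_apply _ (measurable_subtype_coe hs), withDensity_apply _ hs,
    setLIntegral_subtype measurableSet_Ioi _ (fun a : ℝ => ENNReal.ofReal (a ^ n)),
    Measure.restrict_restrict hs, Subtype.image_preimage_coe, inter_comm]

/-- Polar coordinates around `X₀` in the whole space, as an identity of measures; this is Mathlib's
homeomorphism `X ↦ (X / |X|, |X|)` read backwards and translated. -/
theorem map_polar (X₀ : Space N) :
    Measure.map (polar X₀) (((volume.restrict (Ioi (0 : ℝ))).withDensity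
      (fun r => ENNReal.ofReal (r ^ N))).prod (surf N)) = (volume : Measure (Space N)) := by
  have h1 := ((volume : Measure (Space N)).measurePreserving_homeomorphUnitSphereProd).symm
    (homeomorphUnitSphereProd (Space N)).toMeasurableEquiv
  have h2 := (measurePreserving_subtype_coe (μa := (volume : Measure (Space N)))
    (measurableSet_singleton (0 : Space N)).compl).comp h1
  have hd : Module.finrank ℝ (Space N) - 1 = N := by simp
  rw [hd, restrict_compl_singleton] at h2
  have h3 : (volume.restrict (Ioi (0 : ℝ))).withDensity (fun r => ENNReal.ofReal (r ^ N))
      = Measure.map Subtype.val (Measure.volumeIoiPow N) := (map_coe_volumeIoiPow N).symm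
  have h4 := (measurePreserving_add_left (volume : Measure (Space N)) X₀).comp h2
  have : SigmaFinite (Measure.map Subtype.val (Measure.volumeIoiPow N)) := by
    rw [map_coe_volumeIoiPow]; infer_instance
  have h5 := Measure.map_prod_map (Measure.volumeIoiPow N) (surf N)
    (f := Subtype.val) (g := id) measurable_subtype_coe measurable_id
  rw [h3]
  rw [Measure.map_id] at h5
  rw [h5, ← Measure.prod_swap, Measure.map_map (by fun_prop) measurable_swap,
    Measure.map_map (continuous_polar X₀).measurable (by fun_prop)]
  exact h4.map_eq

/-- Polar coordinates turn `r^N dr ⊗ σ` on `(0, R) × 𝕊^N_+` into Lebesgue measure on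
`B_R^+(X₀)`. -/
theorem measurePreserving_polar {X₀ : Space N} (h₀ : yCoord X₀ = 0) (R : ℝ) :
    MeasurePreserving (polar X₀) ((radial N R).prod (surfPos N))
      (volume.restrict (halfBall X₀ R)) := by
  refine ⟨(continuous_polar X₀).measurable, ?_⟩
  rw [← map_polar X₀, Measure.restrict_map (continuous_polar X₀).measurable
    (isOpen_halfBall X₀ R).measurableSet]
  congr 1
  have e1 : (volume.restrict (Ioi (0 : ℝ))).withDensity (fun r => ENNReal.ofReal (r ^ N))
      = (volume.withDensity (fun r => ENNReal.ofReal (r ^ N))).restrict (Ioi 0) :=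
    (restrict_withDensity measurableSet_Ioi _).symm
  have e2 : radial N R
      = (volume.withDensity (fun r => ENNReal.ofReal (r ^ N))).restrict (Ioo 0 R) :=
    (restrict_withDensity measurableSet_Ioo _).symm
  have e3 : ((volume.withDensity (fun r => ENNReal.ofReal (r ^ N))).restrict (Ioi 0)).prod (surf N)
      = ((volume.withDensity (fun r => ENNReal.ofReal (r ^ N))).prod (surf N)).restrict
        (Ioi 0 ×ˢ univ) := by
    rw [← Measure.prod_restrict, Measure.restrict_univ]
  rw [e1, e2, surfPos, Measure.prod_restrict, e3, Measure.restrict_restrict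
    ((isOpen_halfBall X₀ R).preimage (continuous_polar X₀)).measurableSet]
  congr 1
  ext ⟨r, ξ⟩
  constructor
  · rintro ⟨⟨h1, h2⟩, h3⟩
    exact ⟨(polar_mem_halfBall (R := R) h₀ (ξ := ξ) h1).2 ⟨h2, h3⟩, h1, trivial⟩
  · rintro ⟨h1, h2, -⟩
    have h2' : 0 < r := h2
    have := (polar_mem_halfBall h₀ h2').1 h1
    exact ⟨⟨h2, this.1⟩, this.2⟩

theorem radial_absolutelyContinuous (N : ℕ) (R : ℝ) :
    radial N R ≪ volume.restrict (Ioo 0 R) := withDensity_absolutelyContinuous _ _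

theorem absolutelyContinuous_radial (N : ℕ) (R : ℝ) :
    volume.restrict (Ioo 0 R) ≪ radial N R := by
  refine withDensity_absolutelyContinuous' (by fun_prop) ?_
  filter_upwards [ae_restrict_mem measurableSet_Ioo] with r hr
  simpa using pow_pos hr.1 N

/-- Lebesgue measure on `(0, R)` times surface measure on `𝕊^N_+`. It has the null sets of
`r^N dr ⊗ σ`, and Fubini's theorem applies to it without the Jacobian. -/
noncomputable def cyl (N : ℕ) (R : ℝ) : Measure (ℝ × Sph N) :=
  (volume.restrict (Ioo 0 R)).prod (surfPos N)

theorem cyl_eq (N : ℕ) (R : ℝ) :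
    (radial N R).prod (surfPos N) = (cyl N R).withDensity (fun p => ENNReal.ofReal (p.1 ^ N)) := by
  rw [cyl, radial, prod_withDensity_left (by fun_prop)]

theorem quasiMeasurePreserving_polar {X₀ : Space N} (h₀ : yCoord X₀ = 0) (R : ℝ) :
    Measure.QuasiMeasurePreserving (polar X₀) (cyl N R) (volume.restrict (halfBall X₀ R)) :=
  (measurePreserving_polar h₀ R).quasiMeasurePreserving.mono_left
    ((absolutelyContinuous_radial N R).prod Measure.AbsolutelyContinuous.rfl)

section Integration

variable {F : Type*} [NormedAddCommGroup F] [NormedSpace ℝ F]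

theorem ae_cyl_mem (N : ℕ) (R : ℝ) : ∀ᵐ p ∂(cyl N R), p.1 ∈ Ioo 0 R ∧ p.2 ∈ hemisphere N := by
  rw [cyl, surfPos, Measure.prod_restrict]
  exact ae_restrict_mem (measurableSet_Ioo.prod isOpen_hemisphere.measurableSet)

theorem integrable_radial_prod_iff {f : ℝ × Sph N → F} {R : ℝ} :
    Integrable f ((radial N R).prod (surfPos N)) ↔
      Integrable (fun p => p.1 ^ N • f p) (cyl N R) := by
  rw [cyl_eq, integrable_withDensity_iff_integrable_smul₀' (by fun_prop)
    (Eventually.of_forall fun _ => ENNReal.ofReal_lt_top)]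
  refine integrable_congr ?_
  filter_upwards [ae_cyl_mem N R] with p hp
  rw [ENNReal.toReal_ofReal (pow_nonneg hp.1.1.le _)]

theorem integrable_polar {X₀ : Space N} (h₀ : yCoord X₀ = 0) {R : ℝ} {f : Space N → F}
    (hf : IntegrableOn f (halfBall X₀ R)) :
    Integrable (fun p : ℝ × Sph N => p.1 ^ N • f (polar X₀ p)) (cyl N R) :=
  integrable_radial_prod_iff.1 ((measurePreserving_polar h₀ R).integrable_comp_of_integrable hf)

theorem integrableOn_of_polar {X₀ : Space N} (h₀ : yCoord X₀ = 0) {R : ℝ} {f : Space N → F}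
    (hf : AEStronglyMeasurable f (volume.restrict (halfBall X₀ R)))
    (h : Integrable (fun p : ℝ × Sph N => p.1 ^ N • f (polar X₀ p)) (cyl N R)) :
    IntegrableOn f (halfBall X₀ R) :=
  ((measurePreserving_polar h₀ R).integrable_comp hf).1 (integrable_radial_prod_iff.2 h)

theorem setIntegral_halfBall_eq_cyl [CompleteSpace F] {X₀ : Space N} (h₀ : yCoord X₀ = 0) {R : ℝ}
    {f : Space N → F} (hf : AEStronglyMeasurable f (volume.restrict (halfBall X₀ R))) :
    ∫ X in halfBall X₀ R, f X = ∫ p, p.1 ^ N • f (polar X₀ p) ∂(cyl N R) := by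
  have hmp := measurePreserving_polar h₀ R
  rw [← hmp.map_eq, integral_map hmp.measurable.aemeasurable (by rwa [hmp.map_eq]), cyl_eq,
    integral_withDensity_eq_integral_toReal_smul₀ (by fun_prop)
      (Eventually.of_forall fun _ => ENNReal.ofReal_lt_top)]
  refine integral_congr_ae ?_
  filter_upwards [ae_cyl_mem N R] with p hp
  rw [ENNReal.toReal_ofReal (pow_nonneg hp.1.1.le _)]

/-- Integration in polar coordinates over a half ball. -/
theorem setIntegral_halfBall [CompleteSpace F] {X₀ : Space N} (h₀ : yCoord X₀ = 0) {R : ℝ}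
    {f : Space N → F} (hf : IntegrableOn f (halfBall X₀ R)) :
    ∫ X in halfBall X₀ R, f X =
      ∫ r in Ioo 0 R, r ^ N • ∫ ξ, f (polar X₀ (r, ξ)) ∂(surfPos N) := by
  rw [setIntegral_halfBall_eq_cyl h₀ hf.aestronglyMeasurable, cyl,
    integral_prod _ (integrable_polar h₀ hf)]
  simp only [integral_smul]

theorem ae_polar {X₀ : Space N} (h₀ : yCoord X₀ = 0) {R : ℝ} {P : Space N → Prop}
    (h : ∀ᵐ X ∂(volume.restrict (halfBall X₀ R)), P X) :
    ∀ᵐ r ∂(volume.restrict (Ioo 0 R)), ∀ᵐ ξ ∂(surfPos N), P (polar X₀ (r, ξ)) :=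
  Measure.ae_ae_of_ae_prod ((quasiMeasurePreserving_polar h₀ R).ae h)

end Integration

/-! ### Functions of one variable -/

theorem exists_Ioo_superset_of_isCompact {K : Set ℝ} (hK : IsCompact K) {a b : ℝ} (hab : a < b)
    (h : K ⊆ Ioo a b) : ∃ α β, a < α ∧ α < β ∧ β < b ∧ K ⊆ Ioo α β := by
  rcases K.eq_empty_or_nonempty with rfl | hne
  · exact ⟨a + (b - a) / 3, a + (b - a) / 2, by linarith, by linarith, by linarith, by simp⟩
  obtain ⟨x, hx, hx'⟩ := hK.exists_isLeast hne
  obtain ⟨y, hy, hy'⟩ := hK.exists_isGreatest hne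
  have h1 := h hx
  have h2 := h hy
  have h3 : x ≤ y := hx' hy
  refine ⟨(a + x) / 2, (y + b) / 2, by linarith [h1.1], by linarith [h1.1, h2.2],
    by linarith [h2.2], fun z hz => ⟨?_, ?_⟩⟩
  · have := hx' hz; have := h1.1; linarith
  · have := hy' hz; have := h2.2; linarith

/-- A function on `(0, R)` whose integral against every non-negative test function is non-negative
is non-negative almost everywhere. -/
theorem ae_nonneg_of_integral_smooth_nonneg {R : ℝ} {h : ℝ → ℝ} (hh : IntegrableOn h (Ioo 0 R))
    (H : ∀ g : ℝ → ℝ, ContDiff ℝ ∞ g → HasCompactSupport g → tsupport g ⊆ Ioo 0 R →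
      (∀ r, 0 ≤ g r) → 0 ≤ ∫ r in Ioo 0 R, g r * h r) :
    ∀ᵐ r ∂(volume.restrict (Ioo 0 R)), 0 ≤ h r := by
  -- The mollified `h` is non-negative near each point and converges to `h` almost everywhere.
  let φ : ℕ → ContDiffBump (0 : ℝ) := fun n =>
    { rIn := 1 / (n + 1), rOut := 2 * (1 / (n + 1)), rIn_pos := by positivity
      rIn_lt_rOut := by
        have : (0 : ℝ) < 1 / (n + 1) := by positivity
        linarith }
  have hφ : Tendsto (fun n => (φ n).rOut) atTop (𝓝 0) := by
    have := (tendsto_one_div_add_atTop_nhds_zero_nat (𝕜 := ℝ)).const_mul 2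
    simpa [φ] using this
  have hint : LocallyIntegrable ((Ioo 0 R).indicator h) volume :=
    (hh.integrable_indicator measurableSet_Ioo).locallyIntegrable
  have key := ContDiffBump.ae_convolution_tendsto_right_of_locallyIntegrable (μ := volume)
    (K := 2) hφ (Eventually.of_forall fun n => le_rfl) hint
  rw [ae_restrict_iff' measurableSet_Ioo]
  filter_upwards [key] with x hx hxR
  rw [indicator_of_mem hxR] at hx
  refine ge_of_tendsto hx ?_
  obtain ⟨ε, hε, hball⟩ := Metric.isOpen_iff.1 isOpen_Ioo x hxR
  filter_upwards [hφ.eventually (gt_mem_nhds hε)] with n hn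
  have hsupp : Function.support (fun t => (φ n).normed volume (x - t)) ⊆
      closedBall x (φ n).rOut := by
    intro t ht
    have : x - t ∈ Function.support ((φ n).normed volume) := ht
    rw [ContDiffBump.support_normed_eq] at this
    have h' : |x - t| < (φ n).rOut := by simpa using this
    rw [mem_closedBall, Real.dist_eq, abs_sub_comm]
    exact h'.le
  have hts : tsupport (fun t => (φ n).normed volume (x - t)) ⊆ closedBall x (φ n).rOut :=
    closure_minimal hsupp isClosed_closedBall
  have hsm : ContDiff ℝ ∞ (fun t => (φ n).normed volume (x - t)) :=
    ((φ n).contDiff_normed (μ := volume) (n := ⊤)).comp (contDiff_const.sub contDiff_id)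
  have := H (fun t => (φ n).normed volume (x - t)) hsm
    (HasCompactSupport.of_support_subset_isCompact (isCompact_closedBall x _) hsupp)
    (hts.trans ((closedBall_subset_ball hn).trans hball)) (fun t => (φ n).nonneg_normed _)
  rw [convolution_eq_swap]
  rw [← integral_indicator measurableSet_Ioo] at this
  refine this.trans_eq (integral_congr_ae (Eventually.of_forall fun t => ?_))
  by_cases ht : t ∈ Ioo 0 R <;> simp [ht]

/-- Integration by parts for absolutely continuous functions with given derivatives. -/
theorem integral_mul_add_mul_of_ac {f g f' g' : ℝ → ℝ} {a b : ℝ}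
    (hf : AbsolutelyContinuousOnInterval f a b) (hg : AbsolutelyContinuousOnInterval g a b)
    (hf' : ∀ᵐ x, x ∈ uIcc a b → HasDerivAt f (f' x) x)
    (hg' : ∀ᵐ x, x ∈ uIcc a b → HasDerivAt g (g' x) x) :
    ∫ x in a..b, (f' x * g x + f x * g' x) = f b * g b - f a * g a := by
  rw [← hf.integral_deriv_mul_eq_sub hg]
  refine intervalIntegral.integral_congr_ae ?_
  filter_upwards [hf', hg'] with x h1 h2 hx
  rw [(h1 (uIoc_subset_uIcc hx)).deriv, (h2 (uIoc_subset_uIcc hx)).deriv]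

/-- A primitive of an integrable function is absolutely continuous, with the expected derivative
almost everywhere. -/
theorem ac_primitive {k : ℝ → ℝ} {a b c : ℝ}
    (hk : IntervalIntegrable k volume a b) (hc : c ∈ uIcc a b) :
    AbsolutelyContinuousOnInterval (fun x => ∫ t in c..x, k t) a b ∧
      ∀ᵐ x, x ∈ uIcc a b → HasDerivAt (fun x => ∫ t in c..x, k t) (k x) x := by
  refine ⟨hk.absolutelyContinuousOnInterval_intervalIntegral hc, ?_⟩
  filter_upwards [hk.ae_hasDerivAt_integral] with x hx hx'
  exact hx hx' c hc

theorem setIntegral_Ioo_eq_intervalIntegral {f : ℝ → ℝ} {a b α β : ℝ} (hα : a < α)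
    (hαβ : α < β) (hβ : β < b) (hf : ∀ x, x ∉ Ioo α β → f x = 0) :
    ∫ x in Ioo a b, f x = ∫ x in α..β, f x := by
  rw [intervalIntegral.integral_of_le hαβ.le, integral_Ioc_eq_integral_Ioo]
  refine (setIntegral_eq_of_subset_of_forall_sdiff_eq_zero measurableSet_Ioo
    (Ioo_subset_Ioo hα.le hβ.le) fun x hx => hf x hx.2)

theorem contDiff_primitive {η : ℝ → ℝ} (hη : ContDiff ℝ ∞ η) (a : ℝ) :
    ContDiff ℝ ∞ (fun x => ∫ t in a..x, η t) ∧ ∀ x, HasDerivAt (fun x => ∫ t in a..x, η t) (η x) x := by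
  have hd : ∀ x, HasDerivAt (fun x => ∫ t in a..x, η t) (η x) x := fun x =>
    intervalIntegral.integral_hasDerivAt_right (hη.continuous.intervalIntegrable _ _)
      hη.continuous.stronglyMeasurable.stronglyMeasurableAtFilter hη.continuous.continuousAt
  refine ⟨contDiff_infty_iff_deriv.2 ⟨fun x => (hd x).differentiableAt, ?_⟩, hd⟩
  have : deriv (fun x => ∫ t in a..x, η t) = η := funext fun x => (hd x).deriv
  rwa [this]

/-- A continuous function on `(0, R)` with vanishing weak derivative is constant. -/
theorem eq_of_weakDeriv_eq_zero {R : ℝ} {h : ℝ → ℝ} (hc : ContinuousOn h (Ioo 0 R))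
    (H : ∀ η : ℝ → ℝ, ContDiff ℝ ∞ η → HasCompactSupport η → tsupport η ⊆ Ioo 0 R →
      ∫ r in Ioo 0 R, deriv η r * h r = 0) {a b : ℝ} (ha : a ∈ Ioo 0 R) (hb : b ∈ Ioo 0 R) :
    h a = h b := by
  have hR : 0 < R := ha.1.trans ha.2
  have hloc : LocallyIntegrableOn h (Ioo 0 R) := hc.locallyIntegrableOn measurableSet_Ioo
  -- A fixed test function `η₀` of integral one; the constant is `c = ∫ η₀ h`.
  let φ : ContDiffBump (R / 2) := ⟨R / 8, R / 4, by linarith, by linarith⟩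
  set η₀ := φ.normed (volume : Measure ℝ) with hη₀
  have hη₀s : ContDiff ℝ ∞ η₀ := φ.contDiff_normed (n := ⊤)
  have hη₀t : tsupport η₀ ⊆ Ioo 0 R := by
    rw [hη₀, φ.tsupport_normed_eq]
    intro x hx
    have : |x - R / 2| ≤ R / 4 := by simpa [Real.dist_eq] using hx
    rw [abs_le] at this
    constructor <;> linarith
  have hη₀c : HasCompactSupport η₀ := φ.hasCompactSupport_normed
  have hint : ∀ η : ℝ → ℝ, Continuous η → HasCompactSupport η → tsupport η ⊆ Ioo 0 R →
      IntegrableOn (fun r => η r * h r) (Ioo 0 R) := by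
    intro η h1 h2 h3
    have : IntegrableOn (fun r => η r * h r) (tsupport η) :=
      (hloc.integrableOn_compact_subset h3 h2).continuousOn_mul h1.continuousOn h2
    refine (this.integrable_of_forall_notMem_eq_zero fun x hx => ?_).integrableOn
    rw [image_eq_zero_of_notMem_tsupport hx, zero_mul]
  set c := ∫ r in Ioo 0 R, η₀ r * h r with hcdef
  have h0 : ∀ᵐ x, x ∈ Ioo 0 R → h x - c = 0 := by
    refine isOpen_Ioo.ae_eq_zero_of_integral_contDiff_smul_eq_zero
      (hloc.sub ((locallyIntegrable_const c).locallyIntegrableOn _)) ?_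
    intro η h1 h2 h3
    -- `η - β η₀` has integral zero, so its primitive is again a test function on `(0, R)`.
    set β := ∫ x, η x with hβ
    have hk : ContDiff ℝ ∞ (fun x => η x - β * η₀ x) := h1.sub (contDiff_const.mul hη₀s)
    obtain ⟨hζ, hζ'⟩ := contDiff_primitive hk 0
    obtain ⟨p, q, hp, hpq, hq, hsub⟩ := exists_Ioo_superset_of_isCompact (h2.union hη₀c) hR
      (union_subset h3 hη₀t)
    have hz : ∀ x, x ∉ Ioo p q → η x = 0 ∧ η₀ x = 0 := fun x hx =>
      ⟨image_eq_zero_of_notMem_tsupport fun h' => hx (hsub (Or.inl h')),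
        image_eq_zero_of_notMem_tsupport fun h' => hx (hsub (Or.inr h'))⟩
    have hfull : ∫ x in p..q, (η x - β * η₀ x) = 0 := by
      rw [intervalIntegral.integral_of_le hpq.le, integral_Ioc_eq_integral_Ioo,
        setIntegral_eq_integral_of_forall_compl_eq_zero (fun x hx => by
          rw [(hz x hx).1, (hz x hx).2]; simp),
        integral_sub (h1.continuous.integrable_of_hasCompactSupport h2)
          ((hη₀s.continuous.integrable_of_hasCompactSupport hη₀c).const_mul β),
        integral_const_mul, hη₀, φ.integral_normed, mul_one, hβ, sub_self]
    have hζ0 : ∀ x, x ∉ Icc p q → ∫ t in (0:ℝ)..x, (η t - β * η₀ t) = 0 := by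
      have hzero : ∀ u w : ℝ, (∀ x ∈ uIoc u w, x ∉ Ioo p q) →
          ∫ t in u..w, (η t - β * η₀ t) = 0 := by
        intro u w huw
        rw [intervalIntegral.integral_congr_ae (g := fun _ => (0:ℝ))
          (Eventually.of_forall fun x hx => by rw [(hz x (huw x hx)).1, (hz x (huw x hx)).2]; simp)]
        simp
      have hii : ∀ u w : ℝ, IntervalIntegrable (fun t => η t - β * η₀ t) volume u w :=
        fun u w => hk.continuous.intervalIntegrable _ _
      intro x hx
      by_cases hxp : x < p
      · refine hzero _ _ fun t ht ht' => ?_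
        rw [uIoc, mem_Ioc] at ht
        have := ht.2.trans (max_le hp.le hxp.le)
        linarith [ht'.1]
      · have hxq : q < x := by
          by_contra h'
          exact hx ⟨not_lt.1 hxp, not_lt.1 h'⟩
        rw [← intervalIntegral.integral_add_adjacent_intervals (hii 0 p) (hii p x),
          ← intervalIntegral.integral_add_adjacent_intervals (hii p q) (hii q x), hfull,
          hzero 0 p, hzero q x]
        · simp
        · intro t ht ht'
          rw [uIoc_of_le hxq.le] at ht
          linarith [ht.1, ht'.2]
        · intro t ht ht'
          rw [uIoc_of_le hp.le] at ht
          linarith [ht.2, ht'.1]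
    have hsupp : Function.support (fun x => ∫ t in (0:ℝ)..x, (η t - β * η₀ t)) ⊆ Icc p q := by
      intro x hx
      by_contra h'
      exact hx (hζ0 x h')
    have := H _ hζ (HasCompactSupport.of_support_subset_isCompact isCompact_Icc hsupp)
      ((closure_minimal hsupp isClosed_Icc).trans (Icc_subset_Ioo hp hq))
    have e1 : ∀ x, deriv (fun x => ∫ t in (0:ℝ)..x, (η t - β * η₀ t)) x = η x - β * η₀ x :=
      fun x => (hζ' x).deriv
    simp only [e1, sub_mul, mul_assoc] at this
    rw [integral_sub (hint η h1.continuous h2 h3)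
      ((hint η₀ hη₀s.continuous hη₀c hη₀t).const_mul β), integral_const_mul, ← hcdef] at this
    have hzη : ∀ x, x ∉ Ioo 0 R → η x = 0 := fun x hx =>
      image_eq_zero_of_notMem_tsupport fun h' => hx (h3 h')
    rw [← setIntegral_eq_integral_of_forall_compl_eq_zero (s := Ioo 0 R) (fun x hx => by
      rw [hzη x hx, zero_smul])]
    simp only [smul_eq_mul, mul_sub]
    rw [integral_sub (hint η h1.continuous h2 h3)
      ((h1.continuous.integrable_of_hasCompactSupport h2).integrableOn.mul_const c),
      integral_mul_const, setIntegral_eq_integral_of_forall_compl_eq_zero (fun x hx => hzη x hx)]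
    exact this
  have heq : EqOn h (fun _ => c) (Ioo 0 R) := by
    refine Measure.eqOn_open_of_ae_eq (μ := volume) ?_ isOpen_Ioo hc continuousOn_const
    rw [EventuallyEq, ae_restrict_iff' measurableSet_Ioo]
    filter_upwards [h0] with x hx hx'
    exact sub_eq_zero.1 (hx hx')
  rw [heq ha, heq hb]

theorem intervalIntegrable_of_Ioo {R : ℝ} {k : ℝ → ℝ} (hk : LocallyIntegrableOn k (Ioo 0 R))
    {p q : ℝ} (hp : p ∈ Ioo 0 R) (hq : q ∈ Ioo 0 R) : IntervalIntegrable k volume p q :=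
  (hk.integrableOn_compact_subset (ordConnected_Ioo.uIcc_subset hp hq)
    isCompact_uIcc).intervalIntegrable

theorem continuousOn_primitive_Ioo {R : ℝ} {k : ℝ → ℝ} (hk : LocallyIntegrableOn k (Ioo 0 R))
    {a : ℝ} (ha : a ∈ Ioo 0 R) : ContinuousOn (fun x => ∫ t in a..x, k t) (Ioo 0 R) := by
  intro x hx
  have hx1 : min x a / 2 ∈ Ioo 0 R := by
    have h1 : 0 < min x a := lt_min hx.1 ha.1
    have h2 : min x a ≤ x := min_le_left _ _
    exact ⟨by linarith, by linarith [hx.2]⟩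
  have hx2 : (max x a + R) / 2 ∈ Ioo 0 R := by
    have h1 : max x a < R := max_lt hx.2 ha.2
    have h2 : x ≤ max x a := le_max_left _ _
    exact ⟨by linarith [hx.1], by linarith⟩
  have l1 : min x a / 2 < x := by
    have h1 : 0 < min x a := lt_min hx.1 ha.1
    have h2 : min x a ≤ x := min_le_left _ _
    linarith
  have l1' : min x a / 2 < a := by
    have h1 : 0 < min x a := lt_min hx.1 ha.1
    have h2 : min x a ≤ a := min_le_right _ _
    linarith
  have l2 : x < (max x a + R) / 2 := by
    have h1 : max x a < R := max_lt hx.2 ha.2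
    have h2 : x ≤ max x a := le_max_left _ _
    linarith
  have l2' : a < (max x a + R) / 2 := by
    have h1 : max x a < R := max_lt hx.2 ha.2
    have h2 : a ≤ max x a := le_max_right _ _
    linarith
  have := (ac_primitive (intervalIntegrable_of_Ioo hk hx1 hx2)
    (mem_uIcc_of_le l1'.le l2'.le)).1.continuousOn
  rw [uIcc_of_le (l1.trans l2).le] at this
  exact (this.continuousAt (Icc_mem_nhds l1 l2)).continuousWithinAt

/-- A continuous function on `(0, R)` is the integral of its weak derivative. -/
theorem sub_eq_integral_of_weakDeriv {R : ℝ} {K k : ℝ → ℝ} (hK : ContinuousOn K (Ioo 0 R))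
    (hk : LocallyIntegrableOn k (Ioo 0 R))
    (H : ∀ η : ℝ → ℝ, ContDiff ℝ ∞ η → HasCompactSupport η → tsupport η ⊆ Ioo 0 R →
      ∫ r in Ioo 0 R, (deriv η r * K r + η r * k r) = 0)
    {a b : ℝ} (ha : a ∈ Ioo 0 R) (hb : b ∈ Ioo 0 R) :
    K b - K a = ∫ r in a..b, k r := by
  have hii : ∀ p ∈ Ioo 0 R, ∀ q ∈ Ioo 0 R, IntervalIntegrable k volume p q := fun p hp q hq =>
    intervalIntegrable_of_Ioo hk hp hq
  have hac : ∀ p ∈ Ioo 0 R, ∀ q ∈ Ioo 0 R, a ∈ uIcc p q →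
    AbsolutelyContinuousOnInterval (fun x => ∫ t in a..x, k t) p q ∧
      ∀ᵐ x, x ∈ uIcc p q → HasDerivAt (fun x => ∫ t in a..x, k t) (k x) x :=
    fun p hp q hq h => ac_primitive (hii p hp q hq) h
  have hPc := continuousOn_primitive_Ioo hk ha
  have hconst := eq_of_weakDeriv_eq_zero (h := fun x => K x - ∫ t in a..x, k t) (hK.sub hPc) ?_
    ha hb
  · simp only [intervalIntegral.integral_same, sub_zero] at hconst
    linarith
  intro η h1 h2 h3
  obtain ⟨p, q, hp, hpq, hq, hsub⟩ := exists_Ioo_superset_of_isCompact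
    (h2.union (isCompact_singleton (x := a))) (ha.1.trans ha.2)
    (union_subset h3 (singleton_subset_iff.2 ha))
  have hap : a ∈ Ioo p q := hsub (Or.inr rfl)
  have hz : ∀ x, x ∉ Ioo p q → x ∉ tsupport η := fun x hx h' => hx (hsub (Or.inl h'))
  have hz1 : ∀ x, x ∉ Ioo p q → η x = 0 := fun x hx => image_eq_zero_of_notMem_tsupport (hz x hx)
  have hz2 : ∀ x, x ∉ Ioo p q → deriv η x = 0 := fun x hx => by
    by_contra h'
    exact hz x hx (support_deriv_subset h')
  have hpR : p ∈ Ioo 0 R := ⟨hp, hpq.trans hq⟩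
  have hqR : q ∈ Ioo 0 R := ⟨hp.trans hpq, hq⟩
  have hsubI : uIcc p q ⊆ Ioo 0 R := ordConnected_Ioo.uIcc_subset hpR hqR
  have hη' : Continuous (deriv η) := h1.continuous_deriv (by simp)
  have i1 : IntervalIntegrable (fun x => deriv η x * K x) volume p q :=
    (hη'.continuousOn.mul (hK.mono hsubI)).intervalIntegrable
  have i2 : IntervalIntegrable (fun x => deriv η x * ∫ t in a..x, k t) volume p q :=
    (hη'.continuousOn.mul (hPc.mono hsubI)).intervalIntegrable
  have i3 : IntervalIntegrable (fun x => η x * k x) volume p q :=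
    (hii p hpR q hqR).continuousOn_mul h1.continuous.continuousOn
  have e1 := H η h1 h2 h3
  rw [setIntegral_Ioo_eq_intervalIntegral hp hpq hq (fun x hx => by simp [hz1 x hx, hz2 x hx]),
    intervalIntegral.integral_add i1 i3] at e1
  rw [setIntegral_Ioo_eq_intervalIntegral hp hpq hq (fun x hx => by simp [hz2 x hx])]
  simp only [mul_sub]
  rw [intervalIntegral.integral_sub i1 i2]
  obtain ⟨hP, hP'⟩ := hac p hpR q hqR (mem_uIcc_of_le hap.1.le hap.2.le)
  have hηac : AbsolutelyContinuousOnInterval η p q :=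
    ContDiffOn.absolutelyContinuousOnInterval (h1.contDiffOn.of_le (by simp))
  have hη'' : ∀ x, HasDerivAt η (deriv η x) x := fun x =>
    ((h1.differentiable (by simp)) x).hasDerivAt
  have e2 := integral_mul_add_mul_of_ac hηac hP (f' := deriv η)
    (Eventually.of_forall fun x _ => hη'' x) hP'
  rw [intervalIntegral.integral_add i2 i3, hz1 p (by simp), hz1 q (by simp)] at e2
  linarith

/-- If `∫ (f D + f' E) ≤ 0` for all the non-increasing functions `f(r) = ∫_r^R g`, then
`∫_0^r D ≤ E(r)` for almost every `r`: an integration by parts turns the hypothesis into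
`∫ g(r) (E(r) - ∫_0^r D) ≥ 0`. -/
theorem ae_integral_le_of_forall_smooth {R : ℝ} (hR : 0 < R) {D E : ℝ → ℝ}
    (hD : IntegrableOn D (Ioo 0 R)) (hE : IntegrableOn E (Ioo 0 R))
    (H : ∀ g : ℝ → ℝ, ContDiff ℝ ∞ g → HasCompactSupport g → tsupport g ⊆ Ioo 0 R →
      (∀ r, 0 ≤ g r) → ∫ r in Ioo 0 R, ((∫ t in r..R, g t) * D r - g r * E r) ≤ 0) :
    ∀ᵐ r ∂(volume.restrict (Ioo 0 R)), ∫ t in (0:ℝ)..r, D t ≤ E r := by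
  have hDi : IntervalIntegrable D volume 0 R :=
    (intervalIntegrable_iff_integrableOn_Ioo_of_le hR.le).2 hD
  obtain ⟨hC, hC'⟩ := ac_primitive hDi (left_mem_uIcc)
  have hCc := hC.continuousOn
  have hCi : IntegrableOn (fun r => ∫ t in (0:ℝ)..r, D t) (Ioo 0 R) :=
    (hCc.integrableOn_uIcc).mono_set (by rw [uIcc_of_le hR.le]; exact Ioo_subset_Icc_self)
  have := ae_nonneg_of_integral_smooth_nonneg (hE.sub hCi) ?_
  · filter_upwards [this] with r hr
    simpa using hr
  intro g h1 h2 h3 h4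
  have hf' : ∀ x, HasDerivAt (fun r => ∫ t in r..R, g t) (-g x) x := fun x =>
    intervalIntegral.integral_hasDerivAt_left (h1.continuous.intervalIntegrable _ _)
      h1.continuous.stronglyMeasurable.stronglyMeasurableAtFilter h1.continuous.continuousAt
  have hfc : Continuous (fun r => ∫ t in r..R, g t) :=
    continuous_iff_continuousAt.2 fun x => (hf' x).continuousAt
  have hf : AbsolutelyContinuousOnInterval (fun r => ∫ t in r..R, g t) 0 R := by
    have : (fun r => ∫ t in r..R, g t) = fun r => (-1 : ℝ) * ∫ t in R..r, g t := by
      ext r; rw [intervalIntegral.integral_symm]; ring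
    rw [this]
    exact ((ac_primitive (h1.continuous.intervalIntegrable 0 R)
      right_mem_uIcc).1).const_mul _
  have e := integral_mul_add_mul_of_ac hf hC (Eventually.of_forall fun x _ => hf' x) hC'
  have j1 : IntervalIntegrable (fun r => g r * ∫ t in (0:ℝ)..r, D t) volume 0 R :=
    (h1.continuous.continuousOn.mul hCc).intervalIntegrable
  have j2 : IntervalIntegrable (fun r => (∫ t in r..R, g t) * D r) volume 0 R :=
    hDi.continuousOn_mul hfc.continuousOn
  have j3 : IntervalIntegrable (fun r => g r * E r) volume 0 R :=
    ((intervalIntegrable_iff_integrableOn_Ioo_of_le hR.le).2 hE).continuousOn_mul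
      h1.continuous.continuousOn
  simp only [neg_mul] at e
  have j1' : IntervalIntegrable (fun r => -(g r * ∫ t in (0:ℝ)..r, D t)) volume 0 R := j1.neg
  rw [intervalIntegral.integral_add j1' j2] at e
  simp only [intervalIntegral.integral_same, zero_mul, mul_zero, sub_zero,
    intervalIntegral.integral_neg] at e
  have hH := H g h1 h2 h3 h4
  rw [← integral_Ioc_eq_integral_Ioo, ← intervalIntegral.integral_of_le hR.le,
    intervalIntegral.integral_sub j2 j3] at hH
  rw [← integral_Ioc_eq_integral_Ioo, ← intervalIntegral.integral_of_le hR.le]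
  simp only [Pi.sub_apply, mul_sub]
  rw [intervalIntegral.integral_sub j3 j1]
  linarith

/-! ### Energy bounds and monotonicity on an interval -/

theorem absolutelyContinuous_rpow {a b : ℝ} (ha : 0 < a) (hab : a ≤ b) (p : ℝ) :
    AbsolutelyContinuousOnInterval (fun r : ℝ => r ^ p) a b ∧
      ∀ x ∈ uIcc a b, HasDerivAt (fun r : ℝ => r ^ p) (p * x ^ (p - 1)) x := by
  rw [uIcc_of_le hab]
  have hne : ∀ x ∈ Icc a b, x ≠ 0 := fun x hx => (ha.trans_le hx.1).ne'
  refine ⟨ContDiffOn.absolutelyContinuousOnInterval ?_,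
    fun x hx => Real.hasDerivAt_rpow_const (Or.inl (hne x hx))⟩
  rw [uIcc_of_le hab]
  exact fun x hx => (Real.contDiffAt_rpow_const_of_ne (hne x hx)).contDiffWithinAt

/-- The energy weighted by `r^{-m}` is bounded by boundary terms on almost every sphere: integrate
`r^{-m} D` by parts, and use `∫_0^r D ≤ E` and `H' = 2 r^{-m-1} E`. The boundary terms at the inner
radius have the good sign, so nothing is needed about the behaviour at the origin. -/
theorem weighted_energy_le {R m : ℝ} (hm : 0 < m) {D E H : ℝ → ℝ}
    (hD : IntegrableOn D (Ioo 0 R)) (hE : IntegrableOn E (Ioo 0 R))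
    (hD0 : ∀ r ∈ Ioo 0 R, 0 ≤ D r) (hH0 : ∀ r ∈ Ioo 0 R, 0 ≤ H r)
    (hDE : ∀ᵐ r ∂(volume.restrict (Ioo 0 R)), ∫ t in (0:ℝ)..r, D t ≤ E r)
    (hH : ∀ a ∈ Ioo 0 R, ∀ b ∈ Ioo 0 R, H b - H a = ∫ r in a..b, 2 * (r ^ (-m - 1) * E r)) :
    (∀ ρ ∈ Ioo 0 R, IntegrableOn (fun r => r ^ (-m) * D r) (Ioc 0 ρ)) ∧
    ∀ᵐ ρ ∂(volume.restrict (Ioo 0 R)),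
      ∫ r in (0:ℝ)..ρ, r ^ (-m) * D r ≤ ρ ^ (-m) * E ρ + m / 2 * H ρ := by
  have main : ∀ ρ ∈ Ioo 0 R, ∀ ε ∈ Ioo 0 ρ, IntervalIntegrable (fun r => r ^ (-m) * D r) volume ε ρ ∧
      ∫ r in ε..ρ, r ^ (-m) * D r ≤ ρ ^ (-m) * (∫ t in (0:ℝ)..ρ, D t) + m / 2 * H ρ := by
    intro ρ hρ ε hε
    have hεR : ε ∈ Ioo 0 R := ⟨hε.1, hε.2.trans hρ.2⟩
    have hsub : Ioc ε ρ ⊆ Ioo 0 R := fun x hx => ⟨hε.1.trans hx.1, hx.2.trans_lt hρ.2⟩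
    have hDi : IntervalIntegrable D volume 0 ρ :=
      (intervalIntegrable_iff_integrableOn_Ioc_of_le hρ.1.le).2
        (hD.mono_set fun x hx => ⟨hx.1, hx.2.trans_lt hρ.2⟩)
    have hDi' : IntervalIntegrable D volume ε ρ :=
      (intervalIntegrable_iff_integrableOn_Ioc_of_le hε.2.le).2 (hD.mono_set hsub)
    have hEi' : IntervalIntegrable E volume ε ρ :=
      (intervalIntegrable_iff_integrableOn_Ioc_of_le hε.2.le).2 (hE.mono_set hsub)
    obtain ⟨hC, hC'⟩ := ac_primitive hDi left_mem_uIcc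
    have hsub2 : uIcc ε ρ ⊆ uIcc 0 ρ := by
      rw [uIcc_of_le hε.2.le, uIcc_of_le hρ.1.le]; exact Icc_subset_Icc_left hε.1.le
    obtain ⟨hw, hw'⟩ := absolutelyContinuous_rpow hε.1 hε.2.le (-m)
    have hwc : ∀ p : ℝ, ContinuousOn (fun r : ℝ => r ^ p) (uIcc ε ρ) := fun p =>
      (absolutelyContinuous_rpow hε.1 hε.2.le p).1.continuousOn
    have hCc := (hC.mono hsub2).continuousOn
    have e := integral_mul_add_mul_of_ac hw (hC.mono hsub2)
      (Eventually.of_forall hw') (hC'.mono fun x hx h => hx (hsub2 h))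
    have j2 : IntervalIntegrable (fun r => r ^ (-m) * D r) volume ε ρ :=
      hDi'.continuousOn_mul (hwc _)
    have j1 : IntervalIntegrable (fun r => -m * r ^ (-m - 1) * ∫ t in (0:ℝ)..r, D t) volume ε ρ :=
      ((continuousOn_const.mul (hwc _)).mul hCc).intervalIntegrable
    have j3 : IntervalIntegrable (fun r => r ^ (-m - 1) * E r) volume ε ρ :=
      hEi'.continuousOn_mul (hwc _)
    rw [intervalIntegral.integral_add j1 j2] at e
    refine ⟨j2, ?_⟩
    have hb := hH ε hεR ρ hρ
    rw [intervalIntegral.integral_const_mul] at hb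
    have hle : ∫ r in ε..ρ, -m * (r ^ (-m - 1) * E r)
        ≤ ∫ r in ε..ρ, -m * r ^ (-m - 1) * ∫ t in (0:ℝ)..r, D t := by
      refine intervalIntegral.integral_mono_ae_restrict hε.2.le (j3.const_mul (-m)) j1 ?_
      have hsub3 : Icc ε ρ ⊆ Ioo 0 R := fun x hx => ⟨hε.1.trans_le hx.1, hx.2.trans_lt hρ.2⟩
      filter_upwards [ae_restrict_of_ae_restrict_of_subset hsub3 hDE,
        ae_restrict_mem measurableSet_Icc] with x hx hxI
      have h0 : 0 < x := hε.1.trans_le hxI.1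
      have := mul_le_mul_of_nonneg_left hx (mul_pos hm (Real.rpow_pos_of_pos h0 (-m - 1))).le
      nlinarith
    rw [intervalIntegral.integral_const_mul] at hle
    have hCε : 0 ≤ ∫ t in (0:ℝ)..ε, D t :=
      intervalIntegral.integral_nonneg_of_ae_restrict hε.1.le (by
        rw [Measure.restrict_congr_set Ioo_ae_eq_Icc.symm]
        filter_upwards [ae_restrict_mem measurableSet_Ioo] with x hx
        exact hD0 x ⟨hx.1, hx.2.trans hεR.2⟩)
    have h1 := mul_nonneg (Real.rpow_nonneg hε.1.le (-m)) hCε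
    have h2 := mul_nonneg hm.le (hH0 ε hεR)
    nlinarith
  -- Only the limit `ε → 0` is left.
  have hseq : ∀ ρ ∈ Ioo 0 R, ∃ u : ℕ → ℝ, (∀ n, u n ∈ Ioo 0 ρ) ∧ Tendsto u atTop (𝓝 0) := by
    intro ρ hρ
    obtain ⟨u, -, hu, hu'⟩ := exists_seq_strictAnti_tendsto' hρ.1
    exact ⟨u, hu, hu'⟩
  have hint : ∀ ρ ∈ Ioo 0 R, IntegrableOn (fun r => r ^ (-m) * D r) (Ioc 0 ρ) := by
    intro ρ hρ
    obtain ⟨u, hu, hu'⟩ := hseq ρ hρ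
    refine integrableOn_Ioc_of_intervalIntegral_norm_bounded_left (l := atTop) (a := u)
      (I := ρ ^ (-m) * (∫ t in (0:ℝ)..ρ, D t) + m / 2 * H ρ) (fun n => ?_) hu'
      (Eventually.of_forall fun n => ?_)
    · exact (intervalIntegrable_iff_integrableOn_Ioc_of_le (hu n).2.le).1 (main ρ hρ _ (hu n)).1
    · refine le_trans (le_of_eq ?_) (main ρ hρ _ (hu n)).2
      rw [intervalIntegral.integral_of_le (hu n).2.le]
      refine setIntegral_congr_fun measurableSet_Ioc fun x hx => ?_
      have h0 : 0 < x := (hu n).1.trans hx.1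
      exact Real.norm_of_nonneg (mul_nonneg (Real.rpow_nonneg h0.le _)
        (hD0 x ⟨h0, hx.2.trans_lt hρ.2⟩))
  refine ⟨hint, ?_⟩
  filter_upwards [hDE, ae_restrict_mem measurableSet_Ioo] with ρ hρE hρ
  obtain ⟨u, hu, hu'⟩ := hseq ρ hρ
  have hii : IntervalIntegrable (fun r => r ^ (-m) * D r) volume 0 ρ :=
    (intervalIntegrable_iff_integrableOn_Ioc_of_le hρ.1.le).2 (hint ρ hρ)
  have hcont := (ac_primitive hii right_mem_uIcc).1.continuousOn
  have hlim : Tendsto (fun n => ∫ r in (u n)..ρ, r ^ (-m) * D r) atTop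
      (𝓝 (∫ r in (0:ℝ)..ρ, r ^ (-m) * D r)) := by
    have h1 : Tendsto u atTop (𝓝[uIcc 0 ρ] 0) :=
      tendsto_nhdsWithin_iff.2 ⟨hu', Eventually.of_forall fun n => by
        rw [uIcc_of_le hρ.1.le]; exact ⟨(hu n).1.le, (hu n).2.le⟩⟩
    have := ((hcont 0 left_mem_uIcc).tendsto.comp h1).neg
    simp only [← intervalIntegral.integral_symm] at this
    refine this.congr fun n => ?_
    simp only [Function.comp, ← intervalIntegral.integral_symm]
  refine le_of_tendsto hlim (Eventually.of_forall fun n => (main ρ hρ _ (hu n)).2.trans ?_)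
  have := mul_le_mul_of_nonneg_left hρE (Real.rpow_nonneg hρ.1.le (-m))
  linarith

/-- If `J₁, J₂` are primitives of `j₁, j₂` with `r (j₁ J₂ + j₂ J₁) ≥ 2 κ J₁ J₂`, then
`r^{-2κ} J₁ J₂` is non-decreasing. -/
theorem monotoneOn_rpow_mul_integral {R κ : ℝ} {j₁ j₂ : ℝ → ℝ}
    (h₁ : ∀ ρ ∈ Ioo 0 R, IntegrableOn j₁ (Ioc 0 ρ)) (h₂ : ∀ ρ ∈ Ioo 0 R, IntegrableOn j₂ (Ioc 0 ρ))
    (h : ∀ᵐ r ∂(volume.restrict (Ioo 0 R)),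
      2 * κ * ((∫ t in (0:ℝ)..r, j₁ t) * ∫ t in (0:ℝ)..r, j₂ t) ≤
        r * (j₁ r * (∫ t in (0:ℝ)..r, j₂ t) + (∫ t in (0:ℝ)..r, j₁ t) * j₂ r)) :
    MonotoneOn (fun r => r ^ (-(2 * κ)) * ((∫ t in (0:ℝ)..r, j₁ t) * ∫ t in (0:ℝ)..r, j₂ t))
      (Ioo 0 R) := by
  intro a ha b hb hab
  have hi₁ := (intervalIntegrable_iff_integrableOn_Ioc_of_le hb.1.le).2 (h₁ b hb)
  have hi₂ := (intervalIntegrable_iff_integrableOn_Ioc_of_le hb.1.le).2 (h₂ b hb)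
  obtain ⟨hJ₁, hJ₁'⟩ := ac_primitive hi₁ left_mem_uIcc
  obtain ⟨hJ₂, hJ₂'⟩ := ac_primitive hi₂ left_mem_uIcc
  have hsub : uIcc a b ⊆ uIcc 0 b := by
    rw [uIcc_of_le hab, uIcc_of_le hb.1.le]; exact Icc_subset_Icc_left ha.1.le
  obtain ⟨hw, hw'⟩ := absolutelyContinuous_rpow ha.1 hab (-(2 * κ))
  have e := integral_mul_add_mul_of_ac hw ((hJ₁.mono hsub).fun_mul (hJ₂.mono hsub))
    (g' := fun r => j₁ r * (∫ t in (0:ℝ)..r, j₂ t) + (∫ t in (0:ℝ)..r, j₁ t) * j₂ r)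
    (Eventually.of_forall hw') (by
      filter_upwards [hJ₁', hJ₂'] with x hx₁ hx₂ hx
      exact (hx₁ (hsub hx)).mul (hx₂ (hsub hx)))
  refine sub_nonneg.1 ?_
  rw [← e]
  refine intervalIntegral.integral_nonneg_of_ae_restrict hab ?_
  have hsub3 : Icc a b ⊆ Ioo 0 R := fun x hx => ⟨ha.1.trans_le hx.1, hx.2.trans_lt hb.2⟩
  filter_upwards [ae_restrict_of_ae_restrict_of_subset hsub3 h,
    ae_restrict_mem measurableSet_Icc] with x hx hxI
  have h0 : 0 < x := ha.1.trans_le hxI.1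
  have e1 : x ^ (-(2 * κ)) = x ^ (-(2 * κ) - 1) * x := by
    rw [Real.rpow_sub_one h0.ne']; field_simp
  rw [e1]
  have hp := Real.rpow_pos_of_pos h0 (-(2 * κ) - 1)
  have := mul_nonneg hp.le (sub_nonneg.2 hx)
  simp only [Pi.zero_apply]
  nlinarith

/-! ### The weak gradient tested in polar coordinates -/

/-- The divergence of a vector field on `ℝ^{N+1}`. -/
noncomputable def divergence (Ψ : Space N → Space N) (X : Space N) : ℝ :=
  LinearMap.trace ℝ (Space N) (fderiv ℝ Ψ X).toLinearMap

theorem divergence_eq_sum (Ψ : Space N → Space N) (X : Space N) :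
    divergence Ψ X = ∑ j, ⟪EuclideanSpace.basisFun (Fin (N + 1)) ℝ j,
      fderiv ℝ Ψ X (EuclideanSpace.basisFun (Fin (N + 1)) ℝ j)⟫_ℝ :=
  LinearMap.trace_eq_sum_inner _ (EuclideanSpace.basisFun (Fin (N + 1)) ℝ)

/-- The defining identity of the weak gradient, tested with a vector field. -/
theorem IsWeakGrad.integral_divergence {Ω : Set (Space N)} {v : Space N → ℝ}
    {G : Space N → Space N} (h : IsWeakGrad Ω v G) {Ψ : Space N → Space N} (h1 : ContDiff ℝ ∞ Ψ)
    (h2 : HasCompactSupport Ψ) (h3 : tsupport Ψ ⊆ Ω) :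
    IntegrableOn (fun X => v X * divergence Ψ X + ⟪G X, Ψ X⟫_ℝ) Ω ∧
      ∫ X in Ω, (v X * divergence Ψ X + ⟪G X, Ψ X⟫_ℝ) = 0 := by
  obtain ⟨hv, hG, hφ⟩ := h
  set e := EuclideanSpace.basisFun (Fin (N + 1)) ℝ
  have hd : Continuous (fderiv ℝ Ψ) := h1.continuous_fderiv (by simp)
  have key : ∀ j, IntegrableOn (fun X => v X * ⟪e j, fderiv ℝ Ψ X (e j)⟫_ℝ) Ω ∧
      IntegrableOn (fun X => ⟪e j, Ψ X⟫_ℝ * ⟪e j, G X⟫_ℝ) Ω ∧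
      ∫ X in Ω, v X * ⟪e j, fderiv ℝ Ψ X (e j)⟫_ℝ =
        - ∫ X in Ω, ⟪e j, Ψ X⟫_ℝ * ⟪e j, G X⟫_ℝ := by
    intro j
    let φ : Space N → ℝ := fun X => ⟪e j, Ψ X⟫_ℝ
    have hφs : ContDiff ℝ ∞ φ := contDiff_const.inner ℝ h1
    have hts : tsupport φ ⊆ tsupport Ψ := by
      refine closure_mono fun X hX => ?_
      intro h0
      exact hX (by simp [φ, h0])
    have hφc : HasCompactSupport φ := h2.mono' ((subset_tsupport φ).trans hts)
    have hφd : ∀ X, ⟪e j, ∇ φ X⟫_ℝ = ⟪e j, fderiv ℝ Ψ X (e j)⟫_ℝ := by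
      intro X
      rw [real_inner_comm, inner_gradient_left]
      have := ((innerSL ℝ (e j)).hasFDerivAt.comp X
        ((h1.differentiable (by simp)) X).hasFDerivAt).fderiv
      have h' : fderiv ℝ φ X = (innerSL ℝ (e j)).comp (fderiv ℝ Ψ X) := this
      rw [h']; simp
    have hgc : Continuous (fun X => ∇ φ X) :=
      (InnerProductSpace.toDual ℝ (Space N)).symm.continuous.comp
        (hφs.continuous_fderiv (by simp))
    have hgs : Function.support (fun X => ∇ φ X) ⊆ tsupport φ := by
      intro X hX
      refine support_fderiv_subset ℝ fun h0 => hX ?_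
      simp [gradient, h0]
    have hgk : HasCompactSupport (fun X => ∇ φ X) := hφc.mono' hgs
    have hgt : tsupport (fun X => ∇ φ X) ⊆ Ω :=
      (closure_minimal hgs (isClosed_tsupport _)).trans (hts.trans h3)
    have i1 : IntegrableOn (fun X => v X • ∇ φ X) Ω := by
      have : IntegrableOn (fun X => v X • ∇ φ X) (tsupport (fun X => ∇ φ X)) :=
        (hv.integrableOn_compact_subset hgt hgk).smul_continuousOn hgc.continuousOn hgk
      refine (this.integrable_of_forall_notMem_eq_zero fun x hx => ?_).integrableOn
      rw [image_eq_zero_of_notMem_tsupport hx, smul_zero]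
    have i2 : IntegrableOn (fun X => φ X • G X) Ω := by
      have : IntegrableOn (fun X => φ X • G X) (tsupport φ) :=
        (hG.integrableOn_compact_subset (hts.trans h3) hφc).continuousOn_smul
          hφs.continuous.continuousOn hφc
      refine (this.integrable_of_forall_notMem_eq_zero fun x hx => ?_).integrableOn
      rw [image_eq_zero_of_notMem_tsupport hx, zero_smul]
    have h0 := congrArg (fun Y => ⟪e j, Y⟫_ℝ) (hφ φ hφs hφc (hts.trans h3))
    simp only [inner_neg_right] at h0
    rw [← integral_inner i1, ← integral_inner i2] at h0
    simp only [inner_smul_right, hφd] at h0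
    refine ⟨?_, ?_, h0⟩
    · have := i1.const_inner (𝕜 := ℝ) (e j)
      simpa only [IntegrableOn, inner_smul_right, hφd] using this
    · have := i2.const_inner (𝕜 := ℝ) (e j)
      simpa only [IntegrableOn, inner_smul_right] using this
  have e1 : ∀ X, v X * divergence Ψ X + ⟪G X, Ψ X⟫_ℝ =
      ∑ j, (v X * ⟪e j, fderiv ℝ Ψ X (e j)⟫_ℝ + ⟪e j, Ψ X⟫_ℝ * ⟪e j, G X⟫_ℝ) := by
    intro X
    rw [divergence_eq_sum, Finset.sum_add_distrib, Finset.mul_sum, ← e.sum_inner_mul_inner (G X)]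
    congr 1
    refine Finset.sum_congr rfl fun j _ => ?_
    rw [real_inner_comm (e j) (G X), mul_comm]
  have hs : ∀ j, IntegrableOn (fun X => v X * ⟪e j, fderiv ℝ Ψ X (e j)⟫_ℝ
      + ⟪e j, Ψ X⟫_ℝ * ⟪e j, G X⟫_ℝ) Ω := fun j => (key j).1.add (key j).2.1
  simp only [e1]
  refine ⟨integrable_finsetSum _ fun j _ => hs j, ?_⟩
  rw [integral_finsetSum _ fun j _ => hs j]
  refine Finset.sum_eq_zero fun j _ => ?_
  rw [integral_add (key j).1 (key j).2.1, (key j).2.2]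
  simp

/-- The vector field `h(|X - X₀|) F((X - X₀) / |X - X₀|)`. -/
noncomputable def polarField (X₀ : Space N) (h : ℝ → ℝ) (F : Space N → Space N) (X : Space N) :
    Space N :=
  h ‖X - X₀‖ • F (‖X - X₀‖⁻¹ • (X - X₀))

theorem hasFDerivAt_norm_polar (ξ : Sph N) {r : ℝ} (hr : 0 < r) :
    HasFDerivAt (fun Z : Space N => ‖Z‖) (innerSL ℝ (ξ : Space N)) (r • (ξ : Space N)) := by
  have h1 := ((hasStrictFDerivAt_norm_sq (r • (ξ : Space N))).hasFDerivAt).sqrt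
    (by simp [norm_smul, hr.ne'])
  have e1 : (fun Z : Space N => √(‖Z‖ ^ 2)) = fun Z => ‖Z‖ := by
    ext Z; exact Real.sqrt_sq (norm_nonneg _)
  rw [e1] at h1
  refine h1.congr_fderiv ?_
  ext w
  have : √(r ^ 2) = r := Real.sqrt_sq hr.le
  simp [norm_smul, this, abs_of_pos hr]
  field_simp

theorem hasFDerivAt_direction (ξ : Sph N) {r : ℝ} (hr : 0 < r) :
    HasFDerivAt (fun Z : Space N => ‖Z‖⁻¹ • Z)
      (r⁻¹ • (ContinuousLinearMap.id ℝ (Space N)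
        - (innerSL ℝ (ξ : Space N)).smulRight (ξ : Space N))) (r • (ξ : Space N)) := by
  have hn : ‖r • (ξ : Space N)‖ = r := by simp [norm_smul, abs_of_pos hr]
  have h1 : HasFDerivAt (fun Z : Space N => ‖Z‖⁻¹) (-(r ^ 2)⁻¹ • innerSL ℝ (ξ : Space N))
      (r • (ξ : Space N)) := by
    have hd : HasDerivAt (fun t : ℝ => t⁻¹) (-(r ^ 2)⁻¹) ‖r • (ξ : Space N)‖ := by
      rw [hn]; exact hasDerivAt_inv hr.ne'
    exact hd.comp_hasFDerivAt _ (hasFDerivAt_norm_polar ξ hr)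
  have h2 := h1.fun_smul (hasFDerivAt_id (r • (ξ : Space N)))
  refine h2.congr_fderiv ?_
  ext1 w
  change ‖r • (ξ : Space N)‖⁻¹ • w + (-(r ^ 2)⁻¹ * ⟪(ξ : Space N), w⟫_ℝ) • r • (ξ : Space N)
    = r⁻¹ • (w - ⟪(ξ : Space N), w⟫_ℝ • (ξ : Space N))
  rw [hn, smul_sub, smul_smul, smul_smul, sub_eq_add_neg, ← neg_smul]
  congr 2
  field_simp

theorem polar_sub (X₀ : Space N) (r : ℝ) (ξ : Sph N) : polar X₀ (r, ξ) - X₀ = r • (ξ : Space N) := by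
  simp [polar]

theorem norm_polar_sub (X₀ : Space N) {r : ℝ} (hr : 0 < r) (ξ : Sph N) :
    ‖polar X₀ (r, ξ) - X₀‖ = r := by
  rw [polar_sub]; simp [norm_smul, abs_of_pos hr]

theorem direction_polar (X₀ : Space N) {r : ℝ} (hr : 0 < r) (ξ : Sph N) :
    ‖polar X₀ (r, ξ) - X₀‖⁻¹ • (polar X₀ (r, ξ) - X₀) = (ξ : Space N) := by
  rw [norm_polar_sub X₀ hr, polar_sub, smul_smul, inv_mul_cancel₀ hr.ne', one_smul]

theorem polarField_polar (X₀ : Space N) (h : ℝ → ℝ) (F : Space N → Space N) {r : ℝ} (hr : 0 < r)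
    (ξ : Sph N) : polarField X₀ h F (polar X₀ (r, ξ)) = h r • F ξ := by
  rw [polarField, direction_polar X₀ hr, norm_polar_sub X₀ hr]

theorem hasFDerivAt_polarField (X₀ : Space N) {h : ℝ → ℝ} {F : Space N → Space N}
    (hh : Differentiable ℝ h) (hF : Differentiable ℝ F) {r : ℝ} (hr : 0 < r) (ξ : Sph N) :
    HasFDerivAt (polarField X₀ h F)
      (h r • (fderiv ℝ F ξ).comp (r⁻¹ • (ContinuousLinearMap.id ℝ (Space N)
        - (innerSL ℝ (ξ : Space N)).smulRight (ξ : Space N)))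
        + (deriv h r • innerSL ℝ (ξ : Space N)).smulRight (F ξ)) (polar X₀ (r, ξ)) := by
  have hs : HasFDerivAt (fun X : Space N => X - X₀) (ContinuousLinearMap.id ℝ (Space N))
      (polar X₀ (r, ξ)) := (hasFDerivAt_id _).sub_const X₀
  have hn := norm_polar_sub X₀ hr ξ
  have h1 : HasFDerivAt (fun X : Space N => ‖X - X₀‖) (innerSL ℝ (ξ : Space N))
      (polar X₀ (r, ξ)) := by
    have := hasFDerivAt_norm_polar ξ hr
    rw [← polar_sub X₀] at this
    exact this.comp (polar X₀ (r, ξ)) hs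
  have h2 := by
    have := hasFDerivAt_direction ξ hr
    rw [← polar_sub X₀] at this
    exact this.comp (polar X₀ (r, ξ)) hs
  have h3 : HasFDerivAt (fun X : Space N => h ‖X - X₀‖) (deriv h r • innerSL ℝ (ξ : Space N))
      (polar X₀ (r, ξ)) := by
    have hd : HasDerivAt h (deriv h r) ‖polar X₀ (r, ξ) - X₀‖ := by
      rw [hn]; exact (hh r).hasDerivAt
    exact hd.comp_hasFDerivAt (polar X₀ (r, ξ)) h1
  have h4 : HasFDerivAt (fun X : Space N => F (‖X - X₀‖⁻¹ • (X - X₀)))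
      ((fderiv ℝ F ξ).comp (r⁻¹ • (ContinuousLinearMap.id ℝ (Space N)
        - (innerSL ℝ (ξ : Space N)).smulRight (ξ : Space N)))) (polar X₀ (r, ξ)) := by
    have hd : HasFDerivAt F (fderiv ℝ F ξ)
        (‖polar X₀ (r, ξ) - X₀‖⁻¹ • (polar X₀ (r, ξ) - X₀)) := by
      rw [direction_polar X₀ hr]; exact (hF _).hasFDerivAt
    exact hd.comp (polar X₀ (r, ξ)) h2
  have h5 := h3.fun_smul h4
  rw [direction_polar X₀ hr, hn] at h5
  exact h5

/-- Divergence in polar coordinates; at `ξ` only the tangential part of `DF` enters, since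
`F((X - X₀) / |X - X₀|)` is constant along rays. -/
theorem divergence_polarField (X₀ : Space N) {h : ℝ → ℝ} {F : Space N → Space N}
    (hh : Differentiable ℝ h) (hF : Differentiable ℝ F) {r : ℝ} (hr : 0 < r) (ξ : Sph N) :
    divergence (polarField X₀ h F) (polar X₀ (r, ξ)) =
      deriv h r * ⟪F ξ, (ξ : Space N)⟫_ℝ + h r * r⁻¹ * tangDiv F ξ := by
  set e := EuclideanSpace.basisFun (Fin (N + 1)) ℝ
  have hT : tangDiv F ξ = divergence F ξ - ⟪fderiv ℝ F ξ (ξ : Space N), (ξ : Space N)⟫_ℝ := rfl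
  rw [divergence_eq_sum, (hasFDerivAt_polarField X₀ hh hF hr ξ).fderiv, hT, divergence_eq_sum]
  have e1 : ⟪F ξ, (ξ : Space N)⟫_ℝ = ∑ j, ⟪(ξ : Space N), e j⟫_ℝ * ⟪e j, F ξ⟫_ℝ := by
    rw [e.sum_inner_mul_inner, real_inner_comm]
  have e2 : ⟪fderiv ℝ F ξ (ξ : Space N), (ξ : Space N)⟫_ℝ
      = ∑ j, ⟪(ξ : Space N), e j⟫_ℝ * ⟪e j, fderiv ℝ F ξ (ξ : Space N)⟫_ℝ := by
    rw [e.sum_inner_mul_inner, real_inner_comm]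
  rw [e1, e2, ← Finset.sum_sub_distrib, Finset.mul_sum, Finset.mul_sum, ← Finset.sum_add_distrib]
  refine Finset.sum_congr rfl fun j _ => ?_
  simp only [_root_.add_apply, _root_.smul_apply,
    ContinuousLinearMap.comp_apply, _root_.sub_apply,
    ContinuousLinearMap.smulRight_apply, innerSL_apply_apply, ContinuousLinearMap.id_apply,
    smul_sub, map_sub, map_smul, inner_add_right, inner_sub_right, inner_smul_right, smul_eq_mul]
  ring

theorem polarField_support {X₀ : Space N} (h₀ : yCoord X₀ = 0) {R : ℝ} {h : ℝ → ℝ}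
    {F : Space N → Space N} (h2 : HasCompactSupport h) (h3 : tsupport h ⊆ Ioo 0 R)
    (F3 : tsupport F ⊆ {X | 0 < yCoord X}) :
    HasCompactSupport (polarField X₀ h F) ∧ tsupport (polarField X₀ h F) ⊆ halfBall X₀ R := by
  let S : Set (Sph N) := Subtype.val ⁻¹' tsupport F
  have hS : IsCompact S := ((isClosed_tsupport F).preimage continuous_subtype_val).isCompact
  have hK : IsCompact (polar X₀ '' (tsupport h ×ˢ S)) :=
    (IsCompact.prod h2 hS).image (continuous_polar X₀)
  have hsub : Function.support (polarField X₀ h F) ⊆ polar X₀ '' (tsupport h ×ˢ S) := by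
    intro X hX
    have hX1 : h ‖X - X₀‖ ≠ 0 := fun h0 => hX (by simp [polarField, h0])
    have hX2 : F (‖X - X₀‖⁻¹ • (X - X₀)) ≠ 0 := fun h0 => hX (by simp [polarField, h0])
    have hn : 0 < ‖X - X₀‖ := (h3 (subset_tsupport h hX1)).1
    refine ⟨(‖X - X₀‖, ⟨‖X - X₀‖⁻¹ • (X - X₀), by simp [norm_smul, hn.ne']⟩),
      ⟨subset_tsupport h hX1, subset_tsupport F hX2⟩, ?_⟩
    simp [polar, smul_smul, hn.ne']
  refine ⟨HasCompactSupport.of_support_subset_isCompact hK hsub,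
    (closure_minimal hsub hK.isClosed).trans ?_⟩
  rintro _ ⟨⟨r, ξ⟩, ⟨hr, hξ⟩, rfl⟩
  exact (polar_mem_halfBall h₀ (h3 hr).1).2 ⟨(h3 hr).2, F3 hξ⟩

theorem contDiff_polarField (X₀ : Space N) {R : ℝ} {h : ℝ → ℝ}
    {F : Space N → Space N} (h1 : ContDiff ℝ ∞ h) (h3 : tsupport h ⊆ Ioo 0 R)
    (F1 : ContDiff ℝ ∞ F) : ContDiff ℝ ∞ (polarField X₀ h F) := by
  rw [contDiff_iff_contDiffAt]
  intro X
  by_cases hX : ‖X - X₀‖ ∈ tsupport h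
  · have hn : X - X₀ ≠ 0 := norm_pos_iff.1 (h3 hX).1
    have hs : ContDiffAt ℝ ∞ (fun X : Space N => X - X₀) X := contDiffAt_id.sub contDiffAt_const
    have hnorm : ContDiffAt ℝ ∞ (fun X : Space N => ‖X - X₀‖) X := hs.norm ℝ hn
    exact (h1.contDiffAt.comp X hnorm).smul
      (F1.contDiffAt.comp X ((hnorm.inv (norm_ne_zero_iff.2 hn)).smul hs))
  · have hev : ∀ᶠ Y in 𝓝 X, polarField X₀ h F Y = 0 := by
      have hc : Continuous (fun Y : Space N => ‖Y - X₀‖) := by fun_prop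
      have := hc.continuousAt.preimage_mem_nhds
        ((isClosed_tsupport h).isOpen_compl.mem_nhds hX)
      filter_upwards [this] with Y hY
      have h0 : h ‖Y - X₀‖ = 0 := image_eq_zero_of_notMem_tsupport hY
      rw [polarField, h0, zero_smul]
    exact contDiffAt_const.congr_of_eventuallyEq hev

/-- The defining identity of the weak gradient on a half ball, tested with
`h(|X - X₀|) F((X - X₀) / |X - X₀|)` and written in polar coordinates. -/
theorem IsWeakGrad.integral_polar {X₀ : Space N} (h₀ : yCoord X₀ = 0) {R : ℝ} {v : Space N → ℝ}
    {G : Space N → Space N} (hv : IsWeakGrad (halfBall X₀ R) v G) {h : ℝ → ℝ}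
    {F : Space N → Space N} (h1 : ContDiff ℝ ∞ h) (h2 : HasCompactSupport h)
    (h3 : tsupport h ⊆ Ioo 0 R) (F1 : ContDiff ℝ ∞ F)
    (F3 : tsupport F ⊆ {X | 0 < yCoord X}) :
    Integrable (fun p : ℝ × Sph N => p.1 ^ N * (v (polar X₀ p) *
        (deriv h p.1 * ⟪F p.2, (p.2 : Space N)⟫_ℝ + h p.1 * p.1⁻¹ * tangDiv F p.2)
        + h p.1 * ⟪G (polar X₀ p), F p.2⟫_ℝ)) (cyl N R) ∧
      ∫ p : ℝ × Sph N, p.1 ^ N * (v (polar X₀ p) *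
        (deriv h p.1 * ⟪F p.2, (p.2 : Space N)⟫_ℝ + h p.1 * p.1⁻¹ * tangDiv F p.2)
        + h p.1 * ⟪G (polar X₀ p), F p.2⟫_ℝ) ∂(cyl N R) = 0 := by
  obtain ⟨hc, ht⟩ := polarField_support h₀ h2 h3 F3
  obtain ⟨hi, hz⟩ := hv.integral_divergence (contDiff_polarField X₀ h1 h3 F1) hc ht
  have hcongr : (fun p : ℝ × Sph N => p.1 ^ N • (v (polar X₀ p) *
      divergence (polarField X₀ h F) (polar X₀ p)
        + ⟪G (polar X₀ p), polarField X₀ h F (polar X₀ p)⟫_ℝ)) =ᵐ[cyl N R]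
      fun p : ℝ × Sph N => p.1 ^ N * (v (polar X₀ p) *
        (deriv h p.1 * ⟪F p.2, (p.2 : Space N)⟫_ℝ + h p.1 * p.1⁻¹ * tangDiv F p.2)
        + h p.1 * ⟪G (polar X₀ p), F p.2⟫_ℝ) := by
    filter_upwards [ae_cyl_mem N R] with p hp
    rw [show p = (p.1, p.2) from rfl, divergence_polarField X₀ (h1.differentiable (by simp))
      (F1.differentiable (by simp)) hp.1.1, polarField_polar X₀ h F hp.1.1, inner_smul_right,
      smul_eq_mul]
  refine ⟨(integrable_polar h₀ hi).congr hcongr, ?_⟩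
  rw [← integral_congr_ae hcongr, ← setIntegral_halfBall_eq_cyl h₀ hi.aestronglyMeasurable]
  exact hz

/-! ### Fundamental lemmas of the calculus of variations -/

/-- The direction `X / |X|` of a nonzero vector, as a point of the unit sphere; the value at `0` is
arbitrary. -/
noncomputable def direction (X : Space N) : Sph N :=
  ⟨if X = 0 then EuclideanSpace.single 0 1 else ‖X‖⁻¹ • X, by
    split_ifs with h <;> simp [norm_smul, h]⟩

theorem measurable_direction : Measurable (direction : Space N → Sph N) :=
  Measurable.subtype_mk (Measurable.ite (measurableSet_singleton 0) measurable_const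
    (by fun_prop))

theorem direction_polar_zero {r : ℝ} (hr : 0 < r) (ξ : Sph N) :
    direction (polar 0 (r, ξ)) = ξ := by
  have h1 : polar 0 (r, ξ) ≠ 0 := by
    rw [polar, zero_add]
    exact smul_ne_zero hr.ne' (norm_ne_zero_iff.1 (by simp))
  ext1
  have := direction_polar 0 hr ξ
  rw [sub_zero] at this
  simp only [direction, if_neg h1, this]

/-- Almost every point of the half ball has its direction outside a given null set of `𝕊^N_+`. -/
theorem quasiMeasurePreserving_direction (R : ℝ) :
    Measure.QuasiMeasurePreserving (direction : Space N → Sph N)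
      (volume.restrict (halfBall 0 R)) (surfPos N) := by
  refine ⟨measurable_direction, Measure.AbsolutelyContinuous.mk fun t ht h0 => ?_⟩
  have hmp := measurePreserving_polar (N := N) (X₀ := 0) rfl R
  rw [Measure.map_apply measurable_direction ht, ← hmp.map_eq,
    Measure.map_apply hmp.measurable (measurable_direction ht)]
  have h1 : ∀ᵐ p ∂((radial N R).prod (surfPos N)), p.2 ∉ t :=
    Measure.quasiMeasurePreserving_snd.ae (p := fun ξ => ξ ∉ t) (by
      rw [ae_iff]; simpa using h0)
  have h2 : ∀ᵐ p ∂((radial N R).prod (surfPos N)), 0 < p.1 :=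
    Measure.quasiMeasurePreserving_fst.ae (p := fun r => 0 < r)
      ((radial_absolutelyContinuous N R).ae_le
        ((ae_restrict_mem measurableSet_Ioo).mono fun r hr => hr.1))
  have h3 : ∀ᵐ p ∂((radial N R).prod (surfPos N)), p ∉ polar 0 ⁻¹' (direction ⁻¹' t) := by
    filter_upwards [h1, h2] with p hp1 hp2 hp
    rw [mem_preimage, mem_preimage, show p = (p.1, p.2) from rfl,
      direction_polar_zero hp2] at hp
    exact hp1 hp
  rw [ae_iff] at h3
  simp only [not_not] at h3
  exact h3

/-- The `0`-homogeneous extension of a locally integrable function on `𝕊^N_+`. -/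
theorem locallyIntegrableOn_direction {F : Type*} [NormedAddCommGroup F] [NormedSpace ℝ F]
    {f : Sph N → F} (hf : LocallyIntegrableOn f (hemisphere N) (surf N)) :
    LocallyIntegrableOn (fun X : Space N => f (direction X)) (halfBall 0 1) := by
  rw [locallyIntegrableOn_iff (isOpen_halfBall _ _).isLocallyClosed]
  intro K hK hKc
  let T : Set (ℝ × Sph N) := (Icc 0 1 ×ˢ univ) ∩ polar 0 ⁻¹' K
  have hT : IsCompact T := (isCompact_Icc.prod isCompact_univ).inter_right
    (hKc.isClosed.preimage (continuous_polar 0))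
  have hS : IsCompact (Prod.snd '' T) := hT.image continuous_snd
  have hSsub : Prod.snd '' T ⊆ hemisphere N := by
    rintro _ ⟨⟨r, ξ⟩, ⟨⟨hr, -⟩, hp⟩, rfl⟩
    have h1 : 0 < yCoord (polar 0 (r, ξ)) := (hK hp).2
    rw [polar, zero_add, yCoord_smul] at h1
    exact pos_of_mul_pos_right h1 hr.1
  have hfS := (hf.integrableOn_compact_subset hSsub hS)
  have hind : Integrable ((Prod.snd '' T).indicator f) (surfPos N) :=
    (hfS.integrable_indicator hS.isClosed.measurableSet).restrict
  have hm : AEStronglyMeasurable (fun X : Space N => (Prod.snd '' T).indicator f (direction X))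
      (volume.restrict (halfBall 0 1)) :=
    hind.aestronglyMeasurable.comp_quasiMeasurePreserving (quasiMeasurePreserving_direction 1)
  have hi : IntegrableOn (fun X : Space N => (Prod.snd '' T).indicator f (direction X))
      (halfBall 0 1) := by
    refine integrableOn_of_polar (X₀ := 0) rfl hm ?_
    have hp : IntegrableOn (fun r : ℝ => r ^ N) (Ioo 0 1) :=
      ((continuous_pow N).integrableOn_Icc (a := 0) (b := 1)).mono_set Ioo_subset_Icc_self
    refine (hp.smul_prod hind).congr ?_
    filter_upwards [ae_cyl_mem N 1] with p hp
    have : direction (polar 0 p) = p.2 := direction_polar_zero hp.1.1 p.2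
    rw [this]
  refine (hi.mono_set hK).congr_fun (fun X hX => ?_) hKc.isClosed.measurableSet
  refine indicator_of_mem ?_ f
  have hX0 : X ≠ 0 := by
    rintro rfl
    have : (0 : ℝ) < yCoord (0 : Space N) := (hK hX).2
    simp [yCoord] at this
  have hX1 : ‖X‖ < 1 := by simpa using (hK hX).1
  refine ⟨(‖X‖, direction X), ⟨⟨⟨norm_nonneg _, hX1.le⟩, trivial⟩, ?_⟩, rfl⟩
  have : polar 0 (‖X‖, direction X) = X := by
    simp [polar, direction, hX0, smul_smul]
  rw [mem_preimage, this]
  exact hX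

/-- A locally integrable function on `𝕊^N_+` that is orthogonal to all test functions vanishes
almost everywhere. Its `0`-homogeneous extension is orthogonal to all test functions `g` of the
half ball, because each `g(r ·)` is an admissible test function on the sphere. -/
theorem ae_eq_zero_of_forall_smooth_sphere {F : Type*} [NormedAddCommGroup F] [NormedSpace ℝ F]
    [CompleteSpace F] {f : Sph N → F} (hf : LocallyIntegrableOn f (hemisphere N) (surf N))
    (H : ∀ ψ : Space N → ℝ, ContDiff ℝ ∞ ψ → HasCompactSupport ψ →
      tsupport ψ ⊆ {X | 0 < yCoord X} → ∫ ξ, ψ (ξ : Space N) • f ξ ∂(surfPos N) = 0) :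
    ∀ᵐ ξ ∂(surfPos N), f ξ = 0 := by
  have hloc := locallyIntegrableOn_direction hf
  have key : ∀ᵐ X ∂(volume : Measure (Space N)), X ∈ halfBall 0 1 → f (direction X) = 0 := by
    refine (isOpen_halfBall _ _).ae_eq_zero_of_integral_contDiff_smul_eq_zero hloc ?_
    intro g h1 h2 h3
    have hz : ∀ X, X ∉ halfBall (0 : Space N) 1 → g X = 0 := fun X hX =>
      image_eq_zero_of_notMem_tsupport fun h' => hX (h3 h')
    rw [← setIntegral_eq_integral_of_forall_compl_eq_zero (s := halfBall (0 : Space N) 1)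
      (fun X hX => by rw [hz X hX, zero_smul])]
    have hi : IntegrableOn (fun X => g X • f (direction X)) (halfBall 0 1) := by
      have : IntegrableOn (fun X => g X • f (direction X)) (tsupport g) :=
        (hloc.integrableOn_compact_subset h3 h2).continuousOn_smul h1.continuous.continuousOn h2
      refine (this.integrable_of_forall_notMem_eq_zero fun x hx => ?_).integrableOn
      rw [image_eq_zero_of_notMem_tsupport hx, zero_smul]
    rw [setIntegral_halfBall (X₀ := 0) rfl hi]
    refine (setIntegral_congr_fun measurableSet_Ioo fun r hr => ?_).trans (integral_zero' _ _)
    have h4 : ∀ ξ : Sph N, polar 0 (r, ξ) = r • (ξ : Space N) := fun ξ => by simp [polar]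
    have h5 : ∫ ξ, g (polar 0 (r, ξ)) • f (direction (polar 0 (r, ξ))) ∂(surfPos N) = 0 := by
      simp only [direction_polar_zero hr.1]
      simp only [h4]
      have hemb : Topology.IsClosedEmbedding (fun X : Space N => r • X) :=
        (Homeomorph.smulOfNeZero r hr.1.ne').isClosedEmbedding
      refine H (fun X => g (r • X)) (h1.comp (contDiff_const_smul r))
        (h2.comp_isClosedEmbedding hemb) ?_
      have hsub : tsupport (fun X => g (r • X)) ⊆ (fun X => r • X) ⁻¹' tsupport g :=
        closure_minimal (fun X hX => subset_tsupport g hX)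
          ((isClosed_tsupport g).preimage (continuous_const_smul r))
      intro X hX
      have : 0 < yCoord (r • X) := (h3 (hsub hX)).2
      rw [yCoord_smul] at this
      exact pos_of_mul_pos_right this hr.1.le
    simp only [h5, smul_zero, Pi.zero_apply]
  have h6 := ae_polar (X₀ := 0) (R := 1) (N := N) rfl
    ((ae_restrict_iff' (isOpen_halfBall _ _).measurableSet).2 key)
  have h7 : ∃ r ∈ Ioo (0 : ℝ) 1, ∀ᵐ ξ ∂(surfPos N), f (direction (polar 0 (r, ξ))) = 0 := by
    have h8 := h6.and (ae_restrict_mem measurableSet_Ioo)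
    have : NeBot (ae (volume.restrict (Ioo (0 : ℝ) 1))) := by
      rw [ae_neBot]
      intro h
      have := congrArg (fun μ => μ univ) h
      simp at this
    obtain ⟨r, h9, h10⟩ := h8.exists
    exact ⟨r, h10, h9⟩
  obtain ⟨r, hr, h⟩ := h7
  filter_upwards [h] with ξ hξ
  rwa [direction_polar_zero hr.1] at hξ

/-- The fundamental lemma on `(0, R)`, with local integrability of `k` deduced from that of its
products with test functions. -/
theorem ae_eq_zero_of_forall_smooth_Ioo {R : ℝ} {k : ℝ → ℝ}
    (H : ∀ h : ℝ → ℝ, ContDiff ℝ ∞ h → HasCompactSupport h → tsupport h ⊆ Ioo 0 R →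
      IntegrableOn (fun r => h r * k r) (Ioo 0 R) ∧ ∫ r in Ioo 0 R, h r * k r = 0) :
    ∀ᵐ r ∂(volume.restrict (Ioo 0 R)), k r = 0 := by
  have hloc : LocallyIntegrableOn k (Ioo 0 R) := by
    intro x hx
    obtain ⟨ε, hε, hball⟩ := Metric.isOpen_iff.1 isOpen_Ioo x hx
    let φ : ContDiffBump x := ⟨ε / 4, ε / 2, by linarith, by linarith⟩
    have hs : tsupport φ ⊆ Ioo 0 R := by
      rw [φ.tsupport_eq]
      exact (closedBall_subset_ball (show ε / 2 < ε by linarith)).trans hball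
    refine ⟨closedBall x (ε / 4), mem_nhdsWithin_of_mem_nhds
      (closedBall_mem_nhds x (by linarith)), ?_⟩
    have h1 := (H φ φ.contDiff φ.hasCompactSupport hs).1.mono_set (s := closedBall x (ε / 4))
      ((closedBall_subset_ball (show ε / 4 < ε by linarith)).trans hball)
    refine h1.congr_fun (fun y hy => ?_) measurableSet_closedBall
    simp only [φ.one_of_mem_closedBall hy, one_mul]
  rw [ae_restrict_iff' measurableSet_Ioo]
  refine isOpen_Ioo.ae_eq_zero_of_integral_contDiff_smul_eq_zero hloc fun g h1 h2 h3 => ?_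
  rw [← (H g h1 h2 h3).2, setIntegral_eq_integral_of_forall_compl_eq_zero]
  · rfl
  · intro x hx
    rw [image_eq_zero_of_notMem_tsupport fun h' => hx (h3 h'), zero_mul]

/-- The tangential gradient is unique up to null sets. -/
theorem IsWeakTangGrad.ae_eq {u : Sph N → ℝ} {G G' : Sph N → Space N} (h : IsWeakTangGrad u G)
    (h' : IsWeakTangGrad u G') : ∀ᵐ ξ ∂(surfPos N), G ξ = G' ξ := by
  have := ae_eq_zero_of_forall_smooth_sphere (f := fun ξ => G ξ - G' ξ) (h.2.1.sub h'.2.1) ?_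
  · filter_upwards [this] with ξ hξ
    exact sub_eq_zero.1 hξ
  intro ψ h1 h2 h3
  have hi : ∀ {A : Sph N → Space N}, LocallyIntegrableOn A (hemisphere N) (surf N) →
      Integrable (fun ξ : Sph N => ψ (ξ : Space N) • A ξ) (surfPos N) := by
    intro A hA
    have hS : IsCompact (Subtype.val ⁻¹' tsupport ψ : Set (Sph N)) :=
      ((isClosed_tsupport ψ).preimage continuous_subtype_val).isCompact
    have : IntegrableOn (fun ξ : Sph N => ψ (ξ : Space N) • A ξ)
        (Subtype.val ⁻¹' tsupport ψ) (surf N) :=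
      (hA.integrableOn_compact_subset (fun ξ hξ => h3 hξ) hS).continuousOn_smul
        (h1.continuous.comp continuous_subtype_val).continuousOn hS
    refine (this.integrable_of_forall_notMem_eq_zero fun x hx => ?_).restrict
    rw [image_eq_zero_of_notMem_tsupport (f := ψ) hx, zero_smul]
  have hi1 := hi h.2.1
  have hi2 := hi h'.2.1
  simp only [smul_sub]
  rw [integral_sub hi1 hi2]
  refine ext_inner_left ℝ fun e => ?_
  rw [inner_sub_right, inner_zero_right, ← integral_inner hi1, ← integral_inner hi2]
  -- The tangential part of the constant field `e` is an admissible direction.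
  let F : Space N → Space N := fun X => ψ X • (e - ⟪e, X⟫_ℝ • X)
  have hF1 : ContDiff ℝ ∞ F :=
    h1.smul (contDiff_const.sub ((contDiff_const.inner ℝ contDiff_id).smul contDiff_id))
  have hFs : tsupport F ⊆ tsupport ψ := tsupport_smul_subset_left _ _
  have hF2 : HasCompactSupport F := h2.smul_right
  have hF4 : ∀ ξ : Sph N, ⟪F ξ, (ξ : Space N)⟫_ℝ = 0 := by
    intro ξ
    simp [F, inner_smul_left, inner_sub_left]
  have e1 : ∀ {A : Sph N → Space N}, (∀ ξ : Sph N, ⟪A ξ, (ξ : Space N)⟫_ℝ = 0) → ∀ ξ : Sph N,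
      ⟪e, ψ (ξ : Space N) • A ξ⟫_ℝ = ⟪A ξ, F ξ⟫_ℝ := by
    intro A hA ξ
    simp [F, inner_smul_right, inner_sub_right, hA ξ, real_inner_comm]
  simp only [e1 h.2.2.1, e1 h'.2.2.1]
  have t1 := h.2.2.2 F hF1 hF2 (hFs.trans h3) hF4
  have t2 := h'.2.2.2 F hF1 hF2 (hFs.trans h3) hF4
  rw [t1] at t2
  exact sub_eq_zero.2 (neg_injective t2)

/-- The weak gradient is unique up to null sets. -/
theorem IsWeakGrad.ae_eq {Ω : Set (Space N)} (hΩ : IsOpen Ω) {v : Space N → ℝ}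
    {G G' : Space N → Space N} (h : IsWeakGrad Ω v G) (h' : IsWeakGrad Ω v G') :
    ∀ᵐ X ∂(volume.restrict Ω), G X = G' X := by
  rw [ae_restrict_iff' hΩ.measurableSet]
  have := hΩ.ae_eq_zero_of_integral_contDiff_smul_eq_zero (h.2.1.sub h'.2.1) ?_
  · filter_upwards [this] with X hX hX'
    exact sub_eq_zero.1 (hX hX')
  intro φ h1 h2 h3
  have hi : ∀ {A : Space N → Space N}, LocallyIntegrableOn A Ω →
      IntegrableOn (fun X => φ X • A X) Ω := by
    intro A hA
    have : IntegrableOn (fun X => φ X • A X) (tsupport φ) :=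
      (hA.integrableOn_compact_subset h3 h2).continuousOn_smul h1.continuous.continuousOn h2
    refine (this.integrable_of_forall_notMem_eq_zero fun x hx => ?_).integrableOn
    rw [image_eq_zero_of_notMem_tsupport hx, zero_smul]
  rw [← setIntegral_eq_integral_of_forall_compl_eq_zero (s := Ω) fun X hX => by
    rw [image_eq_zero_of_notMem_tsupport fun hX' => hX (h3 hX'), zero_smul]]
  simp only [Pi.sub_apply, smul_sub]
  rw [integral_sub (hi h.2.1) (hi h'.2.1), sub_eq_zero]
  exact neg_injective ((h.2.2 φ h1 h2 h3).symm.trans (h'.2.2 φ h1 h2 h3))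

/-! ### Restriction to spheres -/

/-- `v` is a function of finite weighted energy on `B_R^+(X₀)`, where `X₀` lies on `{y = 0}`, with
weak gradient `G`, and it is continuous up to the flat part of the boundary. -/
structure FiniteEnergy (s : ℝ) (X₀ : Space N) (R : ℝ) (v : Space N → ℝ) (G : Space N → Space N) :
    Prop where
  flat : yCoord X₀ = 0
  weakGrad : IsWeakGrad (halfBall X₀ R) v G
  integrable : IntegrableOn (fun X => weight s X * (v X ^ 2 + ‖G X‖ ^ 2)) (halfBall X₀ R)
  continuousOn : ContinuousOn v (ball X₀ R ∩ {X | 0 ≤ yCoord X})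

theorem weight_pos {s : ℝ} {X : Space N} (h : 0 < yCoord X) : 0 < weight s X :=
  Real.rpow_pos_of_pos h _

/-- Homogeneity of the weight, with the Jacobian `r^N` of polar coordinates. -/
theorem weight_polar (s : ℝ) {X₀ : Space N} (h₀ : yCoord X₀ = 0) {r : ℝ} (hr : 0 < r) {ξ : Sph N}
    (hξ : ξ ∈ hemisphere N) :
    r ^ N * weight s (polar X₀ (r, ξ)) = r ^ ((N : ℝ) - 2 * s + 1) * weight s (ξ : Space N) := by
  have h : 0 < yCoord (ξ : Space N) := hξ
  rw [weight, weight, polar, yCoord_add, h₀, zero_add, yCoord_smul, Real.mul_rpow hr.le h.le,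
    ← mul_assoc, ← Real.rpow_natCast, ← Real.rpow_add hr]
  congr 2
  ring

theorem continuousOn_weight (s : ℝ) :
    ContinuousOn (fun ξ : Sph N => weight s (ξ : Space N)) (hemisphere N) := by
  intro ξ hξ
  have h : 0 < yCoord (ξ : Space N) := hξ
  exact ((continuous_yCoord.comp continuous_subtype_val).continuousAt.rpow_const
    (Or.inl h.ne')).continuousWithinAt

/-- The weight is bounded from below away from the equator, so that weighted integrability implies
local integrability. -/
theorem exists_weight_ge (s : ℝ) {S : Set (Sph N)} (hS : IsCompact S) (hSsub : S ⊆ hemisphere N) :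
    ∃ c > 0, ∀ ξ ∈ S, c ≤ weight s (ξ : Space N) := by
  rcases S.eq_empty_or_nonempty with rfl | hne
  · exact ⟨1, one_pos, by simp⟩
  obtain ⟨ξ, hξ, h⟩ := hS.exists_isMinOn hne ((continuousOn_weight s).mono hSsub)
  exact ⟨_, weight_pos (hSsub hξ), fun η hη => h hη⟩

theorem ae_surfPos_mem (N : ℕ) : ∀ᵐ ξ ∂(surfPos N), ξ ∈ hemisphere N :=
  ae_restrict_mem isOpen_hemisphere.measurableSet

namespace FiniteEnergy

variable {s R : ℝ} {X₀ : Space N} {v : Space N → ℝ} {G : Space N → Space N}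

theorem polar_mem (h : FiniteEnergy s X₀ R v G) {r : ℝ} (hr : r ∈ Ioo 0 R) {ξ : Sph N}
    (hξ : ξ ∈ closedHemisphere N) : polar X₀ (r, ξ) ∈ ball X₀ R ∩ {X | 0 ≤ yCoord X} := by
  refine ⟨?_, ?_⟩
  · rw [mem_ball_iff_norm, norm_polar_sub X₀ hr.1]; exact hr.2
  · have h1 : 0 ≤ yCoord (ξ : Space N) := hξ
    simpa [polar, h.flat] using mul_nonneg hr.1.le h1

theorem continuousOn_polar (h : FiniteEnergy s X₀ R v G) :
    ContinuousOn (fun p => v (polar X₀ p)) (Ioo 0 R ×ˢ closedHemisphere N) :=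
  h.continuousOn.comp (continuous_polar X₀).continuousOn fun _ hp => h.polar_mem hp.1 hp.2

theorem continuousOn_slice (h : FiniteEnergy s X₀ R v G) {r : ℝ} (hr : r ∈ Ioo 0 R) :
    ContinuousOn (fun ξ => v (polar X₀ (r, ξ))) (closedHemisphere N) :=
  h.continuousOn_polar.comp (by fun_prop) fun _ hξ => ⟨hr, hξ⟩

theorem continuousOn_ray (h : FiniteEnergy s X₀ R v G) {ξ : Sph N} (hξ : ξ ∈ hemisphere N) :
    ContinuousOn (fun r => v (polar X₀ (r, ξ))) (Ioo 0 R) :=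
  h.continuousOn_polar.comp (by fun_prop) fun r hr => ⟨hr, le_of_lt (show 0 < yCoord _ from hξ)⟩

theorem hemisphere_subset : hemisphere N ⊆ closedHemisphere N :=
  fun ξ hξ => le_of_lt (show 0 < yCoord (ξ : Space N) from hξ)

theorem aestronglyMeasurable_polar (h : FiniteEnergy s X₀ R v G) :
    AEStronglyMeasurable (fun p => v (polar X₀ p)) (cyl N R) := by
  rw [cyl, surfPos, Measure.prod_restrict]
  exact (h.continuousOn_polar.mono (prod_mono le_rfl hemisphere_subset)).aestronglyMeasurable
    (measurableSet_Ioo.prod isOpen_hemisphere.measurableSet)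

theorem aestronglyMeasurable_grad_polar (h : FiniteEnergy s X₀ R v G) :
    AEStronglyMeasurable (fun p => G (polar X₀ p)) (cyl N R) :=
  (h.weakGrad.2.1.aestronglyMeasurable).comp_quasiMeasurePreserving
    (quasiMeasurePreserving_polar h.flat R)

theorem aestronglyMeasurable_weight (s : ℝ) :
    AEStronglyMeasurable (fun ξ : Sph N => weight s (ξ : Space N)) (surfPos N) :=
  (continuousOn_weight s).aestronglyMeasurable isOpen_hemisphere.measurableSet

theorem integrable_cyl (h : FiniteEnergy s X₀ R v G) :
    Integrable (fun p : ℝ × Sph N => p.1 ^ ((N : ℝ) - 2 * s + 1) * (weight s (p.2 : Space N) *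
      (v (polar X₀ p) ^ 2 + ‖G (polar X₀ p)‖ ^ 2))) (cyl N R) := by
  refine (integrable_polar h.flat h.integrable).congr ?_
  filter_upwards [ae_cyl_mem N R] with p hp
  have := weight_polar s h.flat hp.1.1 hp.2
  rw [smul_eq_mul, ← mul_assoc, this, mul_assoc]

/-- Fubini's theorem for the weighted energy: almost every sphere carries finite energy. -/
theorem ae_slice (h : FiniteEnergy s X₀ R v G) :
    ∀ᵐ r ∂(volume.restrict (Ioo 0 R)),
      AEStronglyMeasurable (fun ξ => G (polar X₀ (r, ξ))) (surfPos N) ∧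
      Integrable (fun ξ : Sph N => weight s (ξ : Space N) *
        (v (polar X₀ (r, ξ)) ^ 2 + ‖G (polar X₀ (r, ξ))‖ ^ 2)) (surfPos N) := by
  have h1 : ∀ᵐ r ∂(volume.restrict (Ioo 0 R)),
      AEStronglyMeasurable (fun ξ => G (polar X₀ (r, ξ))) (surfPos N) :=
    h.aestronglyMeasurable_grad_polar.prodMk_left
  filter_upwards [h1, h.integrable_cyl.prod_right_ae, ae_restrict_mem measurableSet_Ioo]
    with r hr1 hr2 hr3
  refine ⟨hr1, ?_⟩
  have := hr2.const_mul (r ^ ((N : ℝ) - 2 * s + 1))⁻¹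
  refine this.congr (Eventually.of_forall fun ξ => ?_)
  simp only
  rw [inv_mul_cancel_left₀ (Real.rpow_pos_of_pos hr3.1 _).ne']

/-- Fubini's theorem for the weighted energy, along rays. -/
theorem ae_ray (h : FiniteEnergy s X₀ R v G) :
    ∀ᵐ ξ ∂(surfPos N),
      AEStronglyMeasurable (fun r => G (polar X₀ (r, ξ))) (volume.restrict (Ioo 0 R)) ∧
      IntegrableOn (fun r => r ^ ((N : ℝ) - 2 * s + 1) *
        (v (polar X₀ (r, ξ)) ^ 2 + ‖G (polar X₀ (r, ξ))‖ ^ 2)) (Ioo 0 R) := by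
  have h1 : ∀ᵐ ξ ∂(surfPos N),
      AEStronglyMeasurable (fun r => G (polar X₀ (r, ξ))) (volume.restrict (Ioo 0 R)) :=
    h.aestronglyMeasurable_grad_polar.prod_swap.prodMk_left
  filter_upwards [h1, h.integrable_cyl.prod_left_ae, ae_surfPos_mem N] with ξ hr1 hr2 hr3
  refine ⟨hr1, ?_⟩
  have := hr2.const_mul (weight s (ξ : Space N))⁻¹
  refine this.congr (Eventually.of_forall fun r => ?_)
  have hw := (weight_pos (s := s) (show 0 < yCoord (ξ : Space N) from hr3)).ne'
  simp only
  field_simp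

theorem norm_le_of_sq {E : Type*} [SeminormedAddCommGroup E] (x : E) {c w t : ℝ} (hc : 0 < c)
    (hw : c ≤ w) : ‖x‖ ≤ 1 + c⁻¹ * (w * (t ^ 2 + ‖x‖ ^ 2)) := by
  have h1 : ‖x‖ ≤ 1 + ‖x‖ ^ 2 := by nlinarith [norm_nonneg x, sq_nonneg (‖x‖ - 1)]
  have h2 : c * ‖x‖ ^ 2 ≤ w * (t ^ 2 + ‖x‖ ^ 2) :=
    mul_le_mul hw (by nlinarith [sq_nonneg t]) (sq_nonneg _) (hc.le.trans hw)
  have h3 := mul_le_mul_of_nonneg_left h2 (inv_pos.2 hc).le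
  rw [inv_mul_cancel_left₀ hc.ne'] at h3
  linarith

theorem integrableOn_slice {r : ℝ}
    (hm : AEStronglyMeasurable (fun ξ => G (polar X₀ (r, ξ))) (surfPos N))
    (hi : Integrable (fun ξ : Sph N => weight s (ξ : Space N) *
        (v (polar X₀ (r, ξ)) ^ 2 + ‖G (polar X₀ (r, ξ))‖ ^ 2)) (surfPos N))
    {S : Set (Sph N)} (hS : IsCompact S) (hSsub : S ⊆ hemisphere N) :
    IntegrableOn (fun ξ => G (polar X₀ (r, ξ))) S (surf N) := by
  obtain ⟨c, hc, hcw⟩ := exists_weight_ge s hS hSsub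
  have hi' := (show IntegrableOn _ (hemisphere N) (surf N) from hi).mono_set hSsub
  have hc1 : IntegrableOn (fun _ : Sph N => (1 : ℝ)) S (surf N) := integrable_const _
  refine (hc1.add (hi'.const_mul c⁻¹)).mono' (hm.mono_measure (Measure.restrict_mono hSsub le_rfl))
    ?_
  filter_upwards [ae_restrict_mem hS.isClosed.measurableSet] with ξ hξ
  exact norm_le_of_sq _ hc (hcw ξ hξ)

end FiniteEnergy

/-- The tangential divergence at `ξ` of a field with derivative `T` there. Unlike `tangDiv` it is
defined for limits of derivatives, and it is continuous in `(T, ξ)`. -/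
noncomputable def tangTrace (T : Space N →L[ℝ] Space N) (ξ : Sph N) : ℝ :=
  LinearMap.trace ℝ (Space N) T.toLinearMap - ⟪T (ξ : Space N), (ξ : Space N)⟫_ℝ

theorem exists_tangTrace_bound (N : ℕ) :
    ∃ A : ℝ, ∀ (T : Space N →L[ℝ] Space N) (ξ : Sph N), |tangTrace T ξ| ≤ A * ‖T‖ := by
  let τ : (Space N →L[ℝ] Space N) →L[ℝ] ℝ := LinearMap.toContinuousLinearMap
    (LinearMap.trace ℝ (Space N) ∘ₗ ContinuousLinearMap.coeLM ℝ)
  refine ⟨‖τ‖ + 1, fun T ξ => ?_⟩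
  have h1 : |τ T| ≤ ‖τ‖ * ‖T‖ := τ.le_opNorm T
  have h2 : |⟪T (ξ : Space N), (ξ : Space N)⟫_ℝ| ≤ ‖T‖ := by
    refine (abs_real_inner_le_norm _ _).trans ?_
    have := T.le_opNorm (ξ : Space N)
    rw [norm_sph, mul_one] at this ⊢
    exact this
  have h3 : tangTrace T ξ = τ T - ⟪T (ξ : Space N), (ξ : Space N)⟫_ℝ := rfl
  rw [h3, add_mul, one_mul]
  exact (abs_sub _ _).trans (add_le_add h1 h2)

theorem continuous_tangTrace :
    Continuous (fun q : (Space N →L[ℝ] Space N) × Sph N => tangTrace q.1 q.2) := by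
  let τ : (Space N →L[ℝ] Space N) →L[ℝ] ℝ := LinearMap.toContinuousLinearMap
    (LinearMap.trace ℝ (Space N) ∘ₗ ContinuousLinearMap.coeLM ℝ)
  have h1 : Continuous (fun q : (Space N →L[ℝ] Space N) × Sph N => τ q.1) :=
    τ.continuous.comp continuous_fst
  have h2 : Continuous (fun q : (Space N →L[ℝ] Space N) × Sph N =>
      ⟪q.1 (q.2 : Space N), (q.2 : Space N)⟫_ℝ) := by fun_prop
  exact h1.sub h2

theorem tangDiv_eq_tangTrace (F : Space N → Space N) (ξ : Sph N) :
    tangDiv F ξ = tangTrace (fderiv ℝ F ξ) ξ := rfl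

/-- The compact part `{y ≥ 1 / (n + 1)}` of the open upper half sphere. -/
def hemisphereGe (N n : ℕ) : Set (Sph N) := {ξ | 1 / ((n : ℝ) + 1) ≤ yCoord (ξ : Space N)}

theorem isCompact_hemisphereGe (n : ℕ) : IsCompact (hemisphereGe N n) :=
  (isClosed_le continuous_const (continuous_yCoord.comp continuous_subtype_val)).isCompact

theorem hemisphereGe_subset (n : ℕ) : hemisphereGe N n ⊆ hemisphere N := fun ξ hξ =>
  lt_of_lt_of_le (by positivity) (show 1 / ((n : ℝ) + 1) ≤ yCoord (ξ : Space N) from hξ)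

/-- Tangential test fields supported in `{y ≥ 1 / (n + 1)}`. -/
structure IsTangTest (n : ℕ) (F : Space N → Space N) : Prop where
  contDiff : ContDiff ℝ ∞ F
  tsupport_subset : tsupport F ⊆ {X | 1 / ((n : ℝ) + 1) ≤ yCoord X}
  tangent : ∀ ξ : Sph N, ⟪F ξ, (ξ : Space N)⟫_ℝ = 0

theorem exists_isTangTest {F : Space N → Space N} (h1 : ContDiff ℝ ∞ F) (h2 : HasCompactSupport F)
    (h3 : tsupport F ⊆ {X | 0 < yCoord X}) (h4 : ∀ ξ : Sph N, ⟪F ξ, (ξ : Space N)⟫_ℝ = 0) :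
    ∃ n, IsTangTest n F := by
  rcases (tsupport F).eq_empty_or_nonempty with he | hne
  · exact ⟨0, h1, by rw [he]; exact empty_subset _, h4⟩
  obtain ⟨X, hX, hmin⟩ := h2.exists_isMinOn hne continuous_yCoord.continuousOn
  obtain ⟨n, hn⟩ := exists_nat_one_div_lt (show 0 < yCoord X from h3 hX)
  exact ⟨n, h1, fun Y hY => hn.le.trans (hmin hY), h4⟩

theorem IsTangTest.eq_zero {n : ℕ} {F : Space N → Space N} (h : IsTangTest n F) {ξ : Sph N}
    (hξ : ξ ∉ hemisphereGe N n) : F ξ = 0 ∧ tangDiv F ξ = 0 := by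
  have h1 : (ξ : Space N) ∉ tsupport F := fun h' => hξ (h.tsupport_subset h')
  refine ⟨image_eq_zero_of_notMem_tsupport h1, ?_⟩
  have h2 : fderiv ℝ F ξ = 0 := by
    by_contra h'
    exact h1 (support_fderiv_subset ℝ h')
  simp [tangDiv, h2]

namespace FiniteEnergy

variable {s R : ℝ} {X₀ : Space N} {v : Space N → ℝ} {G : Space N → Space N}

/-- The weak tangential gradient identity for a fixed test field, on almost every sphere. -/
theorem ae_integral_tangDiv (h : FiniteEnergy s X₀ R v G) {F : Space N → Space N}
    (h1 : ContDiff ℝ ∞ F) (h3 : tsupport F ⊆ {X | 0 < yCoord X})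
    (h4 : ∀ ξ : Sph N, ⟪F ξ, (ξ : Space N)⟫_ℝ = 0) :
    ∀ᵐ r ∂(volume.restrict (Ioo 0 R)),
      ∫ ξ, (v (polar X₀ (r, ξ)) * tangDiv F ξ + r * ⟪G (polar X₀ (r, ξ)), F ξ⟫_ℝ) ∂(surfPos N)
        = 0 := by
  have key := ae_eq_zero_of_forall_smooth_Ioo (R := R) (k := fun r => r ^ N * r⁻¹ *
    ∫ ξ, (v (polar X₀ (r, ξ)) * tangDiv F ξ + r * ⟪G (polar X₀ (r, ξ)), F ξ⟫_ℝ) ∂(surfPos N)) ?_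
  · filter_upwards [key, ae_restrict_mem measurableSet_Ioo] with r hr hr'
    have h0 : r ≠ 0 := hr'.1.ne'
    exact (mul_eq_zero.1 hr).resolve_left (mul_ne_zero (pow_ne_zero _ h0) (inv_ne_zero h0))
  intro g g1 g2 g3
  obtain ⟨hi, hz⟩ := h.weakGrad.integral_polar h.flat g1 g2 g3 h1 h3
  rw [cyl] at hi hz
  rw [integral_prod _ hi] at hz
  have hi' := hi.integral_prod_left
  have e : ∀ r ∈ Ioo 0 R, ∫ ξ, r ^ N * (v (polar X₀ (r, ξ)) *
        (deriv g r * ⟪F ξ, (ξ : Space N)⟫_ℝ + g r * r⁻¹ * tangDiv F ξ)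
        + g r * ⟪G (polar X₀ (r, ξ)), F ξ⟫_ℝ) ∂(surfPos N) = g r * (r ^ N * r⁻¹ *
      ∫ ξ, (v (polar X₀ (r, ξ)) * tangDiv F ξ + r * ⟪G (polar X₀ (r, ξ)), F ξ⟫_ℝ) ∂(surfPos N)) := by
    intro r hr
    rw [← integral_const_mul, ← integral_const_mul]
    refine integral_congr_ae (Eventually.of_forall fun ξ => ?_)
    have h0 : r ≠ 0 := hr.1.ne'
    simp only [h4 ξ]
    field_simp
    ring
  refine ⟨?_, ?_⟩
  · refine IntegrableOn.congr_fun hi' (fun r hr => e r hr) measurableSet_Ioo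
  · exact (setIntegral_congr_fun measurableSet_Ioo fun r hr => e r hr).symm.trans hz

/-- The weak tangential gradient identity holds on almost every sphere for all test fields at
once, since test fields with their first derivatives form a separable subset of a space of
continuous functions. -/
theorem ae_forall_integral_tangDiv (h : FiniteEnergy s X₀ R v G) :
    ∀ᵐ r ∂(volume.restrict (Ioo 0 R)), ∀ F : Space N → Space N, ContDiff ℝ ∞ F →
      HasCompactSupport F → tsupport F ⊆ {X | 0 < yCoord X} →
      (∀ ξ : Sph N, ⟪F ξ, (ξ : Space N)⟫_ℝ = 0) →
      ∫ ξ, (v (polar X₀ (r, ξ)) * tangDiv F ξ + r * ⟪G (polar X₀ (r, ξ)), F ξ⟫_ℝ) ∂(surfPos N)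
        = 0 := by
  -- The test fields supported in `{y ≥ 1 / (n + 1)}`, seen on the sphere with their derivatives. The
  -- common support makes the passage to the limit possible, as `v` and `G` are integrable there.
  let 𝓢 : ℕ → Set C(Sph N, Space N × (Space N →L[ℝ] Space N)) := fun n =>
    {c | ∃ F : Space N → Space N, IsTangTest n F ∧ ∀ ξ : Sph N, c ξ = (F ξ, fderiv ℝ F ξ)}
  have hsep : ∀ n, ∃ t ⊆ 𝓢 n, t.Countable ∧ 𝓢 n ⊆ closure t := fun n =>
    (TopologicalSpace.IsSeparable.of_separableSpace (𝓢 n)).exists_countable_dense_subset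
  choose t ht htc htd using hsep
  have hall : ∀ᵐ r ∂(volume.restrict (Ioo 0 R)), ∀ n, ∀ c ∈ t n,
      ∫ ξ in hemisphereGe N n, (v (polar X₀ (r, ξ)) * tangTrace (c ξ).2 ξ
        + r * ⟪G (polar X₀ (r, ξ)), (c ξ).1⟫_ℝ) ∂(surf N) = 0 := by
    rw [ae_all_iff]
    intro n
    rw [ae_ball_iff (htc n)]
    intro c hc
    obtain ⟨F, hF, hcF⟩ := ht n hc
    filter_upwards [h.ae_integral_tangDiv hF.contDiff (hF.tsupport_subset.trans fun X hX =>
      lt_of_lt_of_le (by positivity) (show 1 / ((n : ℝ) + 1) ≤ yCoord X from hX)) hF.tangent]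
      with r hr
    rw [← hr, surfPos]
    simp only [hcF, ← tangDiv_eq_tangTrace]
    refine (setIntegral_eq_of_subset_of_forall_sdiff_eq_zero isOpen_hemisphere.measurableSet
      (hemisphereGe_subset n) fun ξ hξ => ?_).symm
    rw [(hF.eq_zero hξ.2).1, (hF.eq_zero hξ.2).2]
    simp
  obtain ⟨A, hA⟩ := exists_tangTrace_bound N
  filter_upwards [hall, h.ae_slice, ae_restrict_mem measurableSet_Ioo] with r hr hgood hrR
  intro F h1 h2 h3 h4
  obtain ⟨n, hF⟩ := exists_isTangTest h1 h2 h3 h4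
  let c : C(Sph N, Space N × (Space N →L[ℝ] Space N)) :=
    ⟨fun ξ => (F ξ, fderiv ℝ F ξ), (h1.continuous.comp continuous_subtype_val).prodMk
      ((h1.continuous_fderiv (by simp)).comp continuous_subtype_val)⟩
  have hc : c ∈ 𝓢 n := ⟨F, hF, fun ξ => rfl⟩
  obtain ⟨w, hw, hwc⟩ := mem_closure_iff_seq_limit.1 (htd n hc)
  have hwn : Tendsto (fun k => ‖w k‖) atTop (𝓝 ‖c‖) := (continuous_norm.tendsto c).comp hwc
  obtain ⟨M, hM⟩ := hwn.bddAbove_range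
  have hS := isCompact_hemisphereGe (N := N) n
  have hSm : MeasurableSet (hemisphereGe N n) := hS.isClosed.measurableSet
  have hGi := integrableOn_slice hgood.1 hgood.2 hS (hemisphereGe_subset n)
  have hvc : ContinuousOn (fun ξ => v (polar X₀ (r, ξ))) (hemisphereGe N n) :=
    (h.continuousOn_slice hrR).mono ((hemisphereGe_subset n).trans hemisphere_subset)
  have hvi : IntegrableOn (fun ξ => v (polar X₀ (r, ξ))) (hemisphereGe N n) (surf N) :=
    hvc.integrableOn_compact hS
  have hlim : Tendsto (fun k => ∫ ξ in hemisphereGe N n, (v (polar X₀ (r, ξ)) *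
      tangTrace (w k ξ).2 ξ + r * ⟪G (polar X₀ (r, ξ)), (w k ξ).1⟫_ℝ) ∂(surf N)) atTop
      (𝓝 (∫ ξ in hemisphereGe N n, (v (polar X₀ (r, ξ)) *
      tangTrace (c ξ).2 ξ + r * ⟪G (polar X₀ (r, ξ)), (c ξ).1⟫_ℝ) ∂(surf N))) := by
    refine tendsto_integral_of_dominated_convergence (fun ξ =>
      ‖v (polar X₀ (r, ξ))‖ * (|A| * M) + r * (‖G (polar X₀ (r, ξ))‖ * M)) (fun k => ?_) ?_
      (fun k => ?_) ?_
    · have hc1 : Continuous (fun ξ => tangTrace (w k ξ).2 ξ) :=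
        continuous_tangTrace.comp (((w k).continuous.snd).prodMk continuous_id)
      have hc2 : Continuous (fun ξ => (w k ξ).1) := (w k).continuous.fst
      exact (hvi.aestronglyMeasurable.mul hc1.aestronglyMeasurable).add
        ((hGi.aestronglyMeasurable.inner hc2.aestronglyMeasurable).const_mul r)
    · exact (hvi.norm.mul_const _).add ((hGi.norm.mul_const _).const_mul _)
    · refine Eventually.of_forall fun ξ => ?_
      have hk : ‖w k ξ‖ ≤ M := ((w k).norm_coe_le_norm ξ).trans (hM ⟨k, rfl⟩)
      have hk1 : ‖(w k ξ).1‖ ≤ M := (norm_fst_le _).trans hk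
      have hk2 : ‖(w k ξ).2‖ ≤ M := (norm_snd_le _).trans hk
      refine (norm_add_le _ _).trans (add_le_add ?_ ?_)
      · rw [norm_mul]
        refine mul_le_mul_of_nonneg_left ((hA _ _).trans ?_) (norm_nonneg _)
        exact mul_le_mul (le_abs_self A) hk2 (norm_nonneg _) (abs_nonneg _)
      · rw [norm_mul, Real.norm_of_nonneg hrR.1.le]
        refine mul_le_mul_of_nonneg_left ((norm_inner_le_norm _ _).trans ?_) hrR.1.le
        exact mul_le_mul_of_nonneg_left hk1 (norm_nonneg _)
    · refine Eventually.of_forall fun ξ => ?_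
      have hpt : Tendsto (fun k => w k ξ) atTop (𝓝 (c ξ)) :=
        ((continuous_eval_const ξ).tendsto c).comp hwc
      have ht1 : Tendsto (fun k => tangTrace (w k ξ).2 ξ) atTop (𝓝 (tangTrace (c ξ).2 ξ)) :=
        (continuous_tangTrace.tendsto ((c ξ).2, ξ)).comp
          ((hpt.snd_nhds).prodMk_nhds tendsto_const_nhds)
      exact (tendsto_const_nhds.mul ht1).add
        (tendsto_const_nhds.mul (tendsto_const_nhds.inner hpt.fst_nhds))
  have hzero : ∀ k, ∫ ξ in hemisphereGe N n, (v (polar X₀ (r, ξ)) *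
      tangTrace (w k ξ).2 ξ + r * ⟪G (polar X₀ (r, ξ)), (w k ξ).1⟫_ℝ) ∂(surf N) = 0 :=
    fun k => hr n (w k) (hw k)
  simp only [hzero] at hlim
  have hfin := tendsto_nhds_unique hlim tendsto_const_nhds
  rw [← hfin, surfPos]
  refine setIntegral_eq_of_subset_of_forall_sdiff_eq_zero isOpen_hemisphere.measurableSet
      (hemisphereGe_subset n) fun ξ hξ => ?_
  rw [(hF.eq_zero hξ.2).1, (hF.eq_zero hξ.2).2]
  simp

/-- On almost every sphere the rescaled tangential part of `G` is a weak tangential gradient. -/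
theorem ae_isWeakTangGrad (h : FiniteEnergy s X₀ R v G) :
    ∀ᵐ r ∂(volume.restrict (Ioo 0 R)), IsWeakTangGrad (fun ξ => v (polar X₀ (r, ξ)))
      (fun ξ => r • (G (polar X₀ (r, ξ)) - ⟪G (polar X₀ (r, ξ)), (ξ : Space N)⟫_ℝ • (ξ : Space N)))
      := by
  filter_upwards [h.ae_forall_integral_tangDiv, h.ae_slice, ae_restrict_mem measurableSet_Ioo]
    with r hr hgood hrR
  have hvloc : LocallyIntegrableOn (fun ξ => v (polar X₀ (r, ξ))) (hemisphere N) (surf N) :=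
    ((h.continuousOn_slice hrR).mono hemisphere_subset).locallyIntegrableOn
      isOpen_hemisphere.measurableSet
  have hG := fun {S : Set (Sph N)} (hS : IsCompact S) (hSsub : S ⊆ hemisphere N) =>
    integrableOn_slice hgood.1 hgood.2 hS hSsub
  refine ⟨hvloc, ?_, ?_, ?_⟩
  · rw [locallyIntegrableOn_iff isOpen_hemisphere.isLocallyClosed]
    intro S hS hSc
    have hi := hG hSc hS
    have hmξ : AEStronglyMeasurable (fun ξ : Sph N => (ξ : Space N)) ((surf N).restrict S) :=
      continuous_subtype_val.aestronglyMeasurable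
    have hi2 : IntegrableOn (fun ξ : Sph N =>
        ⟪G (polar X₀ (r, ξ)), (ξ : Space N)⟫_ℝ • (ξ : Space N)) S (surf N) := by
      refine hi.norm.mono' ((hi.aestronglyMeasurable.inner (𝕜 := ℝ) hmξ).smul hmξ)
        (Eventually.of_forall fun ξ => ?_)
      rw [norm_smul, norm_sph, mul_one]
      refine (norm_inner_le_norm _ _).trans ?_
      rw [norm_sph, mul_one]
    exact (hi.sub hi2).smul r
  · intro ξ
    simp [inner_smul_left, inner_sub_left]
  · intro F h1 h2 h3 h4
    obtain ⟨n, hF⟩ := exists_isTangTest h1 h2 h3 h4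
    have hS := isCompact_hemisphereGe (N := N) n
    have hSsub := hemisphereGe_subset (N := N) n
    have hFc : Continuous (fun ξ : Sph N => F ξ) := h1.continuous.comp continuous_subtype_val
    have hdc : Continuous (fun ξ : Sph N => tangDiv F ξ) := by
      have := (h1.continuous_fderiv (by simp)).comp (continuous_subtype_val (p := fun X =>
        X ∈ sphere (0 : Space N) 1))
      exact continuous_tangTrace.comp (this.prodMk continuous_id)
    have i1 : Integrable (fun ξ => v (polar X₀ (r, ξ)) * tangDiv F ξ) (surfPos N) := by
      have : IntegrableOn (fun ξ => v (polar X₀ (r, ξ)) * tangDiv F ξ) (hemisphereGe N n)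
          (surf N) := (hvloc.integrableOn_compact_subset hSsub hS).mul_continuousOn
            hdc.continuousOn hS
      refine (this.integrable_of_forall_notMem_eq_zero fun ξ hξ => ?_).restrict
      rw [(hF.eq_zero hξ).2, mul_zero]
    have i2 : Integrable (fun ξ => r * ⟪G (polar X₀ (r, ξ)), F ξ⟫_ℝ) (surfPos N) := by
      obtain ⟨C, hC⟩ := hS.exists_bound_of_continuousOn hFc.continuousOn
      have hi := hG hS hSsub
      have : IntegrableOn (fun ξ => ⟪G (polar X₀ (r, ξ)), F ξ⟫_ℝ) (hemisphereGe N n)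
          (surf N) := by
        refine (hi.norm.mul_const C).mono'
          (hi.aestronglyMeasurable.inner hFc.aestronglyMeasurable) ?_
        filter_upwards [ae_restrict_mem hS.isClosed.measurableSet] with ξ hξ
        exact (norm_inner_le_norm _ _).trans
          (mul_le_mul_of_nonneg_left (hC ξ hξ) (norm_nonneg _))
      refine ((this.integrable_of_forall_notMem_eq_zero fun ξ hξ => ?_).restrict).const_mul r
      rw [(hF.eq_zero hξ).1, inner_zero_right]
    have e := hr F h1 h2 h3 h4
    rw [integral_add i1 i2] at e
    have e2 : ∀ ξ : Sph N, ⟪r • (G (polar X₀ (r, ξ)) - ⟪G (polar X₀ (r, ξ)), (ξ : Space N)⟫_ℝ •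
        (ξ : Space N)), F ξ⟫_ℝ = r * ⟪G (polar X₀ (r, ξ)), F ξ⟫_ℝ := by
      intro ξ
      have := h4 ξ
      rw [real_inner_comm] at this
      simp [inner_smul_left, inner_sub_left, this]
    simp only [e2]
    rw [surfPos] at e
    exact eq_neg_of_add_eq_zero_left e

end FiniteEnergy

/-! ### Absolute continuity along rays and the mass on spheres -/

/-- A smooth function supported in `(0, R)` stays smooth when multiplied by `r^{-n}`. -/
theorem contDiff_mul_inv_pow {η : ℝ → ℝ} {R : ℝ} (h1 : ContDiff ℝ ∞ η) (h3 : tsupport η ⊆ Ioo 0 R)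
    (n : ℕ) : ContDiff ℝ ∞ (fun r => η r * (r ^ n)⁻¹) := by
  rw [contDiff_iff_contDiffAt]
  intro r
  by_cases hr : r = 0
  · have h0 : r ∉ tsupport η := fun h => (h3 h).1.ne' hr
    have hev : (fun r => η r * (r ^ n)⁻¹) =ᶠ[𝓝 r] fun _ => 0 := by
      filter_upwards [(isClosed_tsupport η).isOpen_compl.mem_nhds h0] with t ht
      rw [image_eq_zero_of_notMem_tsupport ht, zero_mul]
    exact contDiffAt_const.congr_of_eventuallyEq hev
  · exact h1.contDiffAt.mul ((contDiffAt_id.pow n).inv (pow_ne_zero n hr))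

/-- The tangential divergence of the radial field `ψ(X) X`. The field is not tangent, and `N` is the
mean curvature of the unit sphere. -/
theorem tangDiv_smul_id {ψ : Space N → ℝ} (h1 : ContDiff ℝ ∞ ψ) (ξ : Sph N) :
    tangDiv (fun X => ψ X • X) ξ = N * ψ ξ := by
  set e := EuclideanSpace.basisFun (Fin (N + 1)) ℝ
  have hd : HasFDerivAt (fun X => ψ X • X) (ψ ξ • ContinuousLinearMap.id ℝ (Space N)
      + (fderiv ℝ ψ ξ).smulRight (ξ : Space N)) (ξ : Space N) :=
    (((h1.differentiable (by simp)) _).hasFDerivAt).fun_smul (hasFDerivAt_id _)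
  have hT : tangDiv (fun X => ψ X • X) ξ = divergence (fun X => ψ X • X) ξ
      - ⟪fderiv ℝ (fun X => ψ X • X) ξ (ξ : Space N), (ξ : Space N)⟫_ℝ := rfl
  have e1 : fderiv ℝ ψ ξ (ξ : Space N) = ∑ j, ⟪e j, (ξ : Space N)⟫_ℝ * fderiv ℝ ψ ξ (e j) := by
    calc fderiv ℝ ψ ξ (ξ : Space N)
        = fderiv ℝ ψ ξ (∑ j, ⟪e j, (ξ : Space N)⟫_ℝ • e j) := by rw [e.sum_repr']
      _ = _ := by simp only [map_sum, map_smul, smul_eq_mul]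
  have e2 : ∑ j, ⟪e j, e j⟫_ℝ = (N : ℝ) + 1 := by simp
  rw [hT, divergence_eq_sum, hd.fderiv]
  simp only [_root_.add_apply, _root_.smul_apply, ContinuousLinearMap.id_apply,
    ContinuousLinearMap.smulRight_apply, inner_add_right, inner_smul_right, inner_add_left,
    inner_smul_left, Finset.sum_add_distrib]
  rw [← Finset.mul_sum, e2, real_inner_self_eq_norm_sq, norm_sph, e1]
  simp only [e, mul_comm, RCLike.conj_to_real]
  ring

namespace FiniteEnergy

variable {s R : ℝ} {X₀ : Space N} {v : Space N → ℝ} {G : Space N → Space N}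

theorem integrable_annulus (h : FiniteEnergy s X₀ R v G) (hm : 0 < (N : ℝ) - 2 * s) {a b : ℝ}
    (ha : 0 < a) (hb : b < R) :
    Integrable (fun p : ℝ × Sph N => weight s (p.2 : Space N) *
      (v (polar X₀ p) ^ 2 + ‖G (polar X₀ p)‖ ^ 2)) ((volume.restrict (Ioc a b)).prod (surfPos N)) := by
  have hac : (volume.restrict (Ioc a b)).prod (surfPos N) ≤ cyl N R :=
    Measure.prod_mono (Measure.restrict_mono (show Ioc a b ⊆ Ioo 0 R from
      fun x hx => ⟨ha.trans hx.1, hx.2.trans_lt hb⟩) le_rfl)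
      le_rfl
  have hi := h.integrable_cyl.mono_measure hac
  have hmeas : AEStronglyMeasurable (fun p : ℝ × Sph N => weight s (p.2 : Space N) *
      (v (polar X₀ p) ^ 2 + ‖G (polar X₀ p)‖ ^ 2)) (cyl N R) :=
    ((aestronglyMeasurable_weight s).comp_snd).mul
      ((h.aestronglyMeasurable_polar.pow 2).add (h.aestronglyMeasurable_grad_polar.norm.pow 2))
  refine (hi.const_mul (a ^ ((N : ℝ) - 2 * s + 1))⁻¹).mono' (hmeas.mono_measure hac) ?_
  have hmem : ∀ᵐ p ∂((volume.restrict (Ioc a b)).prod (surfPos N)),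
      p.1 ∈ Ioc a b ∧ p.2 ∈ hemisphere N := by
    rw [surfPos, Measure.prod_restrict]
    exact ae_restrict_mem (measurableSet_Ioc.prod isOpen_hemisphere.measurableSet)
  filter_upwards [hmem] with p hp
  have hw := (weight_pos (s := s) (show 0 < yCoord (p.2 : Space N) from hp.2)).le
  have hnn := mul_nonneg hw
    (add_nonneg (sq_nonneg (v (polar X₀ p))) (sq_nonneg ‖G (polar X₀ p)‖))
  rw [Real.norm_of_nonneg hnn]
  have hpa : a ^ ((N : ℝ) - 2 * s + 1) ≤ p.1 ^ ((N : ℝ) - 2 * s + 1) :=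
    Real.rpow_le_rpow ha.le hp.1.1.le (by linarith)
  have hpos := Real.rpow_pos_of_pos ha ((N : ℝ) - 2 * s + 1)
  rw [inv_mul_eq_div, le_div_iff₀ hpos, mul_comm]
  exact mul_le_mul_of_nonneg_right hpa hnn

theorem aestronglyMeasurable_annulus (h : FiniteEnergy s X₀ R v G) {a b : ℝ}
    (ha : 0 < a) (hb : b < R) :
    AEStronglyMeasurable (fun p => v (polar X₀ p)) ((volume.restrict (Ioc a b)).prod (surfPos N)) ∧
    AEStronglyMeasurable (fun p : ℝ × Sph N => ⟪G (polar X₀ p), (p.2 : Space N)⟫_ℝ)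
      ((volume.restrict (Ioc a b)).prod (surfPos N)) := by
  have hac : (volume.restrict (Ioc a b)).prod (surfPos N) ≤ cyl N R :=
    Measure.prod_mono (Measure.restrict_mono (show Ioc a b ⊆ Ioo 0 R from
      fun x hx => ⟨ha.trans hx.1, hx.2.trans_lt hb⟩) le_rfl)
      le_rfl
  refine ⟨h.aestronglyMeasurable_polar.mono_measure hac,
    (h.aestronglyMeasurable_grad_polar.mono_measure hac).inner (𝕜 := ℝ) ?_⟩
  exact (continuous_subtype_val.comp continuous_snd).aestronglyMeasurable

theorem abs_inner_sph_le (Z : Space N) (ξ : Sph N) : |⟪Z, (ξ : Space N)⟫_ℝ| ≤ ‖Z‖ := by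
  have := abs_real_inner_le_norm Z (ξ : Space N)
  rwa [norm_sph, mul_one] at this

/-- The radial derivative is integrable on annular sectors away from the equator. -/
theorem integrable_radial_annulus (h : FiniteEnergy s X₀ R v G) (hm : 0 < (N : ℝ) - 2 * s)
    {a b : ℝ} (ha : 0 < a) (hb : b < R) {S : Set (Sph N)} (hS : IsCompact S)
    (hSsub : S ⊆ hemisphere N) {f : Sph N → ℝ} (hf : Continuous f) (hf0 : ∀ ξ, ξ ∉ S → f ξ = 0) :
    Integrable (fun p : ℝ × Sph N => f p.2 * ⟪G (polar X₀ p), (p.2 : Space N)⟫_ℝ)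
      ((volume.restrict (Ioc a b)).prod (surfPos N)) := by
  obtain ⟨c, hc, hcw⟩ := exists_weight_ge s hS hSsub
  obtain ⟨C, hC⟩ := hS.exists_bound_of_continuousOn hf.continuousOn
  have hi := h.integrable_annulus hm ha hb
  have h1 : Integrable (fun _ : ℝ × Sph N => (1 : ℝ))
      ((volume.restrict (Ioc a b)).prod (surfPos N)) := integrable_const _
  refine ((h1.add (hi.const_mul c⁻¹)).const_mul |C|).mono'
    ((hf.comp continuous_snd).aestronglyMeasurable.mul (h.aestronglyMeasurable_annulus ha hb).2) ?_
  have hmem : ∀ᵐ p ∂((volume.restrict (Ioc a b)).prod (surfPos N)), p.2 ∈ hemisphere N :=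
    Measure.quasiMeasurePreserving_snd.ae (ae_surfPos_mem N)
  filter_upwards [hmem] with p hp
  have hw := (weight_pos (s := s) (show 0 < yCoord (p.2 : Space N) from hp)).le
  have hnn := mul_nonneg hw
    (add_nonneg (sq_nonneg (v (polar X₀ p))) (sq_nonneg ‖G (polar X₀ p)‖))
  rw [norm_mul]
  by_cases hpS : p.2 ∈ S
  · refine mul_le_mul ((hC _ hpS).trans (le_abs_self C)) ?_ (norm_nonneg _) (abs_nonneg _)
    exact (abs_inner_sph_le _ _).trans (norm_le_of_sq _ hc (hcw _ hpS))
  · rw [hf0 _ hpS, norm_zero, zero_mul]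
    have := mul_nonneg (inv_pos.2 hc).le hnn
    exact mul_nonneg (abs_nonneg _) (by simp only [Pi.add_apply]; linarith)

/-- Tested against a function of the direction, `v` is absolutely continuous in the radius, with
the radial part of `G` as its derivative. -/
theorem integral_radial_sub (h : FiniteEnergy s X₀ R v G) (hm : 0 < (N : ℝ) - 2 * s)
    {ψ : Space N → ℝ} (h1 : ContDiff ℝ ∞ ψ) (h3 : tsupport ψ ⊆ {X | 0 < yCoord X}) {a b : ℝ}
    (ha : a ∈ Ioo 0 R) (hb : b ∈ Ioo 0 R) :
    (∫ ξ, ψ ξ * v (polar X₀ (b, ξ)) ∂(surfPos N)) - ∫ ξ, ψ ξ * v (polar X₀ (a, ξ)) ∂(surfPos N) =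
      ∫ r in a..b, ∫ ξ, ψ ξ * ⟪G (polar X₀ (r, ξ)), (ξ : Space N)⟫_ℝ ∂(surfPos N) := by
  have hψc : Continuous (fun ξ : Sph N => ψ ξ) := h1.continuous.comp continuous_subtype_val
  let S : Set (Sph N) := Subtype.val ⁻¹' tsupport ψ
  have hS : IsCompact S := ((isClosed_tsupport ψ).preimage continuous_subtype_val).isCompact
  have hSsub : S ⊆ hemisphere N := fun ξ hξ => h3 hξ
  have hS0 : ∀ ξ : Sph N, ξ ∉ S → ψ ξ = 0 := fun ξ hξ => image_eq_zero_of_notMem_tsupport hξ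
  have hK : ContinuousOn (fun r => ∫ ξ, ψ ξ * v (polar X₀ (r, ξ)) ∂(surfPos N)) (Ioo 0 R) := by
    refine continuousOn_integral_of_compact_support
      (f := fun (r : ℝ) (ξ : Sph N) => ψ ξ * v (polar X₀ (r, ξ))) hS ?_ ?_
    · rintro ⟨r, ξ⟩ ⟨hr, -⟩
      by_cases hξ : ξ ∈ S
      · have hopen : Ioo 0 R ×ˢ hemisphere N ∈ 𝓝 (r, ξ) :=
          (isOpen_Ioo.prod isOpen_hemisphere).mem_nhds ⟨hr, hSsub hξ⟩
        have hvc := (h.continuousOn_polar.mono (prod_mono le_rfl hemisphere_subset)).continuousAt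
          hopen
        exact ((hψc.comp continuous_snd).continuousAt.mul hvc).continuousWithinAt
      · have hev : (Function.uncurry fun (r : ℝ) (ξ : Sph N) => ψ ξ * v (polar X₀ (r, ξ)))
            =ᶠ[𝓝 (r, ξ)] fun _ => 0 := by
          filter_upwards [continuous_snd.continuousAt.preimage_mem_nhds
            (hS.isClosed.isOpen_compl.mem_nhds (x := (r, ξ).2) hξ)] with q hq
          simp only [Function.uncurry, hS0 q.2 hq, zero_mul]
        exact (continuousAt_const.congr hev.symm).continuousWithinAt
    · intro r ξ _ hξ
      simp only [hS0 ξ hξ, zero_mul]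
  have hk : LocallyIntegrableOn
      (fun r => ∫ ξ, ψ ξ * ⟪G (polar X₀ (r, ξ)), (ξ : Space N)⟫_ℝ ∂(surfPos N)) (Ioo 0 R) := by
    rw [locallyIntegrableOn_iff isOpen_Ioo.isLocallyClosed]
    intro C hC hCc
    obtain ⟨p, q, hp, hpq, hq, hsub⟩ :=
      exists_Ioo_superset_of_isCompact hCc (ha.1.trans ha.2) hC
    have hi : IntegrableOn
        (fun r => ∫ ξ, ψ ξ * ⟪G (polar X₀ (r, ξ)), (ξ : Space N)⟫_ℝ ∂(surfPos N)) (Ioc p q) :=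
      (h.integrable_radial_annulus hm hp hq hS hSsub hψc hS0).integral_prod_left
    exact hi.mono_set (hsub.trans Ioo_subset_Ioc_self)
  refine sub_eq_integral_of_weakDeriv hK hk (fun η e1 e2 e3 => ?_) ha hb
  -- The radial field `η(r) r^{-N} ψ(ξ) ξ` has divergence `η'(r) r^{-N} ψ(ξ)`; the Jacobian of polar
  -- coordinates cancels `r^{-N}`.
  have g1 := contDiff_mul_inv_pow e1 e3 N
  have gs : tsupport (fun r => η r * (r ^ N)⁻¹) ⊆ tsupport η := closure_mono fun r hr h0 =>
    hr (by simp only [h0, zero_mul])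
  have g2 : HasCompactSupport (fun r => η r * (r ^ N)⁻¹) := e2.mul_right
  have F1 : ContDiff ℝ ∞ (fun X => ψ X • X) := h1.smul contDiff_id
  have F3 : tsupport (fun X => ψ X • X) ⊆ {X | 0 < yCoord X} :=
    (tsupport_smul_subset_left _ _).trans h3
  obtain ⟨hi, hz⟩ := h.weakGrad.integral_polar h.flat g1 g2 (gs.trans e3) F1 F3
  rw [cyl] at hi hz
  rw [integral_prod _ hi] at hz
  refine (integral_congr_ae ?_).trans hz
  filter_upwards [h.ae_slice, ae_restrict_mem measurableSet_Ioo] with r hgood hr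
  have h0 : r ≠ 0 := hr.1.ne'
  have hvr : IntegrableOn (fun ξ => v (polar X₀ (r, ξ))) S (surf N) :=
    ((h.continuousOn_slice hr).mono (hSsub.trans hemisphere_subset)).integrableOn_compact hS
  have i1 : Integrable (fun ξ : Sph N => ψ ξ * v (polar X₀ (r, ξ))) (surfPos N) := by
    have : IntegrableOn (fun ξ : Sph N => ψ ξ * v (polar X₀ (r, ξ))) S (surf N) :=
      hvr.continuousOn_mul hψc.continuousOn hS
    refine (this.integrable_of_forall_notMem_eq_zero fun ξ hξ => ?_).restrict
    rw [hS0 ξ hξ, zero_mul]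
  have i2 : Integrable (fun ξ : Sph N => ψ ξ * ⟪G (polar X₀ (r, ξ)), (ξ : Space N)⟫_ℝ)
      (surfPos N) := by
    have hGi := integrableOn_slice hgood.1 hgood.2 hS hSsub
    have hGi' : IntegrableOn (fun ξ : Sph N => ⟪G (polar X₀ (r, ξ)), (ξ : Space N)⟫_ℝ) S
        (surf N) :=
      hGi.norm.mono' (hGi.aestronglyMeasurable.inner (𝕜 := ℝ)
        continuous_subtype_val.aestronglyMeasurable) (Eventually.of_forall fun ξ =>
          abs_inner_sph_le _ _)
    have : IntegrableOn (fun ξ : Sph N => ψ ξ * ⟪G (polar X₀ (r, ξ)), (ξ : Space N)⟫_ℝ) S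
        (surf N) := hGi'.continuousOn_mul hψc.continuousOn hS
    refine (this.integrable_of_forall_notMem_eq_zero fun ξ hξ => ?_).restrict
    rw [hS0 ξ hξ, zero_mul]
  have hder : deriv (fun r => η r * (r ^ N)⁻¹) r
      = deriv η r * (r ^ N)⁻¹ - N * (η r * (r ^ N)⁻¹ * r⁻¹) := by
    have d1 : HasDerivAt η (deriv η r) r := ((e1.differentiable (by simp)) r).hasDerivAt
    have d2 : HasDerivAt (fun r : ℝ => (r ^ N)⁻¹) (-(N * r ^ (N - 1)) / (r ^ N) ^ 2) r := by
      simpa using (hasDerivAt_pow N r).fun_inv (pow_ne_zero N h0)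
    rw [(d1.fun_mul d2).deriv]
    rcases Nat.eq_zero_or_pos N with hN | hN
    · simp [hN]
    · have : r ^ N = r ^ (N - 1) * r := by rw [← pow_succ, Nat.sub_add_cancel hN]
      rw [this]
      field_simp
      ring
  rw [← integral_const_mul, ← integral_const_mul, ← integral_add (i1.const_mul _) (i2.const_mul _)]
  refine integral_congr_ae (Eventually.of_forall fun ξ => ?_)
  simp only [hder, tangDiv_smul_id h1, inner_smul_left, inner_smul_right,
    real_inner_self_eq_norm_sq, norm_sph, RCLike.conj_to_real]
  have hN0 : r ^ N ≠ 0 := pow_ne_zero N h0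
  field_simp
  ring

theorem locallyIntegrableOn_ray (hm : 0 < (N : ℝ) - 2 * s) {ξ : Sph N}
    (hG : AEStronglyMeasurable (fun r => G (polar X₀ (r, ξ))) (volume.restrict (Ioo 0 R)))
    (hi : IntegrableOn (fun r => r ^ ((N : ℝ) - 2 * s + 1) *
        (v (polar X₀ (r, ξ)) ^ 2 + ‖G (polar X₀ (r, ξ))‖ ^ 2)) (Ioo 0 R)) :
    LocallyIntegrableOn (fun r => ⟪G (polar X₀ (r, ξ)), (ξ : Space N)⟫_ℝ) (Ioo 0 R) := by
  rw [locallyIntegrableOn_iff isOpen_Ioo.isLocallyClosed]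
  intro C hC hCc
  rcases C.eq_empty_or_nonempty with rfl | ⟨x, hx⟩
  · simp
  obtain ⟨p, q, hp, hpq, hq, hsub⟩ := exists_Ioo_superset_of_isCompact hCc
    ((hC hx).1.trans (hC hx).2) hC
  have hpos := Real.rpow_pos_of_pos hp ((N : ℝ) - 2 * s + 1)
  have h1 : IntegrableOn (fun _ : ℝ => (1 : ℝ)) C := continuousOn_const.integrableOn_compact hCc
  refine (h1.add ((hi.mono_set hC).const_mul (p ^ ((N : ℝ) - 2 * s + 1))⁻¹)).mono'
    ((hG.mono_measure (Measure.restrict_mono hC le_rfl)).inner (𝕜 := ℝ)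
      aestronglyMeasurable_const) ?_
  filter_upwards [ae_restrict_mem hCc.isClosed.measurableSet] with r hr
  exact (abs_inner_sph_le _ _).trans (norm_le_of_sq _ hpos
    (Real.rpow_le_rpow hp.le (hsub hr).1.le (by linarith)))

/-- For fixed radii `a ≤ b`, `v` is recovered on almost every ray from the radial part of `G`. -/
theorem ae_sub_eq_integral (h : FiniteEnergy s X₀ R v G) (hm : 0 < (N : ℝ) - 2 * s) {a b : ℝ}
    (ha : a ∈ Ioo 0 R) (hb : b ∈ Ioo 0 R) (hab : a ≤ b) :
    ∀ᵐ ξ ∂(surfPos N), v (polar X₀ (b, ξ)) - v (polar X₀ (a, ξ)) -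
      ∫ r in a..b, ⟪G (polar X₀ (r, ξ)), (ξ : Space N)⟫_ℝ = 0 := by
  have hv : ∀ r ∈ Ioo 0 R, LocallyIntegrableOn (fun ξ => v (polar X₀ (r, ξ))) (hemisphere N)
      (surf N) := fun r hr =>
    ((h.continuousOn_slice hr).mono hemisphere_subset).locallyIntegrableOn
      isOpen_hemisphere.measurableSet
  have hP : LocallyIntegrableOn (fun ξ : Sph N => ∫ r in a..b,
      ⟪G (polar X₀ (r, ξ)), (ξ : Space N)⟫_ℝ) (hemisphere N) (surf N) := by
    rw [locallyIntegrableOn_iff isOpen_hemisphere.isLocallyClosed]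
    intro S hS hSc
    obtain ⟨c, hc, hcw⟩ := exists_weight_ge s hSc hS
    have hle : (volume.restrict (Ioc a b)).prod ((surf N).restrict S)
        ≤ (volume.restrict (Ioc a b)).prod (surfPos N) :=
      Measure.prod_mono le_rfl (Measure.restrict_mono hS le_rfl)
    have h1 : Integrable (fun _ : ℝ × Sph N => (1 : ℝ))
        ((volume.restrict (Ioc a b)).prod ((surf N).restrict S)) := integrable_const _
    have hq : Integrable (fun p : ℝ × Sph N => ⟪G (polar X₀ p), (p.2 : Space N)⟫_ℝ)
        ((volume.restrict (Ioc a b)).prod ((surf N).restrict S)) := by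
      refine (h1.add (((h.integrable_annulus hm ha.1 hb.2).mono_measure hle).const_mul c⁻¹)).mono'
        ((h.aestronglyMeasurable_annulus ha.1 hb.2).2.mono_measure hle) ?_
      filter_upwards [Measure.quasiMeasurePreserving_snd.ae
        (ae_restrict_mem hSc.isClosed.measurableSet)] with p hp
      exact (abs_inner_sph_le _ _).trans (norm_le_of_sq _ hc (hcw _ hp))
    have := hq.integral_prod_right
    simp only [intervalIntegral.integral_of_le hab]
    exact this
  refine ae_eq_zero_of_forall_smooth_sphere (((hv b hb).sub (hv a ha)).sub hP) ?_
  intro ψ h1 h2 h3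
  have hψc : Continuous (fun ξ : Sph N => ψ ξ) := h1.continuous.comp continuous_subtype_val
  let S : Set (Sph N) := Subtype.val ⁻¹' tsupport ψ
  have hS : IsCompact S := ((isClosed_tsupport ψ).preimage continuous_subtype_val).isCompact
  have hSsub : S ⊆ hemisphere N := fun ξ hξ => h3 hξ
  have hS0 : ∀ ξ : Sph N, ξ ∉ S → ψ ξ = 0 := fun ξ hξ => image_eq_zero_of_notMem_tsupport hξ
  have hint : ∀ {f : Sph N → ℝ}, LocallyIntegrableOn f (hemisphere N) (surf N) →
      Integrable (fun ξ : Sph N => ψ ξ * f ξ) (surfPos N) := by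
    intro f hf
    have : IntegrableOn (fun ξ : Sph N => ψ ξ * f ξ) S (surf N) :=
      (hf.integrableOn_compact_subset hSsub hS).continuousOn_mul hψc.continuousOn hS
    refine (this.integrable_of_forall_notMem_eq_zero fun ξ hξ => ?_).restrict
    rw [hS0 ξ hξ, zero_mul]
  have key := h.integral_radial_sub hm h1 h3 ha hb
  have hsw : ∫ r in a..b, ∫ ξ, ψ ξ * ⟪G (polar X₀ (r, ξ)), (ξ : Space N)⟫_ℝ ∂(surfPos N)
      = ∫ ξ : Sph N, ψ ξ * (∫ r in a..b, ⟪G (polar X₀ (r, ξ)), (ξ : Space N)⟫_ℝ) ∂(surfPos N) := by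
    simp only [intervalIntegral.integral_of_le hab]
    rw [integral_integral_swap (f := fun (r : ℝ) (ξ : Sph N) =>
      ψ ξ * ⟪G (polar X₀ (r, ξ)), (ξ : Space N)⟫_ℝ)
      (h.integrable_radial_annulus hm ha.1 hb.2 hS hSsub hψc hS0)]
    simp only [integral_const_mul]
  have hba : Integrable (fun ξ : Sph N => ψ ξ * v (polar X₀ (b, ξ)) - ψ ξ * v (polar X₀ (a, ξ)))
      (surfPos N) := (hint (hv b hb)).sub (hint (hv a ha))
  simp only [smul_eq_mul, mul_sub]
  rw [integral_sub hba (hint hP),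
    integral_sub (hint (hv b hb)) (hint (hv a ha)), key, hsw, sub_self]

/-- On almost every ray `v` is the integral of the radial part of `G`, for all radii at once, since
both sides are continuous and the rational radii suffice; squaring gives the derivative of `v²`. -/
theorem ae_sq_sub_sq (h : FiniteEnergy s X₀ R v G) (hm : 0 < (N : ℝ) - 2 * s) {a : ℝ}
    (ha : a ∈ Ioo 0 R) :
    ∀ᵐ ξ ∂(surfPos N), ∀ b ∈ Ioo 0 R, a ≤ b →
      v (polar X₀ (b, ξ)) ^ 2 - v (polar X₀ (a, ξ)) ^ 2 =
        ∫ r in a..b, 2 * (v (polar X₀ (r, ξ)) * ⟪G (polar X₀ (r, ξ)), (ξ : Space N)⟫_ℝ) := by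
  have hrat : ∀ᵐ ξ ∂(surfPos N), ∀ q : ℚ, (q : ℝ) ∈ Ioo 0 R → a ≤ q →
      v (polar X₀ (q, ξ)) - v (polar X₀ (a, ξ)) -
        ∫ r in a..q, ⟪G (polar X₀ (r, ξ)), (ξ : Space N)⟫_ℝ = 0 := by
    rw [ae_all_iff]
    intro q
    by_cases hq : (q : ℝ) ∈ Ioo 0 R ∧ a ≤ q
    · filter_upwards [h.ae_sub_eq_integral hm ha hq.1 hq.2] with ξ hξ _ _
      exact hξ
    · exact Eventually.of_forall fun ξ h1 h2 => absurd ⟨h1, h2⟩ hq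
  filter_upwards [hrat, h.ae_ray, ae_surfPos_mem N] with ξ hξ hray hξm
  have hloc := locallyIntegrableOn_ray hm hray.1 hray.2
  have hcont := h.continuousOn_ray hξm
  have hPc := continuousOn_primitive_Ioo hloc ha
  have hall : ∀ r ∈ Ioo 0 R, a ≤ r → v (polar X₀ (r, ξ)) = v (polar X₀ (a, ξ)) +
      ∫ t in a..r, ⟪G (polar X₀ (t, ξ)), (ξ : Space N)⟫_ℝ := by
    intro r hr har
    by_contra hne
    have hd : ContinuousOn (fun r => v (polar X₀ (r, ξ)) - v (polar X₀ (a, ξ)) -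
        ∫ t in a..r, ⟪G (polar X₀ (t, ξ)), (ξ : Space N)⟫_ℝ) (Ioo 0 R) :=
      (hcont.sub continuousOn_const).sub hPc
    have hopen := hd.isOpen_inter_preimage isOpen_Ioo (isOpen_compl_singleton (x := (0:ℝ)))
    have hmem : r ∈ Ioo 0 R ∩ (fun r => v (polar X₀ (r, ξ)) - v (polar X₀ (a, ξ)) -
        ∫ t in a..r, ⟪G (polar X₀ (t, ξ)), (ξ : Space N)⟫_ℝ) ⁻¹' {0}ᶜ := by
      refine ⟨hr, fun h0 => hne ?_⟩
      have h0' : v (polar X₀ (r, ξ)) - v (polar X₀ (a, ξ)) -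
        ∫ t in a..r, ⟪G (polar X₀ (t, ξ)), (ξ : Space N)⟫_ℝ = 0 := h0
      linarith
    obtain ⟨ε, hε, hball⟩ := Metric.isOpen_iff.1 hopen r hmem
    obtain ⟨q, hq1, hq2⟩ := exists_rat_btwn (show r < r + ε by linarith)
    have hqm := hball (show (q : ℝ) ∈ ball r ε by
      rw [mem_ball, Real.dist_eq, abs_of_pos (by linarith)]; linarith)
    exact hqm.2 (hξ q hqm.1 (har.trans hq1.le))
  intro b hb hab
  have hii := intervalIntegrable_of_Ioo hloc ha hb
  obtain ⟨hP, hP'⟩ := ac_primitive hii left_mem_uIcc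
  have hfac : AbsolutelyContinuousOnInterval (fun r => v (polar X₀ (a, ξ)) +
      ∫ t in a..r, ⟪G (polar X₀ (t, ξ)), (ξ : Space N)⟫_ℝ) a b :=
    AbsolutelyContinuousOnInterval.fun_add
      (ContDiffOn.absolutelyContinuousOnInterval contDiffOn_const) hP
  have hfd := hP'.mono fun x hx hx' => (hx hx').const_add (v (polar X₀ (a, ξ)))
  have e := integral_mul_add_mul_of_ac hfac hfac hfd hfd
  simp only [intervalIntegral.integral_same, add_zero] at e
  rw [← hall b hb hab] at e
  rw [sq, sq, ← e]
  refine intervalIntegral.integral_congr fun r hr => ?_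
  rw [uIcc_of_le hab] at hr
  rw [← hall r ⟨ha.1.trans_le hr.1, hr.2.trans_lt hb.2⟩ hr.1]
  ring

/-- The weighted integral of `v²` over the half sphere of radius `r` around `X₀`, rescaled to radius
one. -/
noncomputable def sphereMass (s : ℝ) (X₀ : Space N) (v : Space N → ℝ) (r : ℝ) : ℝ :=
  ∫ ξ : Sph N, weight s (ξ : Space N) * v (polar X₀ (r, ξ)) ^ 2 ∂(surfPos N)

/-- The weighted integral of `v ∂_r v` over the half sphere of radius `r` around `X₀`, rescaled to
radius one. -/
noncomputable def sphereFlux (s : ℝ) (X₀ : Space N) (v : Space N → ℝ) (G : Space N → Space N)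
    (r : ℝ) : ℝ :=
  ∫ ξ : Sph N, weight s (ξ : Space N) *
    (v (polar X₀ (r, ξ)) * ⟪G (polar X₀ (r, ξ)), (ξ : Space N)⟫_ℝ) ∂(surfPos N)

theorem abs_mul_inner_le (t : ℝ) (Z : Space N) (ξ : Sph N) :
    |t * ⟪Z, (ξ : Space N)⟫_ℝ| ≤ t ^ 2 + ‖Z‖ ^ 2 := by
  rw [abs_mul]
  have h1 := abs_inner_sph_le Z ξ
  have h2 := mul_le_mul_of_nonneg_left h1 (abs_nonneg t)
  nlinarith [sq_nonneg (|t| - ‖Z‖), sq_abs t, sq_nonneg t, sq_nonneg ‖Z‖]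

theorem integrable_sq_slice (h : FiniteEnergy s X₀ R v G) {r : ℝ} (hr : r ∈ Ioo 0 R)
    (hi : Integrable (fun ξ : Sph N => weight s (ξ : Space N) *
        (v (polar X₀ (r, ξ)) ^ 2 + ‖G (polar X₀ (r, ξ))‖ ^ 2)) (surfPos N)) :
    Integrable (fun ξ : Sph N => weight s (ξ : Space N) * v (polar X₀ (r, ξ)) ^ 2)
      (surfPos N) := by
  have hvm : AEStronglyMeasurable (fun ξ => v (polar X₀ (r, ξ))) (surfPos N) :=
    ((h.continuousOn_slice hr).mono hemisphere_subset).aestronglyMeasurable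
      isOpen_hemisphere.measurableSet
  refine hi.mono' ((aestronglyMeasurable_weight s).mul (hvm.pow 2)) ?_
  filter_upwards [ae_surfPos_mem N] with ξ hξ
  have hw := (weight_pos (s := s) (show 0 < yCoord (ξ : Space N) from hξ)).le
  rw [Real.norm_of_nonneg (mul_nonneg hw (sq_nonneg _))]
  exact mul_le_mul_of_nonneg_left (by linarith [sq_nonneg ‖G (polar X₀ (r, ξ))‖]) hw

theorem exists_integrable_slice_lt (h : FiniteEnergy s X₀ R v G) {b : ℝ} (hb : b ∈ Ioo 0 R) :
    ∃ r ∈ Ioo 0 b, Integrable (fun ξ : Sph N => weight s (ξ : Space N) *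
        (v (polar X₀ (r, ξ)) ^ 2 + ‖G (polar X₀ (r, ξ))‖ ^ 2)) (surfPos N) := by
  have h1 := ae_restrict_of_ae_restrict_of_subset (Ioo_subset_Ioo_right hb.2.le) h.ae_slice
  have h8 := h1.and (ae_restrict_mem measurableSet_Ioo)
  have : NeBot (ae (volume.restrict (Ioo (0 : ℝ) b))) := by
    rw [ae_neBot]
    intro h
    have := congrArg (fun μ => μ univ) h
    simp at this
    exact absurd hb.1 (not_lt.2 this)
  obtain ⟨r, h9, h10⟩ := h8.exists
  exact ⟨r, h10, h9.2⟩

theorem integrable_flux (h : FiniteEnergy s X₀ R v G) (hm : 0 < (N : ℝ) - 2 * s) {a b : ℝ}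
    (ha : 0 < a) (hb : b < R) :
    Integrable (fun p : ℝ × Sph N => weight s (p.2 : Space N) *
      (2 * (v (polar X₀ p) * ⟪G (polar X₀ p), (p.2 : Space N)⟫_ℝ)))
      ((volume.restrict (Ioc a b)).prod (surfPos N)) := by
  obtain ⟨m1, m2⟩ := h.aestronglyMeasurable_annulus ha hb
  refine ((h.integrable_annulus hm ha hb).const_mul 2).mono'
    ((aestronglyMeasurable_weight s).comp_snd.mul ((m1.mul m2).const_mul 2)) ?_
  filter_upwards [Measure.quasiMeasurePreserving_snd.ae (ae_surfPos_mem N)] with p hp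
  have hw := (weight_pos (s := s) (show 0 < yCoord (p.2 : Space N) from hp)).le
  rw [norm_mul, norm_mul, Real.norm_of_nonneg hw, Real.norm_of_nonneg (by norm_num : (0:ℝ) ≤ 2)]
  have := mul_le_mul_of_nonneg_left (abs_mul_inner_le (v (polar X₀ p)) (G (polar X₀ p)) p.2) hw
  rw [Real.norm_eq_abs]
  linarith

/-- The mass is absolutely continuous in the radius, with derivative twice the flux. -/
theorem sphereMass_sub (h : FiniteEnergy s X₀ R v G) (hm : 0 < (N : ℝ) - 2 * s) :
    ∀ a ∈ Ioo 0 R, ∀ b ∈ Ioo 0 R,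
      sphereMass s X₀ v b - sphereMass s X₀ v a = ∫ r in a..b, 2 * sphereFlux s X₀ v G r := by
  have hstep : ∀ a ∈ Ioo 0 R, ∀ b ∈ Ioo 0 R, a ≤ b →
      ∀ᵐ ξ : Sph N ∂(surfPos N), weight s (ξ : Space N) * v (polar X₀ (b, ξ)) ^ 2
        - weight s (ξ : Space N) * v (polar X₀ (a, ξ)) ^ 2 =
        ∫ r in Ioc a b, weight s (ξ : Space N) *
          (2 * (v (polar X₀ (r, ξ)) * ⟪G (polar X₀ (r, ξ)), (ξ : Space N)⟫_ℝ)) := by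
    intro a ha b hb hab
    filter_upwards [h.ae_sq_sub_sq hm ha] with ξ hξ
    rw [← mul_sub, hξ b hb hab, intervalIntegral.integral_of_le hab]
    simp only [integral_const_mul]
  -- The mass is finite on every sphere: compare with a smaller sphere of finite energy.
  have hfin : ∀ b ∈ Ioo 0 R, Integrable (fun ξ : Sph N => weight s (ξ : Space N) *
      v (polar X₀ (b, ξ)) ^ 2) (surfPos N) := by
    intro b hb
    obtain ⟨a, ha, hi⟩ := h.exists_integrable_slice_lt hb
    have haR : a ∈ Ioo 0 R := ⟨ha.1, ha.2.trans hb.2⟩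
    refine ((h.integrable_sq_slice haR hi).add
      (h.integrable_flux hm ha.1 hb.2).integral_prod_right).congr ?_
    filter_upwards [hstep a haR b hb ha.2.le] with ξ hξ
    simp only [Pi.add_apply]
    rw [← hξ]
    ring
  have hle : ∀ a ∈ Ioo 0 R, ∀ b ∈ Ioo 0 R, a ≤ b →
      sphereMass s X₀ v b - sphereMass s X₀ v a = ∫ r in a..b, 2 * sphereFlux s X₀ v G r := by
    intro a ha b hb hab
    rw [sphereMass, sphereMass, ← integral_sub (hfin b hb) (hfin a ha),
      integral_congr_ae (hstep a ha b hb hab), intervalIntegral.integral_of_le hab,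
      ← integral_integral_swap (f := fun (r : ℝ) (ξ : Sph N) => weight s (ξ : Space N) *
        (2 * (v (polar X₀ (r, ξ)) * ⟪G (polar X₀ (r, ξ)), (ξ : Space N)⟫_ℝ)))
        (h.integrable_flux hm ha.1 hb.2)]
    refine setIntegral_congr_fun measurableSet_Ioc fun r _ => ?_
    simp only [sphereFlux]
    rw [← integral_const_mul]
    refine integral_congr_ae (Eventually.of_forall fun ξ => ?_)
    simp only
    ring
  intro a ha b hb
  rcases le_total a b with hab | hab
  · exact hle a ha b hb hab
  · have := hle b hb a ha hab
    rw [intervalIntegral.integral_symm]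
    linarith

end FiniteEnergy

/-! ### The differential inequality -/

theorem gradient_mul {φ ψ : Space N → ℝ} (h1 : ContDiff ℝ ∞ φ) (h2 : ContDiff ℝ ∞ ψ)
    (X : Space N) : ∇ (fun X => φ X * ψ X) X = φ X • ∇ ψ X + ψ X • ∇ φ X := by
  have d1 := ((h1.differentiable (by simp)) X).hasFDerivAt
  have d2 := ((h2.differentiable (by simp)) X).hasFDerivAt
  have h := (d1.fun_mul d2).fderiv
  simp only [gradient, h, map_add, map_smulₛₗ, RCLike.conj_to_real]

theorem integrableOn_smul_of_tsupport_subset {F : Type*} [NormedAddCommGroup F] [NormedSpace ℝ F]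
    {Ω : Set (Space N)} {A : Space N → F} (hA : LocallyIntegrableOn A Ω) {φ : Space N → ℝ}
    (h1 : Continuous φ) (h2 : HasCompactSupport φ) (h3 : tsupport φ ⊆ Ω) :
    IntegrableOn (fun X => φ X • A X) Ω := by
  have : IntegrableOn (fun X => φ X • A X) (tsupport φ) :=
    (hA.integrableOn_compact_subset h3 h2).continuousOn_smul h1.continuousOn h2
  refine (this.integrable_of_forall_notMem_eq_zero fun x hx => ?_).integrableOn
  rw [image_eq_zero_of_notMem_tsupport hx, zero_smul]

theorem continuous_gradient {φ : Space N → ℝ} (h1 : ContDiff ℝ ∞ φ) : Continuous (∇ φ) :=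
  (InnerProductSpace.toDual ℝ (Space N)).symm.continuous.comp (h1.continuous_fderiv (by simp))

theorem tsupport_gradient_subset (φ : Space N → ℝ) : tsupport (∇ φ) ⊆ tsupport φ := by
  refine closure_minimal (fun X hX => support_fderiv_subset ℝ fun h0 => hX ?_)
    (isClosed_tsupport _)
  simp [gradient, h0]

/-- Product rule for the weak gradient and a smooth factor. -/
theorem IsWeakGrad.mul_contDiff {Ω : Set (Space N)} (hΩ : IsOpen Ω) {v : Space N → ℝ}
    {G : Space N → Space N} (h : IsWeakGrad Ω v G) {φ : Space N → ℝ} (h1 : ContDiff ℝ ∞ φ) :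
    IsWeakGrad Ω (fun X => v X * φ X) (fun X => φ X • G X + v X • ∇ φ X) := by
  have hloc : LocallyIntegrableOn (fun X => v X * φ X) Ω := by
    rw [locallyIntegrableOn_iff hΩ.isLocallyClosed]
    intro K hK hKc
    exact (h.1.integrableOn_compact_subset hK hKc).mul_continuousOn h1.continuous.continuousOn hKc
  have hgloc : LocallyIntegrableOn (fun X => φ X • G X) Ω := by
    rw [locallyIntegrableOn_iff hΩ.isLocallyClosed]
    intro K hK hKc
    exact (h.2.1.integrableOn_compact_subset hK hKc).continuousOn_smul h1.continuous.continuousOn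
      hKc
  have hvloc : LocallyIntegrableOn (fun X => v X • ∇ φ X) Ω := by
    rw [locallyIntegrableOn_iff hΩ.isLocallyClosed]
    intro K hK hKc
    exact (h.1.integrableOn_compact_subset hK hKc).smul_continuousOn
      (continuous_gradient h1).continuousOn hKc
  refine ⟨hloc, hgloc.add hvloc, fun ψ p1 p2 p3 => ?_⟩
  have hq := h.2.2 (fun X => φ X * ψ X) (h1.mul p1) p2.mul_left
    ((tsupport_mul_subset_right).trans p3)
  have i1 : IntegrableOn (fun X => (v X * φ X) • ∇ ψ X) Ω := by
    have : IntegrableOn (fun X => (v X * φ X) • ∇ ψ X) (tsupport ψ) :=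
      (hloc.integrableOn_compact_subset p3 p2).smul_continuousOn
        (continuous_gradient p1).continuousOn p2
    refine (this.integrable_of_forall_notMem_eq_zero fun x hx => ?_).integrableOn
    rw [image_eq_zero_of_notMem_tsupport fun h' => hx (tsupport_gradient_subset ψ h'), smul_zero]
  have i2 : IntegrableOn (fun X => ψ X • (v X • ∇ φ X)) Ω :=
    integrableOn_smul_of_tsupport_subset hvloc p1.continuous p2 p3
  have i3 : IntegrableOn (fun X => ψ X • (φ X • G X)) Ω :=
    integrableOn_smul_of_tsupport_subset hgloc p1.continuous p2 p3
  have e1 : ∀ X, v X • ∇ (fun X => φ X * ψ X) X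
      = (v X * φ X) • ∇ ψ X + ψ X • (v X • ∇ φ X) := by
    intro X
    rw [gradient_mul h1 p1, smul_add, smul_smul, smul_smul, smul_smul, mul_comm (ψ X)]
  have e2 : ∀ X, (φ X * ψ X) • G X = ψ X • (φ X • G X) := by
    intro X; rw [smul_smul, mul_comm]
  simp only [e1, e2] at hq
  rw [integral_add i1 i2] at hq
  simp only [smul_add]
  rw [integral_add i3 i2, neg_add, ← hq]
  abel

/-- The radial cut-off `∫_{|X - X₀|}^R g`; it is smooth because `g` vanishes near `0`. -/
noncomputable def radialCutoff (X₀ : Space N) (R : ℝ) (g : ℝ → ℝ) (X : Space N) : ℝ :=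
  ∫ t in ‖X - X₀‖..R, g t

/-- The radial cut-off is an admissible test function with radial derivative `-g`. -/
theorem radialCutoff_properties (X₀ : Space N) {R : ℝ} (hR : 0 < R) {g : ℝ → ℝ}
    (h1 : ContDiff ℝ ∞ g) (h2 : HasCompactSupport g) (h3 : tsupport g ⊆ Ioo 0 R)
    (h4 : ∀ r, 0 ≤ g r) :
    ContDiff ℝ ∞ (radialCutoff X₀ R g) ∧ HasCompactSupport (radialCutoff X₀ R g) ∧
      tsupport (radialCutoff X₀ R g) ⊆ ball X₀ R ∧ (∀ X, 0 ≤ radialCutoff X₀ R g X) ∧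
      ∀ r > 0, ∀ ξ : Sph N, ∇ (radialCutoff X₀ R g) (polar X₀ (r, ξ)) = -g r • (ξ : Space N) := by
  obtain ⟨p, q, hp, hpq, hq, hsub⟩ := exists_Ioo_superset_of_isCompact h2 hR h3
  have hz : ∀ t, t ∉ Ioo p q → g t = 0 := fun t ht =>
    image_eq_zero_of_notMem_tsupport fun h => ht (hsub h)
  have hsym : ∀ r, ∫ t in r..R, g t = -∫ t in R..r, g t := fun r =>
    intervalIntegral.integral_symm _ _
  have hf : ContDiff ℝ ∞ (fun r => ∫ t in r..R, g t) := by
    simp only [hsym]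
    exact (contDiff_primitive h1 R).1.neg
  have hf' : ∀ r, HasDerivAt (fun r => ∫ t in r..R, g t) (-g r) r := by
    simp only [hsym]
    exact fun r => ((contDiff_primitive h1 R).2 r).fun_neg
  have hvan : ∀ a b, (∀ t ∈ uIoc a b, t ∉ Ioo p q) → ∫ t in a..b, g t = 0 := by
    intro a b hab
    rw [intervalIntegral.integral_congr_ae (g := fun _ => (0:ℝ))
      (Eventually.of_forall fun t ht => hz t (hab t ht))]
    simp
  have hout : ∀ r, q ≤ r → ∫ t in r..R, g t = 0 := by
    intro r hr
    refine hvan _ _ fun t ht ht' => ?_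
    rw [uIoc, mem_Ioc] at ht
    have : q < t := (le_min hr hq.le).trans_lt ht.1
    linarith [ht'.2]
  have hin : ∀ r, r ≤ p → ∫ t in r..R, g t = ∫ t in p..R, g t := by
    intro r hr
    rw [← intervalIntegral.integral_add_adjacent_intervals
      (h1.continuous.intervalIntegrable r p) (h1.continuous.intervalIntegrable p R), hvan r p,
      zero_add]
    intro t ht ht'
    rw [uIoc_of_le hr] at ht
    linarith [ht.2, ht'.1]
  have hsupp : Function.support (radialCutoff X₀ R g) ⊆ closedBall X₀ q := by
    intro X hX
    by_contra h
    rw [mem_closedBall_iff_norm, not_le] at h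
    exact hX (hout _ h.le)
  refine ⟨?_, HasCompactSupport.of_support_subset_isCompact (isCompact_closedBall _ _) hsupp,
    (closure_minimal hsupp isClosed_closedBall).trans (closedBall_subset_ball hq), ?_, ?_⟩
  · rw [contDiff_iff_contDiffAt]
    intro X
    by_cases hX : X = X₀
    · have hev : radialCutoff X₀ R g =ᶠ[𝓝 X] fun _ => ∫ t in p..R, g t := by
        filter_upwards [ball_mem_nhds X hp] with Y hY
        rw [hX, mem_ball_iff_norm] at hY
        exact hin _ hY.le
      exact contDiffAt_const.congr_of_eventuallyEq hev
    · exact hf.contDiffAt.comp X ((contDiffAt_id.sub contDiffAt_const).norm ℝ (sub_ne_zero.2 hX))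
  · intro X
    rcases le_or_gt ‖X - X₀‖ R with h | h
    · exact intervalIntegral.integral_nonneg h fun t _ => h4 t
    · exact (hout _ (hq.trans h).le).ge
  · intro r hr ξ
    have hs : HasFDerivAt (fun X : Space N => X - X₀) (ContinuousLinearMap.id ℝ (Space N))
        (polar X₀ (r, ξ)) := (hasFDerivAt_id _).sub_const X₀
    have hn : HasFDerivAt (fun X : Space N => ‖X - X₀‖) (innerSL ℝ (ξ : Space N))
        (polar X₀ (r, ξ)) := by
      have := hasFDerivAt_norm_polar ξ hr
      rw [← polar_sub X₀] at this
      exact this.comp (polar X₀ (r, ξ)) hs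
    have hd : HasDerivAt (fun r => ∫ t in r..R, g t) (-g r) ‖polar X₀ (r, ξ) - X₀‖ := by
      rw [norm_polar_sub X₀ hr]; exact hf' r
    have hfin : HasFDerivAt (radialCutoff X₀ R g) (-g r • innerSL ℝ (ξ : Space N))
        (polar X₀ (r, ξ)) := by
      change HasFDerivAt ((fun r => ∫ t in r..R, g t) ∘ fun X => ‖X - X₀‖) _ _
      exact hd.comp_hasFDerivAt (polar X₀ (r, ξ)) hn
    refine ext_inner_right ℝ fun w => ?_
    rw [inner_gradient_left, hfin.fderiv, inner_smul_left]
    simp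

namespace FiniteEnergy

variable {s R : ℝ} {X₀ : Space N} {v : Space N → ℝ} {G : Space N → Space N}

/-- The weighted integral of `|∇v|²` over the half sphere of radius `r` around `X₀`, rescaled to
radius one. -/
noncomputable def sphereEnergy (s : ℝ) (X₀ : Space N) (G : Space N → Space N) (r : ℝ) : ℝ :=
  ∫ ξ : Sph N, weight s (ξ : Space N) * ‖G (polar X₀ (r, ξ))‖ ^ 2 ∂(surfPos N)

theorem ae_weight_nonneg (s : ℝ) : ∀ᵐ ξ : Sph N ∂(surfPos N), 0 ≤ weight s (ξ : Space N) := by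
  filter_upwards [ae_surfPos_mem N] with ξ hξ
  exact (weight_pos (s := s) (show 0 < yCoord (ξ : Space N) from hξ)).le

theorem sphereEnergy_nonneg (s : ℝ) (X₀ : Space N) (G : Space N → Space N) (r : ℝ) :
    0 ≤ sphereEnergy s X₀ G r :=
  integral_nonneg_of_ae ((ae_weight_nonneg s).mono fun _ hξ => mul_nonneg hξ (sq_nonneg _))

theorem sphereMass_nonneg (s : ℝ) (X₀ : Space N) (v : Space N → ℝ) (r : ℝ) :
    0 ≤ sphereMass s X₀ v r :=
  integral_nonneg_of_ae ((ae_weight_nonneg s).mono fun _ hξ => mul_nonneg hξ (sq_nonneg _))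

theorem integrable_energy_cyl (h : FiniteEnergy s X₀ R v G) :
    Integrable (fun p : ℝ × Sph N => p.1 ^ ((N : ℝ) - 2 * s + 1) *
      (weight s (p.2 : Space N) * ‖G (polar X₀ p)‖ ^ 2)) (cyl N R) := by
  refine h.integrable_cyl.mono' ?_ ?_
  · exact (by fun_prop : Measurable fun p : ℝ × Sph N =>
      p.1 ^ ((N : ℝ) - 2 * s + 1)).aestronglyMeasurable.mul
      ((aestronglyMeasurable_weight s).comp_snd.mul (h.aestronglyMeasurable_grad_polar.norm.pow 2))
  · filter_upwards [ae_cyl_mem N R] with p hp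
    have hw := (weight_pos (s := s) (show 0 < yCoord (p.2 : Space N) from hp.2)).le
    have hr := Real.rpow_nonneg hp.1.1.le ((N : ℝ) - 2 * s + 1)
    rw [Real.norm_of_nonneg (mul_nonneg hr (mul_nonneg hw (sq_nonneg _)))]
    exact mul_le_mul_of_nonneg_left
      (mul_le_mul_of_nonneg_left (by linarith [sq_nonneg (v (polar X₀ p))]) hw) hr

theorem integrable_flux_cyl (h : FiniteEnergy s X₀ R v G) :
    Integrable (fun p : ℝ × Sph N => p.1 ^ ((N : ℝ) - 2 * s + 1) * (weight s (p.2 : Space N) *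
      (v (polar X₀ p) * ⟪G (polar X₀ p), (p.2 : Space N)⟫_ℝ))) (cyl N R) := by
  refine h.integrable_cyl.mono' ?_ ?_
  · exact (by fun_prop : Measurable fun p : ℝ × Sph N =>
      p.1 ^ ((N : ℝ) - 2 * s + 1)).aestronglyMeasurable.mul
      ((aestronglyMeasurable_weight s).comp_snd.mul (h.aestronglyMeasurable_polar.mul
        (h.aestronglyMeasurable_grad_polar.inner (𝕜 := ℝ)
          (continuous_subtype_val.comp continuous_snd).aestronglyMeasurable)))
  · filter_upwards [ae_cyl_mem N R] with p hp
    have hw := (weight_pos (s := s) (show 0 < yCoord (p.2 : Space N) from hp.2)).le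
    have hr := Real.rpow_nonneg hp.1.1.le ((N : ℝ) - 2 * s + 1)
    rw [norm_mul, norm_mul, Real.norm_of_nonneg hr, Real.norm_of_nonneg hw]
    exact mul_le_mul_of_nonneg_left (mul_le_mul_of_nonneg_left (abs_mul_inner_le _ _ _) hw) hr

theorem integrable_energy_slice {r : ℝ}
    (hG : AEStronglyMeasurable (fun ξ => G (polar X₀ (r, ξ))) (surfPos N))
    (hi : Integrable (fun ξ : Sph N => weight s (ξ : Space N) *
        (v (polar X₀ (r, ξ)) ^ 2 + ‖G (polar X₀ (r, ξ))‖ ^ 2)) (surfPos N)) :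
    Integrable (fun ξ : Sph N => weight s (ξ : Space N) * ‖G (polar X₀ (r, ξ))‖ ^ 2)
      (surfPos N) := by
  refine hi.mono' ((aestronglyMeasurable_weight s).mul (hG.norm.pow 2)) ?_
  filter_upwards [ae_weight_nonneg s] with ξ hw
  rw [Real.norm_of_nonneg (mul_nonneg hw (sq_nonneg _))]
  exact mul_le_mul_of_nonneg_left (by linarith [sq_nonneg (v (polar X₀ (r, ξ)))]) hw

theorem integrable_flux_slice (h : FiniteEnergy s X₀ R v G) {r : ℝ} (hr : r ∈ Ioo 0 R)
    (hG : AEStronglyMeasurable (fun ξ => G (polar X₀ (r, ξ))) (surfPos N))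
    (hi : Integrable (fun ξ : Sph N => weight s (ξ : Space N) *
        (v (polar X₀ (r, ξ)) ^ 2 + ‖G (polar X₀ (r, ξ))‖ ^ 2)) (surfPos N)) :
    Integrable (fun ξ : Sph N => weight s (ξ : Space N) *
      (v (polar X₀ (r, ξ)) * ⟪G (polar X₀ (r, ξ)), (ξ : Space N)⟫_ℝ)) (surfPos N) := by
  have hvm : AEStronglyMeasurable (fun ξ => v (polar X₀ (r, ξ))) (surfPos N) :=
    ((h.continuousOn_slice hr).mono hemisphere_subset).aestronglyMeasurable
      isOpen_hemisphere.measurableSet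
  refine hi.mono' ((aestronglyMeasurable_weight s).mul (hvm.mul (hG.inner (𝕜 := ℝ)
    continuous_subtype_val.aestronglyMeasurable))) ?_
  filter_upwards [ae_weight_nonneg s] with ξ hw
  rw [norm_mul, Real.norm_of_nonneg hw]
  exact mul_le_mul_of_nonneg_left (abs_mul_inner_le _ _ _) hw

/-- The inequality `∫ y^a ∇v · ∇(v φ) ≤ 0` for the test functions `φ ≥ 0`, in terms of a weak
gradient `G` of `v`: `∇(v φ) = φ G + v ∇φ`. -/
def IsSubsolution (s : ℝ) (X₀ : Space N) (R : ℝ) (v : Space N → ℝ) (G : Space N → Space N) : Prop :=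
  ∀ φ : Space N → ℝ, ContDiff ℝ ∞ φ → HasCompactSupport φ → tsupport φ ⊆ ball X₀ R →
    (∀ X, 0 ≤ φ X) →
    ∫ X in halfBall X₀ R, weight s X * ⟪G X, φ X • G X + v X • ∇ φ X⟫_ℝ ≤ 0

/-- The differential inequality tested with a radial function. -/
theorem radial_inequality (h : FiniteEnergy s X₀ R v G) (hR : 0 < R)
    (hsub : IsSubsolution s X₀ R v G) {g : ℝ → ℝ}
    (h1 : ContDiff ℝ ∞ g) (h2 : HasCompactSupport g) (h3 : tsupport g ⊆ Ioo 0 R)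
    (h4 : ∀ r, 0 ≤ g r) :
    ∫ r in Ioo 0 R, ((∫ t in r..R, g t) * (r ^ ((N : ℝ) - 2 * s + 1) * sphereEnergy s X₀ G r)
      - g r * (r ^ ((N : ℝ) - 2 * s + 1) * sphereFlux s X₀ v G r)) ≤ 0 := by
  obtain ⟨c1, c2, c3, c4, c5⟩ := radialCutoff_properties X₀ hR h1 h2 h3 h4
  have hle := hsub _ c1 c2 c3 c4
  have hGm : AEStronglyMeasurable G (volume.restrict (halfBall X₀ R)) :=
    h.weakGrad.2.1.aestronglyMeasurable
  have hvm : AEStronglyMeasurable v (volume.restrict (halfBall X₀ R)) :=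
    h.weakGrad.1.aestronglyMeasurable
  have hwm : AEStronglyMeasurable (weight s) (volume.restrict (halfBall X₀ R)) :=
    (by unfold weight; exact continuous_yCoord.measurable.pow_const _ :
      Measurable (weight (N := N) s)).aestronglyMeasurable
  have hmeas : AEStronglyMeasurable (fun X => weight s X *
      ⟪G X, radialCutoff X₀ R g X • G X + v X • ∇ (radialCutoff X₀ R g) X⟫_ℝ)
      (volume.restrict (halfBall X₀ R)) :=
    hwm.mul (hGm.inner (𝕜 := ℝ) ((c1.continuous.aestronglyMeasurable.smul hGm).add
      (hvm.smul (continuous_gradient c1).aestronglyMeasurable)))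
  rw [setIntegral_halfBall_eq_cyl h.flat hmeas] at hle
  have hfc : Continuous (fun r => ∫ t in r..R, g t) := by
    have : (fun r => ∫ t in r..R, g t) = fun r => -∫ t in R..r, g t :=
      funext fun r => intervalIntegral.integral_symm _ _
    rw [this]
    exact (contDiff_primitive h1 R).1.continuous.neg
  obtain ⟨M, hM⟩ := (isCompact_Icc (a := 0) (b := R)).exists_bound_of_continuousOn hfc.continuousOn
  obtain ⟨M', hM'⟩ := h2.exists_bound_of_continuous h1.continuous
  have i1 : Integrable (fun p : ℝ × Sph N => (∫ t in p.1..R, g t) *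
      (p.1 ^ ((N : ℝ) - 2 * s + 1) * (weight s (p.2 : Space N) * ‖G (polar X₀ p)‖ ^ 2)))
      (cyl N R) := by
    refine h.integrable_energy_cyl.bdd_mul (c := M)
      (hfc.comp continuous_fst).aestronglyMeasurable ?_
    filter_upwards [ae_cyl_mem N R] with p hp
    exact hM _ ⟨hp.1.1.le, hp.1.2.le⟩
  have i2 : Integrable (fun p : ℝ × Sph N => g p.1 * (p.1 ^ ((N : ℝ) - 2 * s + 1) *
      (weight s (p.2 : Space N) * (v (polar X₀ p) * ⟪G (polar X₀ p), (p.2 : Space N)⟫_ℝ))))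
      (cyl N R) :=
    h.integrable_flux_cyl.bdd_mul (c := M') (h1.continuous.comp continuous_fst).aestronglyMeasurable
      (Eventually.of_forall fun p => hM' _)
  have e : ∫ p, p.1 ^ N • (weight s (polar X₀ p) * ⟪G (polar X₀ p),
      radialCutoff X₀ R g (polar X₀ p) • G (polar X₀ p)
        + v (polar X₀ p) • ∇ (radialCutoff X₀ R g) (polar X₀ p)⟫_ℝ) ∂(cyl N R) =
      ∫ p : ℝ × Sph N, ((∫ t in p.1..R, g t) *
        (p.1 ^ ((N : ℝ) - 2 * s + 1) * (weight s (p.2 : Space N) * ‖G (polar X₀ p)‖ ^ 2)) -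
        g p.1 * (p.1 ^ ((N : ℝ) - 2 * s + 1) * (weight s (p.2 : Space N) *
          (v (polar X₀ p) * ⟪G (polar X₀ p), (p.2 : Space N)⟫_ℝ)))) ∂(cyl N R) := by
    refine integral_congr_ae ?_
    filter_upwards [ae_cyl_mem N R] with p hp
    have hw := weight_polar s h.flat hp.1.1 hp.2
    have hcut : radialCutoff X₀ R g (polar X₀ p) = ∫ t in p.1..R, g t := by
      rw [radialCutoff, show p = (p.1, p.2) from rfl, norm_polar_sub X₀ hp.1.1]
    have hg : ∇ (radialCutoff X₀ R g) (polar X₀ p) = -g p.1 • (p.2 : Space N) :=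
      c5 p.1 hp.1.1 p.2
    rw [hcut, hg, smul_eq_mul, ← mul_assoc, hw, inner_add_right, inner_smul_right,
      inner_smul_right, inner_smul_right, real_inner_self_eq_norm_sq]
    ring
  have i3 := i1.sub i2
  rw [cyl] at i3
  rw [e] at hle
  replace hle := (integral_prod _ i3).symm.trans_le hle
  refine le_of_eq_of_le (integral_congr_ae ?_) hle
  filter_upwards [h.ae_slice, ae_restrict_mem measurableSet_Ioo] with r hgood hr
  have j1 := integrable_energy_slice hgood.1 hgood.2
  have j2 := h.integrable_flux_slice hr hgood.1 hgood.2
  simp only [Pi.sub_apply]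
  rw [integral_sub ((j1.const_mul _).const_mul _) ((j2.const_mul _).const_mul _),
    integral_const_mul, integral_const_mul, integral_const_mul, integral_const_mul]
  rfl

/-- Finiteness of the weighted energy, and its bound by boundary terms on almost every sphere. -/
theorem energy_le (h : FiniteEnergy s X₀ R v G) (hR : 0 < R) (hm : 0 < (N : ℝ) - 2 * s)
    (hsub : IsSubsolution s X₀ R v G) :
    (∀ ρ ∈ Ioo 0 R, IntegrableOn (fun r => r * sphereEnergy s X₀ G r) (Ioc 0 ρ)) ∧
    ∀ᵐ ρ ∂(volume.restrict (Ioo 0 R)), ∫ r in (0:ℝ)..ρ, r * sphereEnergy s X₀ G r ≤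
      ρ * sphereFlux s X₀ v G ρ + ((N : ℝ) - 2 * s) / 2 * sphereMass s X₀ v ρ := by
  set m : ℝ := (N : ℝ) - 2 * s with hmdef
  have hD : IntegrableOn (fun r => r ^ (m + 1) * sphereEnergy s X₀ G r) (Ioo 0 R) := by
    have := h.integrable_energy_cyl.integral_prod_left
    simp only [integral_const_mul] at this
    exact this
  have hE : IntegrableOn (fun r => r ^ (m + 1) * sphereFlux s X₀ v G r) (Ioo 0 R) := by
    have := h.integrable_flux_cyl.integral_prod_left
    simp only [integral_const_mul] at this
    exact this
  have hDE := ae_integral_le_of_forall_smooth hR hD hE fun g h1 h2 h3 h4 =>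
    h.radial_inequality hR hsub h1 h2 h3 h4
  have hcancel : ∀ r : ℝ, 0 < r → ∀ x : ℝ, r ^ (-m - 1) * (r ^ (m + 1) * x) = x := by
    intro r hr x
    rw [← mul_assoc, ← Real.rpow_add hr]
    simp
  have hcancel' : ∀ r : ℝ, 0 < r → ∀ x : ℝ, r ^ (-m) * (r ^ (m + 1) * x) = r * x := by
    intro r hr x
    rw [← mul_assoc, ← Real.rpow_add hr]
    simp
  obtain ⟨h1, h2⟩ := weighted_energy_le hm hD hE
    (fun r hr => mul_nonneg (Real.rpow_nonneg hr.1.le _) (sphereEnergy_nonneg s X₀ G r))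
    (fun r _ => sphereMass_nonneg s X₀ v r) hDE (by
      intro a ha b hb
      rw [h.sphereMass_sub hm a ha b hb]
      refine intervalIntegral.integral_congr fun r hr => ?_
      have hr0 : 0 < r := (ordConnected_Ioo.uIcc_subset ha hb hr).1
      simp only [hcancel r hr0])
  refine ⟨fun ρ hρ => (h1 ρ hρ).congr_fun (fun r hr => hcancel' r hr.1 _) measurableSet_Ioc, ?_⟩
  filter_upwards [h2, ae_restrict_mem measurableSet_Ioo] with ρ hρ hρR
  rw [hcancel' ρ hρR.1] at hρ
  refine le_of_eq_of_le ?_ hρ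
  rw [intervalIntegral.integral_of_le hρR.1.le, intervalIntegral.integral_of_le hρR.1.le]
  exact setIntegral_congr_fun measurableSet_Ioc fun r hr => (hcancel' r hr.1 _).symm

end FiniteEnergy

/-! ### The spectral inequality on spheres -/

theorem setIntegral_weight_mul_sq_nonneg (s : ℝ) (f : Sph N → ℝ) :
    0 ≤ ∫ ξ in hemisphere N, weight s (ξ : Space N) * f ξ ^ 2 ∂(surf N) :=
  setIntegral_nonneg isOpen_hemisphere.measurableSet fun ξ hξ =>
    mul_nonneg (weight_pos (show 0 < yCoord (ξ : Space N) from hξ)).le (sq_nonneg _)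

theorem lambda1_nonneg (s : ℝ) (W : Set (Equator N)) : 0 ≤ lambda1 s W := by
  refine Real.sInf_nonneg ?_
  rintro q ⟨u, -, -, hpos, rfl⟩
  exact div_nonneg (setIntegral_weight_mul_sq_nonneg s fun ξ => ‖tangGrad u ξ‖) hpos.le

/-- A function that is continuous up to the equator is a competitor for `λ_1^s` of the set where its
trace does not vanish. -/
theorem lambda1_mul_integral_le {s : ℝ} {u : Sph N → ℝ} {T : Sph N → Space N}
    (hu : ContinuousOn u (closedHemisphere N)) (hT : IsWeakTangGrad u T)
    (hi : Integrable (fun ξ : Sph N => weight s (ξ : Space N) * (u ξ ^ 2 + ‖T ξ‖ ^ 2))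
      (surfPos N)) :
    lambda1 s {ζ : Equator N | u ζ ≠ 0} *
      ∫ ξ : Sph N, weight s (ξ : Space N) * u ξ ^ 2 ∂(surfPos N) ≤
      ∫ ξ : Sph N, weight s (ξ : Space N) * ‖T ξ‖ ^ 2 ∂(surfPos N) := by
  have hex : ∃ T, IsWeakTangGrad u T := ⟨T, hT⟩
  have hae := (isWeakTangGrad_tangGrad hex).ae_eq hT
  have hint : ∫ ξ : Sph N, weight s (ξ : Space N) * ‖tangGrad u ξ‖ ^ 2 ∂(surfPos N) =
      ∫ ξ : Sph N, weight s (ξ : Space N) * ‖T ξ‖ ^ 2 ∂(surfPos N) :=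
    integral_congr_ae (hae.mono fun ξ hξ => by simp only [hξ])
  have hmem : MemH1aSph s u :=
    ⟨hex, hi.congr (hae.mono fun ξ hξ => by simp only [hξ])⟩
  have hvan : VanishesOff s {ζ : Equator N | u ζ ≠ 0} u :=
    ⟨fun _ => u, fun _ => ⟨hmem, hu, fun ξ hξ => not_not.1 hξ⟩, by simp⟩
  -- `u` itself serves as the approximating sequence, as it is continuous up to the equator. If the
  -- mass of `u` vanishes there is no Rayleigh quotient, and nothing to prove.
  rcases (setIntegral_weight_mul_sq_nonneg s u).eq_or_lt with h0 | hpos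
  · rw [surfPos, ← h0, mul_zero]
    exact setIntegral_weight_mul_sq_nonneg s fun ξ => ‖T ξ‖
  · rw [surfPos] at hint ⊢
    rw [← le_div_iff₀ hpos, ← hint]
    refine csInf_le ⟨0, ?_⟩ ⟨u, hmem, hvan, hpos, rfl⟩
    rintro q ⟨w, -, -, hw, rfl⟩
    exact div_nonneg (setIntegral_weight_mul_sq_nonneg s fun ξ => ‖tangGrad w ξ‖) hw.le

theorem gam_nonneg {s t : ℝ} (ht : 0 ≤ t) : 0 ≤ gam N s t := by
  rw [gam, sub_nonneg]
  exact Real.le_sqrt_of_sq_le (by linarith)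

/-- `γ(t)` is the positive degree `γ` for which `r^γ u(ξ)` solves the equation `div(y^a ∇·) = 0` when
`u` is an eigenfunction on the half sphere with eigenvalue `t`. -/
theorem gam_sq_add {s t : ℝ} (ht : 0 ≤ t) :
    gam N s t ^ 2 + ((N : ℝ) - 2 * s) * gam N s t = t := by
  have h := Real.sq_sqrt (add_nonneg (sq_nonneg (((N : ℝ) - 2 * s) / 2)) ht)
  rw [gam]
  linear_combination h

theorem nuACF_le {s : ℝ} {W₁ W₂ : Set (Equator N)} (h₁ : IsOpen W₁)
    (h₂ : IsOpen W₂) (hd : Disjoint W₁ W₂) :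
    2 * nuACF N s ≤ gam N s (lambda1 s W₁) + gam N s (lambda1 s W₂) := by
  have : nuACF N s ≤ (gam N s (lambda1 s W₁) + gam N s (lambda1 s W₂)) / 2 := by
    refine csInf_le ⟨0, ?_⟩ ⟨W₁, W₂, h₁, h₂, hd, rfl⟩
    rintro q ⟨V₁, V₂, -, -, -, rfl⟩
    have e₁ := gam_nonneg (N := N) (s := s) (lambda1_nonneg s V₁)
    have e₂ := gam_nonneg (N := N) (s := s) (lambda1_nonneg s V₂)
    linarith
  linarith

theorem norm_sq_smul_sub_inner_smul (r : ℝ) (Z : Space N) (ξ : Sph N) :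
    ‖r • (Z - ⟪Z, (ξ : Space N)⟫_ℝ • (ξ : Space N))‖ ^ 2 =
      r ^ 2 * (‖Z‖ ^ 2 - ⟪Z, (ξ : Space N)⟫_ℝ ^ 2) := by
  rw [norm_smul, mul_pow, Real.norm_eq_abs, sq_abs, norm_sub_sq_real, inner_smul_right, norm_smul,
    norm_sph, mul_one, Real.norm_eq_abs, sq_abs]
  ring

namespace FiniteEnergy

variable {s R : ℝ} {X₀ : Space N} {v : Space N → ℝ} {G : Space N → Space N}

/-- The part of the equator where the rescaled function `v(X₀ + r ·)` does not vanish. -/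
def traceSupport (X₀ : Space N) (v : Space N → ℝ) (r : ℝ) : Set (Equator N) :=
  {ζ | v (polar X₀ (r, ζ)) ≠ 0}

theorem isOpen_traceSupport (h : FiniteEnergy s X₀ R v G) {r : ℝ} (hr : r ∈ Ioo 0 R) :
    IsOpen (traceSupport X₀ v r) := by
  have hc : Continuous fun ζ : Equator N => v (polar X₀ (r, ζ)) :=
    (h.continuousOn_slice hr).comp_continuous continuous_subtype_val fun ζ => ζ.2.ge
  exact isOpen_ne_fun hc continuous_const

/-- The inequality `2 γ J ≤ r J'`: the tangential part of the energy on a sphere is bounded from below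
by the first eigenvalue, the radial part by the flux, and the flux controls `J` by `energy_le`. -/
theorem two_gam_mul_integral_le (h : FiniteEnergy s X₀ R v G) (hR : 0 < R)
    (hm : 0 < (N : ℝ) - 2 * s) (hsub : IsSubsolution s X₀ R v G) :
    ∀ᵐ r ∂(volume.restrict (Ioo 0 R)),
      2 * gam N s (lambda1 s (traceSupport X₀ v r)) *
        ∫ t in (0:ℝ)..r, t * sphereEnergy s X₀ G t ≤ r * (r * sphereEnergy s X₀ G r) := by
  filter_upwards [(h.energy_le hR hm hsub).2, h.ae_isWeakTangGrad, h.ae_slice,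
    ae_restrict_mem measurableSet_Ioo] with r hJ hT hgood hr
  have jE := integrable_energy_slice hgood.1 hgood.2
  have jF := h.integrable_flux_slice hr hgood.1 hgood.2
  have jM := h.integrable_sq_slice hr hgood.2
  have jN : Integrable (fun ξ : Sph N => weight s (ξ : Space N) *
      ⟪G (polar X₀ (r, ξ)), (ξ : Space N)⟫_ℝ ^ 2) (surfPos N) := by
    refine jE.mono' ((aestronglyMeasurable_weight s).mul ((hgood.1.inner (𝕜 := ℝ)
      continuous_subtype_val.aestronglyMeasurable).pow 2)) ?_
    filter_upwards [ae_weight_nonneg s] with ξ hw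
    rw [Real.norm_of_nonneg (mul_nonneg hw (sq_nonneg _))]
    refine mul_le_mul_of_nonneg_left ?_ hw
    rw [← sq_abs]
    exact pow_le_pow_left₀ (abs_nonneg _) (abs_inner_sph_le _ _) 2
  have eT : ∀ ξ : Sph N, weight s (ξ : Space N) * ‖r • (G (polar X₀ (r, ξ)) -
      ⟪G (polar X₀ (r, ξ)), (ξ : Space N)⟫_ℝ • (ξ : Space N))‖ ^ 2 =
      r ^ 2 * (weight s (ξ : Space N) * ‖G (polar X₀ (r, ξ))‖ ^ 2) -
      r ^ 2 * (weight s (ξ : Space N) * ⟪G (polar X₀ (r, ξ)), (ξ : Space N)⟫_ℝ ^ 2) := by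
    intro ξ
    rw [norm_sq_smul_sub_inner_smul]
    ring
  have hspec := lambda1_mul_integral_le (s := s) (h.continuousOn_slice hr) hT (by
    simp only [mul_add, eT]
    exact jM.add ((jE.const_mul _).sub (jN.const_mul _)))
  simp only [eT] at hspec
  rw [integral_sub (jE.const_mul _) (jN.const_mul _), integral_const_mul, integral_const_mul]
    at hspec
  change lambda1 s (traceSupport X₀ v r) * sphereMass s X₀ v r ≤
    r ^ 2 * sphereEnergy s X₀ G r - _ at hspec
  set A := ∫ ξ : Sph N, weight s (ξ : Space N) *
      ⟪G (polar X₀ (r, ξ)), (ξ : Space N)⟫_ℝ ^ 2 ∂(surfPos N)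
  have hl := lambda1_nonneg s (traceSupport X₀ v r)
  have hg := gam_nonneg (N := N) (s := s) hl
  have hgs := gam_sq_add (N := N) (s := s) hl
  set γ := gam N s (lambda1 s (traceSupport X₀ v r))
  have hflux : 2 * γ * r * sphereFlux s X₀ v G r ≤ r ^ 2 * A + γ ^ 2 * sphereMass s X₀ v r := by
    rw [sphereFlux, sphereMass, ← integral_const_mul, ← integral_const_mul, ← integral_const_mul,
      ← integral_add (jN.const_mul _) (jM.const_mul _)]
    refine integral_mono_ae (jF.const_mul _) ((jN.const_mul _).add (jM.const_mul _)) ?_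
    filter_upwards [ae_weight_nonneg s] with ξ hw
    have := mul_nonneg hw (sq_nonneg
      (r * ⟪G (polar X₀ (r, ξ)), (ξ : Space N)⟫_ℝ - γ * v (polar X₀ (r, ξ))))
    linarith
  have h1 := mul_le_mul_of_nonneg_left hJ hg
  rw [← hgs] at hspec
  linarith

theorem weight_polar_mul_div {X₀ : Space N} (h₀ : yCoord X₀ = 0) (G : Space N → Space N)
    {p : ℝ × Sph N} (hp : 0 < p.1) (hξ : p.2 ∈ hemisphere N) :
    p.1 ^ N • (weight s (polar X₀ p) *
      (‖G (polar X₀ p)‖ ^ 2 / ‖polar X₀ p - X₀‖ ^ ((N : ℝ) - 2 * s))) =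
      p.1 * (weight s (p.2 : Space N) * ‖G (polar X₀ p)‖ ^ 2) := by
  have hpos := Real.rpow_pos_of_pos hp ((N : ℝ) - 2 * s)
  rw [show polar X₀ p = polar X₀ (p.1, p.2) from rfl, norm_polar_sub X₀ hp, smul_eq_mul,
    ← mul_assoc, weight_polar s h₀ hp hξ, Real.rpow_add_one hp.ne']
  field_simp

/-- The energy with the singular weight in polar coordinates: the Jacobian, the weight `y^a` and the
factor `|X - X₀|^{2s-N}` leave a single power of the radius. -/
theorem integrableOn_and_setIntegral_eq (h : FiniteEnergy s X₀ R v G)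
    {r : ℝ} (hr : r ∈ Ioo 0 R)
    (hi : IntegrableOn (fun t => t * sphereEnergy s X₀ G t) (Ioc 0 r)) :
    IntegrableOn (fun X => weight s X * (‖G X‖ ^ 2 / ‖X - X₀‖ ^ ((N : ℝ) - 2 * s)))
      (halfBall X₀ r) ∧
    ∫ X in halfBall X₀ r, weight s X * (‖G X‖ ^ 2 / ‖X - X₀‖ ^ ((N : ℝ) - 2 * s)) =
      ∫ t in (0:ℝ)..r, t * sphereEnergy s X₀ G t := by
  have hsubset : halfBall X₀ r ⊆ halfBall X₀ R := inter_subset_inter_left _ (ball_subset_ball hr.2.le)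
  have hle : cyl N r ≤ cyl N R :=
    Measure.prod_mono (Measure.restrict_mono (Ioo_subset_Ioo_right hr.2.le) le_rfl) le_rfl
  have hw : Measurable (weight (N := N) s) := by
    unfold weight; exact continuous_yCoord.measurable.pow_const _
  have hmeas : AEStronglyMeasurable
      (fun X => weight s X * (‖G X‖ ^ 2 / ‖X - X₀‖ ^ ((N : ℝ) - 2 * s)))
      (volume.restrict (halfBall X₀ r)) := by
    have hGm : AEMeasurable G (volume.restrict (halfBall X₀ r)) :=
      (h.weakGrad.2.1.aestronglyMeasurable.mono_measure
        (Measure.restrict_mono hsubset le_rfl)).aemeasurable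
    exact (hw.aemeasurable.mul ((hGm.norm.pow_const 2).div
      ((by fun_prop : Measurable fun X : Space N =>
        ‖X - X₀‖ ^ ((N : ℝ) - 2 * s)).aemeasurable))).aestronglyMeasurable
  have hgm : AEStronglyMeasurable (fun p : ℝ × Sph N =>
      p.1 * (weight s (p.2 : Space N) * ‖G (polar X₀ p)‖ ^ 2)) (cyl N r) :=
    (continuous_fst.aestronglyMeasurable.mul ((aestronglyMeasurable_weight s).comp_snd.mul
      (h.aestronglyMeasurable_grad_polar.norm.pow 2))).mono_measure hle
  have hgi : Integrable (fun p : ℝ × Sph N =>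
      p.1 * (weight s (p.2 : Space N) * ‖G (polar X₀ p)‖ ^ 2)) (cyl N r) := by
    rw [cyl, integrable_prod_iff hgm]
    constructor
    · filter_upwards [ae_mono (Measure.restrict_mono (Ioo_subset_Ioo_right hr.2.le) le_rfl)
        h.ae_slice] with t ht
      exact (integrable_energy_slice ht.1 ht.2).const_mul t
    · refine (hi.mono_set Ioo_subset_Ioc_self).congr ?_
      filter_upwards [ae_restrict_mem measurableSet_Ioo] with t ht
      rw [sphereEnergy, ← integral_const_mul]
      refine integral_congr_ae ?_
      filter_upwards [ae_weight_nonneg s] with ξ hξ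
      rw [Real.norm_of_nonneg (mul_nonneg ht.1.le (mul_nonneg hξ (sq_nonneg _)))]
  have hae : (fun p : ℝ × Sph N => p.1 ^ N • (weight s (polar X₀ p) *
      (‖G (polar X₀ p)‖ ^ 2 / ‖polar X₀ p - X₀‖ ^ ((N : ℝ) - 2 * s)))) =ᵐ[cyl N r]
      fun p => p.1 * (weight s (p.2 : Space N) * ‖G (polar X₀ p)‖ ^ 2) := by
    filter_upwards [ae_cyl_mem N r] with p hp
    exact weight_polar_mul_div h.flat G hp.1.1 hp.2
  refine ⟨integrableOn_of_polar h.flat hmeas (hgi.congr hae.symm), ?_⟩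
  rw [setIntegral_halfBall_eq_cyl h.flat hmeas, integral_congr_ae hae]
  rw [cyl] at hgi ⊢
  rw [integral_prod _ hgi, intervalIntegral.integral_of_le hr.1.le, integral_Ioc_eq_integral_Ioo]
  simp only [integral_const_mul, sphereEnergy]

end FiniteEnergy

end FracACF

theorem mainTheorem5 (N : ℕ) (hN : 2 ≤ N) (s : ℝ) (hs₀ : 0 < s) (hs₁ : s < 1)
    (x₀ : EuclideanSpace ℝ (Fin N)) (R : ℝ) (hR : 0 < R) (v : Fin 2 → Space N → ℝ)
    (hv : ∀ i, MemH1a s (halfBall (flatPoint x₀) R) (v i))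
    (hcont : ∀ i, ContinuousOn (v i) (ball (flatPoint x₀) R ∩ {X | 0 ≤ yCoord X}))
    (hseg : ∀ X ∈ ball (flatPoint x₀) R, yCoord X = 0 → v 0 X * v 1 X = 0)
    (hzero : ∀ i, v i (flatPoint x₀) = 0)
    (hsub : ∀ i, ∀ φ : Space N → ℝ, ContDiff ℝ ∞ φ → HasCompactSupport φ →
      tsupport φ ⊆ ball (flatPoint x₀) R → (∀ X, 0 ≤ φ X) →
      ∫ X in halfBall (flatPoint x₀) R, weight s X *
        ⟪weakGrad (halfBall (flatPoint x₀) R) (v i) X,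
          weakGrad (halfBall (flatPoint x₀) R) (fun Z => v i Z * φ Z) X⟫_ℝ ≤ 0) :
    (∀ i, ∀ r ∈ Ioo 0 R,
      IntegrableOn (acfDensity s (halfBall (flatPoint x₀) R) (flatPoint x₀) (v i))
        (halfBall (flatPoint x₀) r)) ∧
    MonotoneOn
      (fun r : ℝ => ∏ i : Fin 2, 1 / r ^ (2 * nuACF N s) *
        ∫ X in halfBall (flatPoint x₀) r,
          acfDensity s (halfBall (flatPoint x₀) R) (flatPoint x₀) (v i) X)
      (Ioo 0 R) := by
  have hN' : (2 : ℝ) ≤ N := by exact_mod_cast hN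
  have hm : 0 < (N : ℝ) - 2 * s := by linarith
  set X₀ := flatPoint x₀
  set G : Fin 2 → Space N → Space N := fun i => weakGrad (halfBall X₀ R) (v i)
  have hfe : ∀ i, FiniteEnergy s X₀ R (v i) (G i) := fun i =>
    ⟨yCoord_flatPoint x₀, isWeakGrad_weakGrad (hv i).1, (hv i).2, hcont i⟩
  have hss : ∀ i, FiniteEnergy.IsSubsolution s X₀ R (v i) (G i) := by
    intro i φ h1 h2 h3 h4
    have hw := (hfe i).weakGrad.mul_contDiff (isOpen_halfBall X₀ R) h1
    have hae := (isWeakGrad_weakGrad ⟨_, hw⟩).ae_eq (isOpen_halfBall X₀ R) hw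
    refine le_of_eq_of_le (integral_congr_ae ?_) (hsub i φ h1 h2 h3 h4)
    filter_upwards [hae] with X hX
    rw [hX]
  set j : Fin 2 → ℝ → ℝ := fun i r => r * FiniteEnergy.sphereEnergy s X₀ (G i) r
  have hj : ∀ i, ∀ ρ ∈ Ioo 0 R, IntegrableOn (j i) (Ioc 0 ρ) := fun i =>
    ((hfe i).energy_le hR hm (hss i)).1
  have hpolar : ∀ i, ∀ r ∈ Ioo 0 R, _ := fun i r hr =>
    (hfe i).integrableOn_and_setIntegral_eq hr (hj i r hr)
  refine ⟨fun i r hr => (hpolar i r hr).1, ?_⟩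
  have hmono := monotoneOn_rpow_mul_integral (κ := 2 * nuACF N s) (hj 0) (hj 1) (by
    filter_upwards [(hfe 0).two_gam_mul_integral_le hR hm (hss 0),
      (hfe 1).two_gam_mul_integral_le hR hm (hss 1), ae_restrict_mem measurableSet_Ioo]
      with r h0 h1 hr
    have hdisj : Disjoint (FiniteEnergy.traceSupport X₀ (v 0) r)
        (FiniteEnergy.traceSupport X₀ (v 1) r) := by
      rw [Set.disjoint_left]
      intro ζ hζ₀ hζ₁
      have hmem := (hfe 0).polar_mem hr (ξ := ζ.1) ζ.2.ge
      have hy : yCoord (polar X₀ (r, ζ.1)) = 0 := by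
        rw [polar, yCoord_add, yCoord_smul, ζ.2, (hfe 0).flat, mul_zero, add_zero]
      exact mul_ne_zero hζ₀ hζ₁ (hseg _ hmem.1 hy)
    have hν := nuACF_le (s := s) ((hfe 0).isOpen_traceSupport hr)
      ((hfe 1).isOpen_traceSupport hr) hdisj
    have hnn : ∀ i, 0 ≤ ∫ t in (0:ℝ)..r, j i t := fun i =>
      intervalIntegral.integral_nonneg hr.1.le fun t ht =>
        mul_nonneg ht.1 (FiniteEnergy.sphereEnergy_nonneg s X₀ (G i) t)
    have e0 := mul_le_mul_of_nonneg_right h0 (hnn 1)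
    have e1 := mul_le_mul_of_nonneg_right h1 (hnn 0)
    have e2 := mul_le_mul_of_nonneg_right hν (mul_nonneg (hnn 0) (hnn 1))
    simp only [j] at e0 e1 e2 ⊢
    linarith)
  refine hmono.congr fun r hr => ?_
  rw [Fin.prod_univ_two]
  have hp := Real.rpow_pos_of_pos hr.1 (2 * nuACF N s)
  have e : r ^ (-(2 * (2 * nuACF N s))) =
      1 / r ^ (2 * nuACF N s) * (1 / r ^ (2 * nuACF N s)) := by
    rw [Real.rpow_neg hr.1.le, two_mul (2 * nuACF N s), Real.rpow_add hr.1]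
    field_simp
  have h0 := (hpolar 0 r hr).2
  have h1 := (hpolar 1 r hr).2
  simp only [acfDensity]
  change _ = 1 / r ^ (2 * nuACF N s) * (∫ X in halfBall X₀ r, weight s X *
    (‖G 0 X‖ ^ 2 / ‖X - X₀‖ ^ ((N : ℝ) - 2 * s))) * (1 / r ^ (2 * nuACF N s) *
    ∫ X in halfBall X₀ r, weight s X * (‖G 1 X‖ ^ 2 / ‖X - X₀‖ ^ ((N : ℝ) - 2 * s)))
  rw [h0, h1, e]
  ring
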